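/- **Definition (ALF space).** Let $(M,g)$ be a connected, complete, smooth Riemannian four-manifold without boundary (orientations, if given, play no role below). It is *asymptotically locally flat (ALF)* if there are * a compact set $K\subset M$, a connected compact smooth three-manifold $N$ without boundary, a smooth circle bundle $\pi:N\to B_\infty$ over a compact connected smooth surface $B_\infty$ (for instance a compact Riemann surface), and a diffeomorphism $\phi:N\times(0,\infty)\to M\setminus K$; * a smooth Riemannian metric $g_{B_\infty}$ on $B_\infty$, a smooth symmetric $2$-tensor $h_F$ on $N$ that is positive definite on the tangent lines of the fibres of $\pi$, and families $a_\rho=(\pi^*g_{B_\infty})'(\rho)$, $h'_\rho=h'_F(\rho)$, $\rho>0$, of symmetric $2$-tensors on $N$, depending smoothly on $(n,\rho)\in N\times(0,\infty)$, bounded as $\rho\to\infty$ with respect to a fixed metric on $N$, converging pointwise to $\pi^*g_{B_\infty}$ and $h_F$ as $\rho\to\infty$, and such that for every $\rho>0$ the tensor $a_\rho$ is positive semidefinite with $a_\rho(v,v)=0$ exactly when $d\pi(v)=0$, and $h'_\rho$ is positive definite on the tangent lines of the fibres, such that $\phi^*g=d\rho^2+\rho^2a_\rho+h'_\rho$ and,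 for every $k\ge 0$, the curvature satisfies $|\nabla^kR|=O(\rho^{-3-k})$ at $\phi(n,\rho)$ as $\rho\to\infty$, uniformly in $n\in N$. **Notation.** Let $s$ be the scalar curvature, $\Delta_0=\delta d$ the Laplacian on functions, and $dV$ the Riemannian volume. Fix a function $r:\mathbb R\to\mathbb R$ with $r(\rho)=\rho+O(1)$ as $\rho\to+\infty$ (for instance $r(\rho)=\rho$; the distance of $\phi(n,\rho)$ from a fixed point $x_0\in M$ differs from $\rho$ by a bounded amount) and, for large $\rho$, let $\overline M_\rho:=K\cup\phi\big(N\times(0,r(\rho)]\big)$ be the truncation of $M$, with boundary $\partial\overline M_\rho=\phi(N\times\{r(\rho)\})$. If $(e_1,\dots,e_4)$ is a smooth orthonormal frame field on an open set $U\subset M$ such that $e_4$ is orthogonal to $\partial\overline M_\rho$ at the points of $U\cap\partial\overline M_\rho$, put $\Pi_{ij}:=g(\nabla_{e_i}e_j,e_4)$ for $i,j=1,2,3$, with $\nabla$ the Levi-Civita connection. **Lemma (boundary contributions vanish).** Let $(M,g)$ be an ALF space and $\overline M_\rho$ its truncations. Then: 1. for all large $\rho$ the function $\Delta_0 s$ is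 integrable over $\overline M_\rho$, and $$\lim_{\rho\to+\infty}\int_{\overline M_\rho}\Delta_0 s\;dV=0;$$ 2. for any choice, for all large $\rho$, of a continuous unit normal field $e_4$ along $\partial\overline M_\rho$, the function $\nabla_{e_4}s=ds(e_4)$ is integrable over $\partial\overline M_\rho$ for all large $\rho$, and $$\lim_{\rho\to+\infty}\int_{\partial\overline M_\rho}\nabla_{e_4}s\;dV|_{\partial\overline M_\rho}=0;$$ 3. $\Pi_{ij}=O(\rho^{-1})$ for $i,j=1,2,3$: there are constants $C$ and $\rho_1>0$ such that, for all $\rho\ge\rho_1$, all frame fields as above and all points of $U\cap\partial\overline M_\rho$, one has $|\Pi_{ij}|\le C\rho^{-1}$. -/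

import Mathlib

open Set Filter Topology MeasureTheory Asymptotics Bundle
open scoped Manifold ContDiff

/-- The model space `ℝᵈ`. -/
abbrev Eucl (d : ℕ) : Type := EuclideanSpace ℝ (Fin d)

/-! ### Tensor calculus in coordinates -/

namespace Coord

noncomputable section

variable {d : ℕ}

/-- The `k`-th partial derivative. -/
def pd (k : Fin d) (f : Eucl d → ℝ) (y : Eucl d) : ℝ :=
  fderiv ℝ f y (EuclideanSpace.single k 1)

/-- Christoffel symbols `Γᵏᵢⱼ = ½ gᵏˡ (∂ᵢ gⱼₗ + ∂ⱼ gᵢₗ - ∂ₗ gᵢⱼ)` of the metric matrix `G`. -/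
def christoffel (G : Eucl d → Matrix (Fin d) (Fin d) ℝ) (k i j : Fin d) (y : Eucl d) : ℝ :=
  (1 / 2) * ∑ l, (G y)⁻¹ k l *
    (pd i (fun z => G z j l) y + pd j (fun z => G z i l) y - pd l (fun z => G z i j) y)

/-- `Rˡₖᵢⱼ`, the `∂ₗ`-component of `R(∂ᵢ, ∂ⱼ)∂ₖ = ∇ᵢ∇ⱼ∂ₖ - ∇ⱼ∇ᵢ∂ₖ`. -/
def riemannUp (G : Eucl d → Matrix (Fin d) (Fin d) ℝ) (l k i j : Fin d) (y : Eucl d) : ℝ :=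
  pd i (christoffel G l j k) y - pd j (christoffel G l i k) y
    + ∑ m, (christoffel G l i m y * christoffel G m j k y
      - christoffel G l j m y * christoffel G m i k y)

/-- The scalar curvature `s = gʲᵏ Rⁱₖᵢⱼ`. -/
def scalar (G : Eucl d → Matrix (Fin d) (Fin d) ℝ) (y : Eucl d) : ℝ :=
  ∑ j, ∑ k, (G y)⁻¹ j k * ∑ i, riemannUp G i k i j y

/-- The Riemann tensor with all indices lowered; `J = (l, k, i, j)` gives `gₗₘ Rᵐₖᵢⱼ`. -/
def riemannDown (G : Eucl d → Matrix (Fin d) (Fin d) ℝ) (J : Fin 4 → Fin d) (y : Eucl d) : ℝ :=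
  ∑ m, G y (J 0) m * riemannUp G m (J 1) (J 2) (J 3) y

/-- Covariant derivative of a covariant `r`-tensor, the new index standing first:
`(∇T)_{k i₁…iᵣ} = ∂ₖ T_{i₁…iᵣ} - ∑ₛ Γᵐ_{k iₛ} T_{i₁…m…iᵣ}`. -/
def covDeriv (G : Eucl d → Matrix (Fin d) (Fin d) ℝ) {r : ℕ}
    (T : (Fin r → Fin d) → Eucl d → ℝ) (J : Fin (r + 1) → Fin d) (y : Eucl d) : ℝ :=
  pd (J 0) (T (Fin.tail J)) y
    - ∑ s, ∑ m, christoffel G m (J 0) (Fin.tail J s) y * T (Function.update (Fin.tail J) s m) y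

/-- The `k`-th iterated covariant derivative `∇ᵏR` of the Riemann tensor. -/
def nablaRiemann (G : Eucl d → Matrix (Fin d) (Fin d) ℝ) :
    (k : ℕ) → (Fin (4 + k) → Fin d) → Eucl d → ℝ
  | 0 => riemannDown G
  | k + 1 => covDeriv G (nablaRiemann G k)

/-- The pointwise norm of a covariant tensor with respect to the metric `G`
(the root of the sum of the squares of its components in an orthonormal frame). -/
def tensorNorm (G : Eucl d → Matrix (Fin d) (Fin d) ℝ) {r : ℕ}
    (T : (Fin r → Fin d) → Eucl d → ℝ) (y : Eucl d) : ℝ :=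
  Real.sqrt (∑ J, ∑ L, (∏ s, (G y)⁻¹ (J s) (L s)) * T J y * T L y)

/-- The Laplacian on functions, `Δ₀ f = δ d f = -(det g)^{-1/2} ∂ᵢ((det g)^{1/2} gⁱʲ ∂ⱼ f)`. -/
def laplacian (G : Eucl d → Matrix (Fin d) (Fin d) ℝ) (f : Eucl d → ℝ) (y : Eucl d) : ℝ :=
  -((Real.sqrt (G y).det)⁻¹ *
    ∑ i, pd i (fun z => Real.sqrt (G z).det * ∑ j, (G z)⁻¹ i j * pd j f z) y)

end

end Coord

/-! ### Tensors and volume on a manifold -/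

namespace Geom

noncomputable section

section Tensors

variable {d : ℕ} {X : Type*} [TopologicalSpace X] [ChartedSpace (Eucl d) X]

/-- The coordinate vector field `∂ᵢ` of the chart `e`, at the point with coordinates `y`. -/
def coordVec (e : OpenPartialHomeomorph X (Eucl d)) (y : Eucl d) (i : Fin d) :
    TangentSpace (𝓡 d) (e.symm y) :=
  mfderiv (𝓡 d) (𝓡 d) e.symm y (EuclideanSpace.single i (1 : ℝ) : Eucl d)

/-- The components `T(∂ᵢ, ∂ⱼ)` of a 2-tensor field in the chart `e`, as functions of the
coordinates. -/
def comps (T : ∀ x : X, TangentSpace (𝓡 d) x → TangentSpace (𝓡 d) x → ℝ)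
    (e : OpenPartialHomeomorph X (Eucl d)) (y : Eucl d) : Matrix (Fin d) (Fin d) ℝ :=
  Matrix.of fun i j => T (e.symm y) (coordVec e y i) (coordVec e y j)

/-- The measure `√(det g) dy¹ ⋯ dyᵈ` on the domain of the chart `e`. -/
def chartVolume [MeasurableSpace X]
    (T : ∀ x : X, TangentSpace (𝓡 d) x → TangentSpace (𝓡 d) x → ℝ)
    (e : OpenPartialHomeomorph X (Eucl d)) : Measure X :=
  (((volume : Measure (Eucl d)).restrict e.target).withDensity
    fun y => ENNReal.ofReal (Real.sqrt (comps T e y).det)).map e.symm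

variable (d X) in
/-- A nonempty σ-compact manifold is covered by a sequence of charts. -/
theorem exists_chart_sequence [SigmaCompactSpace X] [Nonempty X] :
    ∃ c : ℕ → X, ⋃ n, (chartAt (Eucl d) (c n)).source = univ := by
  obtain ⟨s, hs, hcov⟩ := countable_cover_nhds_of_sigmaCompact
    (f := fun x : X => (chartAt (Eucl d) x).source) (fun x => chart_source_mem_nhds _ x)
  have hne : s.Nonempty := by
    rcases s.eq_empty_or_nonempty with rfl | h
    · simp only [mem_empty_iff_false, iUnion_of_empty, iUnion_empty] at hcov
      exact (empty_ne_univ hcov).elim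
    · exact h
  obtain ⟨c, rfl⟩ := hs.exists_eq_range hne
  exact ⟨c, by simpa using hcov⟩

/-- The Riemannian volume measure of the metric tensor `T`: the chart measures
`√(det g) dy` glued along a sequence of charts covering `X`. (By the change of variables formula
it restricts to `√(det g) dy` on every chart, whatever the sequence.) -/
def volumeMeasure [MeasurableSpace X] [SigmaCompactSpace X] [Nonempty X]
    (T : ∀ x : X, TangentSpace (𝓡 d) x → TangentSpace (𝓡 d) x → ℝ) : Measure X :=
  let c := (exists_chart_sequence d X).choose
  Measure.sum fun n => (chartVolume T (chartAt (Eucl d) (c n))).restrict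
    (disjointed (fun k => (chartAt (Eucl d) (c k)).source) n)

end Tensors

/-! ### Riemannian manifolds -/

section Riemannian

variable {d : ℕ} {M : Type*} [TopologicalSpace M] [ChartedSpace (Eucl d) M]
  [RiemannianBundle (fun x : M => TangentSpace (𝓡 d) x)]

/-- The metric tensor of a Riemannian manifold. -/
def metric (x : M) (v w : TangentSpace (𝓡 d) x) : ℝ := inner ℝ v w

/-- The matrix `gᵢⱼ` of the metric in the chart `e`. -/
def metricMat (e : OpenPartialHomeomorph M (Eucl d)) : Eucl d → Matrix (Fin d) (Fin d) ℝ :=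
  comps (metric (M := M)) e

variable (d) in
/-- Scalar curvature. -/
def scalarCurv (x : M) : ℝ :=
  Coord.scalar (metricMat (chartAt (Eucl d) x)) (chartAt (Eucl d) x x)

/-- `|∇ᵏR|` at the point `x`, computed in the chart `e`. -/
def nablaCurvNorm (k : ℕ) (e : OpenPartialHomeomorph M (Eucl d)) (x : M) : ℝ :=
  Coord.tensorNorm (metricMat e) (Coord.nablaRiemann (metricMat e) k) (e x)

variable (d) in
/-- The Laplacian `Δ₀ = δd` on functions. -/
def laplace (f : M → ℝ) (x : M) : ℝ :=
  Coord.laplacian (metricMat (chartAt (Eucl d) x)) (f ∘ (chartAt (Eucl d) x).symm)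
    (chartAt (Eucl d) x x)

/-- The `k`-th component of a tangent vector at `x` in the chart `e`. -/
def vecComp (e : OpenPartialHomeomorph M (Eucl d)) (x : M) (v : TangentSpace (𝓡 d) x)
    (k : Fin d) : ℝ :=
  (show Eucl d from mfderiv (𝓡 d) (𝓡 d) e x v) k

/-- The Levi-Civita covariant derivative of the vector field `Y` in the direction `v ∈ T_xM`:
`(∇_v Y)ᵏ = vⁱ (∂ᵢ Yᵏ + Γᵏᵢⱼ Yʲ)`. -/
def covDerivVec (x : M) (v : TangentSpace (𝓡 d) x) (Y : ∀ z : M, TangentSpace (𝓡 d) z) :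
    TangentSpace (𝓡 d) x :=
  let e := chartAt (Eucl d) x
  let Yc : Fin d → Eucl d → ℝ := fun k y => vecComp e (e.symm y) (Y (e.symm y)) k
  ∑ k, (∑ i, vecComp e x v i * (Coord.pd i (Yc k) (e x)
      + ∑ j, Coord.christoffel (metricMat e) k i j (e x) * Yc j (e x))) •
    (coordVec e (e x) k : TangentSpace (𝓡 d) x)

end Riemannian

end

end Geom

/-! ### ALF spaces -/

/-- `p : N → B` is a smooth fibre bundle with fibre the circle. -/
structure IsSmoothCircleFibration {N B : Type*}
    [TopologicalSpace N] [ChartedSpace (Eucl 3) N]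
    [TopologicalSpace B] [ChartedSpace (Eucl 2) B] (p : N → B) : Prop where
  contMDiff : ContMDiff (𝓡 3) (𝓡 2) ∞ p
  trivial : ∀ b : B, ∃ e : Trivialization Circle p, b ∈ e.baseSet ∧
    ContMDiffOn (𝓡 3) ((𝓡 2).prod (𝓡 1)) ∞ e.toOpenPartialHomeomorph e.source ∧
    ContMDiffOn ((𝓡 2).prod (𝓡 1)) (𝓡 3) ∞ e.toOpenPartialHomeomorph.symm e.target

/-- A one-parameter family `(T ρ)_{ρ > 0}` of symmetric 2-tensor fields on the 3-manifold `N`,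
depending smoothly on `(n, ρ) ∈ N × (0, ∞)`. -/
structure IsSmoothSymmFamily {N : Type*} [TopologicalSpace N] [ChartedSpace (Eucl 3) N]
    (T : ℝ → ∀ n : N, TangentSpace (𝓡 3) n →L[ℝ] TangentSpace (𝓡 3) n →L[ℝ] ℝ) : Prop where
  symm : ∀ ρ > 0, ∀ n v w, T ρ n v w = T ρ n w v
  smooth : ∀ (q₀ : N) (i j : Fin 3),
    ContDiffOn ℝ ∞
      (fun q : Eucl 3 × ℝ =>
        Geom.comps (fun n v w => T q.2 n v w) (chartAt (Eucl 3) q₀) q.1 i j)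
      ((chartAt (Eucl 3) q₀).target ×ˢ Ioi 0)

/-- The family `T ρ` is `O(1)` as `ρ → ∞`, with respect to some (hence, on compact `N`, any)
Riemannian metric on `N`. -/
def IsBoundedFamily {N : Type*} [TopologicalSpace N] [ChartedSpace (Eucl 3) N]
    [IsManifold (𝓡 3) ∞ N]
    (T : ℝ → ∀ n : N, TangentSpace (𝓡 3) n →L[ℝ] TangentSpace (𝓡 3) n →L[ℝ] ℝ) : Prop :=
  ∃ (gN : ContMDiffRiemannianMetric (𝓡 3) ∞ (Eucl 3) (fun n : N => TangentSpace (𝓡 3) n))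
    (C ρ₀ : ℝ), ∀ ρ ≥ ρ₀, ∀ n v, |T ρ n v v| ≤ C * gN.inner n v v

/-- The structure of an asymptotically locally flat (ALF) space on the complete Riemannian
4-manifold `M`, with `N` the 3-manifold at infinity, fibred by circles over the surface `B`. -/
structure ALFStructure (M N B : Type*)
    [TopologicalSpace M] [ChartedSpace (Eucl 4) M] [IsManifold (𝓡 4) ∞ M]
    [RiemannianBundle (fun x : M => TangentSpace (𝓡 4) x)]
    [TopologicalSpace N] [ChartedSpace (Eucl 3) N] [IsManifold (𝓡 3) ∞ N]
    [TopologicalSpace B] [ChartedSpace (Eucl 2) B] [IsManifold (𝓡 2) ∞ B] where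
  /-- The compact part. -/
  K : Set M
  isCompact_K : IsCompact K
  /-- The circle fibration at infinity. -/
  proj : N → B
  fibration : IsSmoothCircleFibration proj
  /-- The diffeomorphism `N × (0, ∞) → M \ K`. -/
  φ : OpenPartialHomeomorph (N × ℝ) M
  φ_source : φ.source = univ ×ˢ Ioi 0
  φ_target : φ.target = Kᶜ
  φ_smooth : ContMDiffOn ((𝓡 3).prod 𝓘(ℝ, ℝ)) (𝓡 4) ∞ φ φ.source
  φ_symm_smooth : ContMDiffOn (𝓡 4) ((𝓡 3).prod 𝓘(ℝ, ℝ)) ∞ φ.symm φ.target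
  /-- The metric `g_B` on the base. -/
  gB : ContMDiffRiemannianMetric (𝓡 2) ∞ (Eucl 2) (fun b : B => TangentSpace (𝓡 2) b)
  /-- The symmetric 2-tensor `h_F` on `N`, a metric along the fibres. -/
  hF : ∀ n : N, TangentSpace (𝓡 3) n →L[ℝ] TangentSpace (𝓡 3) n →L[ℝ] ℝ
  hF_smooth : IsSmoothSymmFamily (fun _ : ℝ => hF)
  hF_pos : ∀ n v, mfderiv (𝓡 3) (𝓡 2) proj n v = 0 → v ≠ 0 → 0 < hF n v v
  /-- The extension `(π^* g_B)'` of `π^* g_B`, read as a family on `N`. -/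
  a : ℝ → ∀ n : N, TangentSpace (𝓡 3) n →L[ℝ] TangentSpace (𝓡 3) n →L[ℝ] ℝ
  a_smooth : IsSmoothSymmFamily a
  a_nonneg : ∀ ρ > 0, ∀ n v, 0 ≤ a ρ n v v
  a_eq_zero_iff : ∀ ρ > 0, ∀ n v, a ρ n v v = 0 ↔ mfderiv (𝓡 3) (𝓡 2) proj n v = 0
  a_bounded : IsBoundedFamily a
  a_extends : ∀ n v w, Tendsto (fun ρ => a ρ n v w) atTop
    (𝓝 (gB.inner (proj n) (mfderiv (𝓡 3) (𝓡 2) proj n v) (mfderiv (𝓡 3) (𝓡 2) proj n w)))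
  /-- The extension `h'_F` of `h_F`, read as a family on `N`. -/
  h : ℝ → ∀ n : N, TangentSpace (𝓡 3) n →L[ℝ] TangentSpace (𝓡 3) n →L[ℝ] ℝ
  h_smooth : IsSmoothSymmFamily h
  h_pos : ∀ ρ > 0, ∀ n v, mfderiv (𝓡 3) (𝓡 2) proj n v = 0 → v ≠ 0 → 0 < h ρ n v v
  h_bounded : IsBoundedFamily h
  h_extends : ∀ n v w, Tendsto (fun ρ => h ρ n v w) atTop (𝓝 (hF n v w))
  /-- `φ^* g = dρ² + ρ² (π^* g_B)' + h'_F`. -/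
  metric_eq : ∀ (n : N) (ρ : ℝ), 0 < ρ →
    ∀ (v w : TangentSpace (𝓡 3) n) (t u : ℝ),
      Geom.metric (φ (n, ρ))
          (mfderiv ((𝓡 3).prod 𝓘(ℝ, ℝ)) (𝓡 4) φ (n, ρ) ((v, t) : Eucl 3 × ℝ))
          (mfderiv ((𝓡 3).prod 𝓘(ℝ, ℝ)) (𝓡 4) φ (n, ρ) ((w, u) : Eucl 3 × ℝ)) =
        t * u + ρ ^ 2 * a ρ n v w + h ρ n v w
  /-- `|∇ᵏR| = O(ρ^{-3-k})`; the norm is the same in all charts around the point. -/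
  curvature_decay : ∀ k : ℕ, ∃ C ρ₀ : ℝ, 0 < ρ₀ ∧ ∀ ρ ≥ ρ₀, ∀ n : N,
    ∀ e ∈ IsManifold.maximalAtlas (𝓡 4) ∞ M, φ (n, ρ) ∈ e.source →
      Geom.nablaCurvNorm k e (φ (n, ρ)) ≤ C * (ρ ^ (3 + k))⁻¹

namespace ALFStructure

noncomputable section

variable {M N B : Type*}
  [TopologicalSpace M] [ChartedSpace (Eucl 4) M] [IsManifold (𝓡 4) ∞ M]
  [RiemannianBundle (fun x : M => TangentSpace (𝓡 4) x)]
  [TopologicalSpace N] [ChartedSpace (Eucl 3) N] [IsManifold (𝓡 3) ∞ N]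
  [TopologicalSpace B] [ChartedSpace (Eucl 2) B] [IsManifold (𝓡 2) ∞ B]
  (A : ALFStructure M N B)

/-- The truncation `K ∪ φ(N × (0, r])`; its boundary (for `r > 0`) is `φ(N × {r})`. -/
def truncation (r : ℝ) : Set M := A.K ∪ A.φ '' (univ ×ˢ Ioc 0 r)

/-- The parametrization `n ↦ φ(n, r)` of the boundary of the truncation. -/
def slice (r : ℝ) (n : N) : M := A.φ (n, r)

/-- The differential of the parametrization of the boundary. -/
def sliceDeriv (r : ℝ) (n : N) (v : TangentSpace (𝓡 3) n) :
    TangentSpace (𝓡 4) (A.slice r n) :=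
  mfderiv (𝓡 3) (𝓡 4) (A.slice r) n v

/-- The metric induced on the boundary of the truncation, pulled back to `N`. -/
def sliceMetric (r : ℝ) (n : N) (v w : TangentSpace (𝓡 3) n) : ℝ :=
  Geom.metric (A.slice r n) (A.sliceDeriv r n v) (A.sliceDeriv r n w)

/-- `ν` is a continuous field of unit normals along the boundary of the truncation. -/
structure IsUnitNormal (r : ℝ) (ν : ∀ n : N, TangentSpace (𝓡 4) (A.slice r n)) : Prop where
  continuous : Continuous (fun n => (⟨A.slice r n, ν n⟩ : TangentBundle (𝓡 4) M))
  unit : ∀ n, Geom.metric (A.slice r n) (ν n) (ν n) = 1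
  orthogonal : ∀ n v, Geom.metric (A.slice r n) (ν n) (A.sliceDeriv r n v) = 0

/-- `(e₁, …, e₄)` (indexed by `0, …, 3`) is a smooth orthonormal frame field on the open set `U`,
with `e₄` orthogonal to the boundary of the truncation. -/
structure IsAdaptedFrame (r : ℝ) (U : Set M) (e : Fin 4 → ∀ x : M, TangentSpace (𝓡 4) x) :
    Prop where
  isOpen : IsOpen U
  smooth : ∀ i, ContMDiffOn (𝓡 4) (𝓡 4).tangent ∞
    (fun x => (⟨x, e i x⟩ : TangentBundle (𝓡 4) M)) U
  orthonormal : ∀ x ∈ U, ∀ i j, Geom.metric x (e i x) (e j x) = if i = j then 1 else 0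
  normal : ∀ n, A.slice r n ∈ U → ∀ v,
    Geom.metric (A.slice r n) (e 3 (A.slice r n)) (A.sliceDeriv r n v) = 0

end

end ALFStructure

/-- The components `Π_{ij} = g(∇_{eᵢ} eⱼ, e₄)`, `i, j = 1, 2, 3`, of the second fundamental form
in the frame `e`, at the point `x`. -/
noncomputable def secondFundForm {M : Type*} [TopologicalSpace M] [ChartedSpace (Eucl 4) M]
    [RiemannianBundle (fun x : M => TangentSpace (𝓡 4) x)]
    (e : Fin 4 → ∀ x : M, TangentSpace (𝓡 4) x) (i j : Fin 3) (x : M) : ℝ :=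
  Geom.metric x (Geom.covDerivVec x (e i.castSucc x) (e j.castSucc)) (e 3 x)

/-! All three claims rest on one normal form. In the chart `(c, ρ)` of the end, with `c` a chart of
`N`, the metric is `dρ² + ρ² a + h`. So `∂_ρ` is a unit geodesic field orthogonal to the slices `ρ =
const`, and the entries of the slice metric are `O(ρ²)`. Hence slices have volume `O(ρ³)` and shells
of thickness `ε` have volume `O(ρ³ ε)`. This is cruder than the true growth, because `a` degenerates
along the circle fibres, but it suffices: `ds` is a contraction of `∇R`, so `|ds| = O(ρ⁻⁴)`.

Boundary integral: an integrand `O(r⁻⁴)` over a volume `O(r³)` gives `O(r⁻¹)`.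

Bulk integral: no divergence theorem on a domain with boundary is needed. Let `χ` be a smooth
cutoff, `1` up to radius `r` and `0` beyond `r + ε`, with slope at most `L / ε`. Green's formula for
compactly supported functions gives `∫ χ Δs = ∫ ⟨dχ, ds⟩`, which is bounded by `(L / ε) · O(r⁻⁴) ·
O(r³ ε) = O(r⁻¹)` uniformly in `ε`. Letting `ε → 0` replaces `χ` by the indicator of the truncation.
Two facts about the ends enter. Truncations are compact, because by completeness radial lines
followed inwards converge to points of `K`. The sets `φ(N × [r, ∞))` are closed, because points of
radius at least `1` keep distance at least `1/2` from `K`; so `χ` extends smoothly by `1`.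

Second fundamental form: an adapted frame has `e₄ = ±∂_ρ` on the slice, so `Π` is, up to sign, the
shape operator `S` of the radial foliation. Along a radial line `S' = -S² - R(·, ∂_ρ)∂_ρ`, with
curvature `O(ρ⁻³)`. Put `θ = tr S` and `q = tr S²`. The traced equation and `θ² ≤ C q` give `|θ| =
O(ρ⁻¹)` by comparison on intervals on both sides of `ρ`. Moreover `q' ≥ -C q^{3/2} - …` keeps `q`
from dropping quickly, so a large `q(ρ)` would force `∫ q` over `[ρ, 2ρ]`, and with it the variation
of `θ`, to be large. Therefore `q = O(ρ⁻²)`.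

The geometric quantities are defined pointwise in preferred charts. The first half of the work is
therefore their invariance under changes of coordinates, which makes the product chart available.
The estimates are carried by `le_of_riccati`, `Coord.IsMetricOn.abs_fderiv_scalar_le`,
`Geom.integral_mul_laplace`, `ALFStructure.exists_volume_shell_le` and
`ALFStructure.isCompact_truncation`. -/

namespace Coord

variable {d : ℕ}

/-! ### Partial derivatives on the model space. -/

section PartialDerivatives

variable {f g : Eucl d → ℝ} {y : Eucl d} {U : Set (Eucl d)}

theorem pd_congr (k : Fin d) (h : f =ᶠ[𝓝 y] g) : pd k f y = pd k g y := by
  rw [pd, pd, h.fderiv_eq]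

theorem pd_congr_on (k : Fin d) (hU : IsOpen U) (hy : y ∈ U) (h : EqOn f g U) :
    pd k f y = pd k g y :=
  pd_congr k (h.eventuallyEq_of_mem (hU.mem_nhds hy))

theorem pd_const (k : Fin d) (c : ℝ) : pd k (fun _ => c) y = 0 := by
  simp [pd]

theorem pd_add (k : Fin d) (hf : DifferentiableAt ℝ f y) (hg : DifferentiableAt ℝ g y) :
    pd k (fun z => f z + g z) y = pd k f y + pd k g y := by
  simp [pd, fderiv_fun_add hf hg]

theorem pd_mul (k : Fin d) (hf : DifferentiableAt ℝ f y) (hg : DifferentiableAt ℝ g y) :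
    pd k (fun z => f z * g z) y = pd k f y * g y + f y * pd k g y := by
  simp [pd, fderiv_fun_mul hf hg]; ring

theorem pd_sum {ι : Type*} (s : Finset ι) (k : Fin d) {F : ι → Eucl d → ℝ}
    (hF : ∀ i ∈ s, DifferentiableAt ℝ (F i) y) :
    pd k (fun z => ∑ i ∈ s, F i z) y = ∑ i ∈ s, pd k (F i) y := by
  simp [pd, fderiv_fun_sum hF]

theorem fderiv_eq_sum_pd (f : Eucl d → ℝ) (y v : Eucl d) :
    fderiv ℝ f y v = ∑ a, v a * pd a f y := by
  conv_lhs => rw [← (EuclideanSpace.basisFun (Fin d) ℝ).sum_repr v]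
  simp [pd]

theorem fderiv_coord {Ψ : Eucl d → Eucl d} (hΨ : DifferentiableAt ℝ Ψ y) (v : Eucl d)
    (a : Fin d) : fderiv ℝ (fun z => Ψ z a) y v = fderiv ℝ Ψ y v a := by
  have h := ((EuclideanSpace.proj a : Eucl d →L[ℝ] ℝ).hasFDerivAt (x := Ψ y)).comp y
    hΨ.hasFDerivAt
  have h2 : HasFDerivAt (fun z => Ψ z a) _ y := h
  rw [h2.fderiv]
  rfl

theorem pd_comp {Ψ : Eucl d → Eucl d} (i : Fin d) (hf : DifferentiableAt ℝ f (Ψ y))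
    (hΨ : DifferentiableAt ℝ Ψ y) :
    pd i (fun z => f (Ψ z)) y = ∑ a, pd i (fun z => Ψ z a) y * pd a f (Ψ y) := by
  have h : fderiv ℝ (fun z => f (Ψ z)) y = (fderiv ℝ f (Ψ y)).comp (fderiv ℝ Ψ y) :=
    (hf.hasFDerivAt.comp y hΨ.hasFDerivAt).fderiv
  rw [pd, h, ContinuousLinearMap.comp_apply, fderiv_eq_sum_pd]
  simp only [pd, fderiv_coord hΨ]

theorem contDiffOn_pd (hU : IsOpen U) (hf : ContDiffOn ℝ ∞ f U) (k : Fin d) :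
    ContDiffOn ℝ ∞ (pd k f) U := by
  have h := hf.fderiv_of_isOpen (m := ∞) hU (by simp)
  exact h.clm_apply contDiffOn_const

theorem differentiableAt_of_contDiffOn {E F : Type*} [NormedAddCommGroup E] [NormedSpace ℝ E]
    [NormedAddCommGroup F] [NormedSpace ℝ F] {f : E → F} {U : Set E} {y : E}
    (hU : IsOpen U) (hy : y ∈ U)
    (hf : ContDiffOn ℝ ∞ f U) : DifferentiableAt ℝ f y :=
  (hf.contDiffAt (hU.mem_nhds hy)).differentiableAt (by simp)

theorem pd_comm (hU : IsOpen U) (hy : y ∈ U) (hf : ContDiffOn ℝ ∞ f U) (i j : Fin d) :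
    pd i (pd j f) y = pd j (pd i f) y := by
  have hs : IsSymmSndFDerivAt ℝ f y :=
    (hf.contDiffAt (hU.mem_nhds hy)).isSymmSndFDerivAt (by
      simp only [minSmoothness_of_isRCLikeNormedField]; exact WithTop.coe_le_coe.mpr le_top)
  have hd : DifferentiableAt ℝ (fderiv ℝ f) y :=
    differentiableAt_of_contDiffOn hU hy (hf.fderiv_of_isOpen (m := ∞) hU (by simp))
  have key : ∀ i j : Fin d, pd i (pd j f) y = fderiv ℝ (fderiv ℝ f) y
      (EuclideanSpace.single i 1) (EuclideanSpace.single j 1) := by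
    intro i j
    have h2 : HasFDerivAt (pd j f) _ y := hd.hasFDerivAt.clm_apply
      (hasFDerivAt_const (EuclideanSpace.single j (1 : ℝ)) y)
    rw [pd, h2.fderiv]
    simp
  rw [key, key]
  exact hs _ _

end PartialDerivatives

/-! ### Calculus of matrix-valued functions. -/

section MatrixFunctions

/-- The entrywise partial derivative of a matrix-valued function. -/
noncomputable def pdM {m n : Type*} (k : Fin d) (A : Eucl d → Matrix m n ℝ) (y : Eucl d) :
    Matrix m n ℝ :=
  Matrix.of fun a b => pd k (fun z => A z a b) y

/-- Entrywise smoothness of a matrix-valued function. -/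
def SmoothM {E : Type*} [NormedAddCommGroup E] [NormedSpace ℝ E] {m n : Type*}
    (A : E → Matrix m n ℝ) (U : Set E) : Prop :=
  ∀ a b, ContDiffOn ℝ ∞ (fun z => A z a b) U

variable {E : Type*} [NormedAddCommGroup E] [NormedSpace ℝ E]
variable {l m n : Type*} [Fintype m] {U : Set E}

theorem SmoothM.mul {A : E → Matrix l m ℝ} {B : E → Matrix m n ℝ}
    (hA : SmoothM A U) (hB : SmoothM B U) : SmoothM (fun z => A z * B z) U := fun a b => by
  simp only [Matrix.mul_apply]
  exact ContDiffOn.sum fun c _ => (hA a c).mul (hB c b)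

theorem SmoothM.det [Fintype n] [DecidableEq n] {A : E → Matrix n n ℝ} (hA : SmoothM A U) :
    ContDiffOn ℝ ∞ (fun z => (A z).det) U := by
  simp only [Matrix.det_apply']
  exact ContDiffOn.sum fun σ _ => contDiffOn_const.mul (contDiffOn_prod fun i _ => hA _ _)

/-- Each entry of the adjugate is the determinant of the matrix with one row replaced by a constant
vector, so smoothness of determinants suffices. -/
theorem SmoothM.inv [Fintype n] [DecidableEq n] {A : E → Matrix n n ℝ} (hA : SmoothM A U)
    (h0 : ∀ z ∈ U, (A z).det ≠ 0) : SmoothM (fun z => (A z)⁻¹) U := fun a b => by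
  simp only [Matrix.inv_def, Matrix.smul_apply, smul_eq_mul, Ring.inverse_eq_inv']
  refine (hA.det.inv h0).mul ?_
  simp only [Matrix.adjugate_apply]
  refine SmoothM.det (A := fun z => (A z).updateRow b (Pi.single a 1)) fun i j => ?_
  by_cases hi : i = b
  · subst hi; simp only [Matrix.updateRow_self]; exact contDiffOn_const
  · simp only [Matrix.updateRow_ne hi]; exact hA i j

variable {y : Eucl d} {V : Set (Eucl d)}

theorem pdM_mul (hV : IsOpen V) (hy : y ∈ V) (k : Fin d) {A : Eucl d → Matrix l m ℝ}
    {B : Eucl d → Matrix m n ℝ} (hA : SmoothM A V) (hB : SmoothM B V) :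
    pdM k (fun z => A z * B z) y = pdM k A y * B y + A y * pdM k B y := by
  ext a b
  have h1 := fun c => differentiableAt_of_contDiffOn hV hy (hA a c)
  have h2 := fun c => differentiableAt_of_contDiffOn hV hy (hB c b)
  simp only [pdM, Matrix.of_apply, Matrix.mul_apply, Matrix.add_apply]
  rw [pd_sum _ _ fun c _ => (h1 c).fun_mul (h2 c), ← Finset.sum_add_distrib]
  exact Finset.sum_congr rfl fun c _ => pd_mul k (h1 c) (h2 c)

/-- Differentiate `A * A⁻¹ = 1`, which holds on the whole open set, and solve for the derivative of
the inverse. -/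
theorem pdM_inv [Fintype n] [DecidableEq n] (hV : IsOpen V) (hy : y ∈ V) (k : Fin d)
    {A : Eucl d → Matrix n n ℝ} (hA : SmoothM A V) (h0 : ∀ z ∈ V, (A z).det ≠ 0) :
    pdM k (fun z => (A z)⁻¹) y = -((A y)⁻¹ * pdM k A y * (A y)⁻¹) := by
  have h1 := pdM_mul hV hy k hA (hA.inv h0)
  have h2 : pdM k (fun z => A z * (A z)⁻¹) y = 0 := by
    ext a b
    simp only [pdM, Matrix.of_apply, Matrix.zero_apply]
    rw [pd_congr_on k hV hy (g := fun _ => (1 : Matrix n n ℝ) a b), pd_const]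
    intro z hz
    simp only [Matrix.mul_nonsing_inv _ (isUnit_iff_ne_zero.mpr (h0 z hz))]
  have hu := isUnit_iff_ne_zero.mpr (h0 y hy)
  have h3 : (A y)⁻¹ * (pdM k A y * (A y)⁻¹ + A y * pdM k (fun z => (A z)⁻¹) y) = 0 := by
    rw [← h1, h2, mul_zero]
  rw [mul_add, ← mul_assoc, ← mul_assoc, Matrix.nonsing_inv_mul _ hu, one_mul] at h3
  rw [eq_neg_iff_add_eq_zero, add_comm]
  exact h3

/-- **Jacobi's formula** for partial derivatives. -/
theorem pd_det [Fintype n] [DecidableEq n] (hV : IsOpen V) (hy : y ∈ V) (k : Fin d)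
    {A : Eucl d → Matrix n n ℝ} (hA : SmoothM A V) (h0 : (A y).det ≠ 0) :
    pd k (fun z => (A z).det) y = (A y).det * ((A y)⁻¹ * pdM k A y).trace := by
  have hd := fun a b => differentiableAt_of_contDiffOn hV hy (hA a b)
  have hp : ∀ σ : Equiv.Perm n, DifferentiableAt ℝ (fun z => ∏ i, A z (σ i) i) y := fun σ =>
    (HasFDerivAt.finsetProd fun i _ => (hd (σ i) i).hasFDerivAt).differentiableAt
  -- The Leibniz expansion differentiates one column at a time. Cramer's rule then identifies the
  -- sum of these determinants with the trace of the adjugate times the derivative.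
  have h1 : pd k (fun z => (A z).det) y
      = ∑ i, ((A y).updateCol i fun j => pdM k A y j i).det := by
    simp only [Matrix.det_apply']
    rw [pd_sum _ _ fun σ _ => (hp σ).const_mul _, Finset.sum_comm]
    refine Finset.sum_congr rfl fun σ _ => ?_
    rw [pd_mul k (differentiableAt_const _) (hp σ), pd_const, zero_mul, zero_add,
      ← Finset.mul_sum]
    congr 1
    have h2 := fderiv_finsetProd (𝕜 := ℝ) (u := Finset.univ) (g := fun i z => A z (σ i) i)
      (x := y) fun i _ => hd (σ i) i
    rw [pd, h2]
    simp only [_root_.sum_apply, _root_.smul_apply, smul_eq_mul]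
    refine Finset.sum_congr rfl fun i _ => ?_
    rw [← Finset.mul_prod_erase _ _ (Finset.mem_univ i), mul_comm]
    congr 1
    · simp [pdM, pd]
    · refine Finset.prod_congr rfl fun j hj => ?_
      rw [Matrix.updateCol_ne (Finset.ne_of_mem_erase hj)]
  have h4 : (A y)⁻¹ = (A y).det⁻¹ • (A y).adjugate := by
    rw [Matrix.inv_def, Ring.inverse_eq_inv']
  rw [h1, h4, Matrix.smul_mul, Matrix.trace_smul, smul_eq_mul, ← mul_assoc, mul_inv_cancel₀ h0,
    one_mul]
  simp only [← Matrix.cramer_apply, Matrix.cramer_eq_adjugate_mulVec, Matrix.trace,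
    Matrix.diag_apply, Matrix.mul_apply, Matrix.mulVec, dotProduct]

end MatrixFunctions

end Coord

/-! ### Connection and curvature matrices, and the transformation law of the connection. -/

namespace Coord

variable {d : ℕ}

open Matrix in
/-- `G` is the matrix of a smooth Riemannian metric on the open set `U`. -/
structure IsMetricOn (G : Eucl d → Matrix (Fin d) (Fin d) ℝ) (U : Set (Eucl d)) : Prop where
  isOpen : IsOpen U
  smooth : SmoothM G U
  posDef : ∀ y ∈ U, (G y).PosDef

/-- The connection matrix `(Γᵢ)ᵏⱼ`. -/
noncomputable def gam (G : Eucl d → Matrix (Fin d) (Fin d) ℝ) (i : Fin d) (y : Eucl d) :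
    Matrix (Fin d) (Fin d) ℝ :=
  Matrix.of fun k j => christoffel G k i j y

/-- The curvature matrix `(Rᵢⱼ)ˡₖ`. -/
noncomputable def riemMat (G : Eucl d → Matrix (Fin d) (Fin d) ℝ) (i j : Fin d) (y : Eucl d) :
    Matrix (Fin d) (Fin d) ℝ :=
  Matrix.of fun l k => riemannUp G l k i j y

namespace IsMetricOn

variable {G : Eucl d → Matrix (Fin d) (Fin d) ℝ} {U : Set (Eucl d)} {y : Eucl d}

theorem symm (hG : IsMetricOn G U) (hy : y ∈ U) (i j : Fin d) : G y i j = G y j i := by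
  have := (hG.posDef y hy).1.apply j i
  simpa using this

theorem transpose (hG : IsMetricOn G U) (hy : y ∈ U) : (G y).transpose = G y := by
  ext i j; exact hG.symm hy j i

theorem det_pos (hG : IsMetricOn G U) (hy : y ∈ U) : 0 < (G y).det := (hG.posDef y hy).det_pos

theorem isUnit_det (hG : IsMetricOn G U) (hy : y ∈ U) : IsUnit (G y).det :=
  isUnit_iff_ne_zero.mpr (hG.det_pos hy).ne'

theorem inv_symm (hG : IsMetricOn G U) (hy : y ∈ U) (i j : Fin d) :
    (G y)⁻¹ i j = (G y)⁻¹ j i := by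
  have : ((G y)⁻¹).transpose = (G y)⁻¹ := by
    rw [Matrix.transpose_nonsing_inv, hG.transpose hy]
  conv_lhs => rw [← this]
  rfl

theorem smooth_inv (hG : IsMetricOn G U) : SmoothM (fun z => (G z)⁻¹) U :=
  hG.smooth.inv fun _ hz => (hG.det_pos hz).ne'

theorem smooth_christoffel (hG : IsMetricOn G U) (k i j : Fin d) :
    ContDiffOn ℝ ∞ (christoffel G k i j) U := by
  unfold christoffel
  exact contDiffOn_const.mul (ContDiffOn.sum fun l _ => (hG.smooth_inv k l).mul
    (((contDiffOn_pd hG.isOpen (hG.smooth j l) i).add (contDiffOn_pd hG.isOpen (hG.smooth i l) j)).sub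
      (contDiffOn_pd hG.isOpen (hG.smooth i j) l)))

theorem smooth_gam (hG : IsMetricOn G U) (i : Fin d) : SmoothM (gam G i) U :=
  fun k j => hG.smooth_christoffel k i j

theorem christoffel_symm (hG : IsMetricOn G U) (hy : y ∈ U) (k i j : Fin d) :
    christoffel G k i j y = christoffel G k j i y := by
  unfold christoffel
  congr 1
  refine Finset.sum_congr rfl fun l _ => ?_
  rw [pd_congr_on l hG.isOpen hy (g := fun z => G z j i) fun z hz => hG.symm hz i j]
  ring

theorem smooth_riemannUp (hG : IsMetricOn G U) (l k i j : Fin d) :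
    ContDiffOn ℝ ∞ (riemannUp G l k i j) U := by
  unfold riemannUp
  exact ((contDiffOn_pd hG.isOpen (hG.smooth_christoffel l j k) i).sub
    (contDiffOn_pd hG.isOpen (hG.smooth_christoffel l i k) j)).add
    (ContDiffOn.sum fun m _ => ((hG.smooth_christoffel l i m).mul
      (hG.smooth_christoffel m j k)).sub
      ((hG.smooth_christoffel l j m).mul (hG.smooth_christoffel m i k)))

theorem smooth_riemannDown (hG : IsMetricOn G U) (J : Fin 4 → Fin d) :
    ContDiffOn ℝ ∞ (riemannDown G J) U := by
  unfold riemannDown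
  exact ContDiffOn.sum fun m _ => (hG.smooth _ _).mul (hG.smooth_riemannUp _ _ _ _)

theorem smooth_scalar (hG : IsMetricOn G U) : ContDiffOn ℝ ∞ (scalar G) U := by
  unfold scalar
  exact ContDiffOn.sum fun j _ => ContDiffOn.sum fun k _ => (hG.smooth_inv j k).mul
    (ContDiffOn.sum fun i _ => hG.smooth_riemannUp _ _ _ _)

open Matrix in
/-- The Christoffel symbols with lowered index. -/
theorem mul_gam_apply (hG : IsMetricOn G U) (hy : y ∈ U) (l i j : Fin d) :
    (G y * gam G i y) l j = (1 / 2) * (pdM i G y j l + pdM j G y i l - pdM l G y i j) := by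
  have h : ∀ k, gam G i y k j = (1 / 2) * ((G y)⁻¹ *ᵥ
      fun l => pdM i G y j l + pdM j G y i l - pdM l G y i j) k := fun k => rfl
  have h2 : (G y *ᵥ ((G y)⁻¹ *ᵥ
      fun l => pdM i G y j l + pdM j G y i l - pdM l G y i j)) l =
      pdM i G y j l + pdM j G y i l - pdM l G y i j := by
    rw [Matrix.mulVec_mulVec, Matrix.mul_nonsing_inv _ (hG.isUnit_det hy), Matrix.one_mulVec]
  rw [← h2, Matrix.mul_apply]
  conv_rhs => rw [Matrix.mulVec, dotProduct, Finset.mul_sum]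
  refine Finset.sum_congr rfl fun k _ => ?_
  rw [h]; ring

/-- Compatibility of the connection with the metric. -/
theorem pdM_eq (hG : IsMetricOn G U) (hy : y ∈ U) (m : Fin d) :
    pdM m G y = G y * gam G m y + (gam G m y).transpose * G y := by
  have h0 : ∀ k a b, pdM k G y a b = pdM k G y b a := fun k a b =>
    pd_congr_on k hG.isOpen hy fun z hz => hG.symm hz a b
  have h1 : (gam G m y).transpose * G y = (G y * gam G m y).transpose := by
    rw [Matrix.transpose_mul, hG.transpose hy]
  ext i j
  -- In the sum of the lowered symbol and its transpose the two cross derivatives cancel, leaving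
  -- the derivative of the metric in direction `m`.
  rw [h1, Matrix.add_apply, Matrix.transpose_apply, hG.mul_gam_apply hy, hG.mul_gam_apply hy,
    h0 j m i, h0 i m j, h0 m j i]
  ring

/-- Metric compatibility for the inverse metric. It lets contractions with `G⁻¹` be commuted with
covariant differentiation. -/
theorem pdM_inv_eq (hG : IsMetricOn G U) (hy : y ∈ U) (m : Fin d) :
    pdM m (fun z => (G z)⁻¹) y
      = -(gam G m y * (G y)⁻¹ + (G y)⁻¹ * (gam G m y).transpose) := by
  have hu := hG.isUnit_det hy
  rw [pdM_inv hG.isOpen hy m hG.smooth fun z hz => (hG.det_pos hz).ne', hG.pdM_eq hy, mul_add,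
    add_mul, ← mul_assoc, Matrix.nonsing_inv_mul _ hu, one_mul, mul_assoc, mul_assoc,
    Matrix.mul_nonsing_inv _ hu, mul_one]

/-- Curvature in the form `∂ᵢΓⱼ - ∂ⱼΓᵢ + [Γᵢ, Γⱼ]`, which turns its transformation law into
noncommutative matrix algebra. -/
theorem riemMat_eq (i j : Fin d) (y : Eucl d) :
    riemMat G i j y = pdM i (gam G j) y - pdM j (gam G i) y
      + (gam G i y * gam G j y - gam G j y * gam G i y) := by
  ext l k
  simp [riemMat, riemannUp, pdM, gam, Matrix.mul_apply]

end IsMetricOn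

/-- The Jacobian matrix of a map. -/
noncomputable def jac (Ψ : Eucl d → Eucl d) (y : Eucl d) : Matrix (Fin d) (Fin d) ℝ :=
  Matrix.of fun a i => pd i (fun z => Ψ z a) y

/-- `Ψ : U → V` is a smooth change of coordinates which pulls `G` back to `G'`. -/
structure IsCoordChange (G' G : Eucl d → Matrix (Fin d) (Fin d) ℝ) (Ψ : Eucl d → Eucl d)
    (U V : Set (Eucl d)) : Prop where
  source : IsMetricOn G' U
  target : IsMetricOn G V
  smooth : ContDiffOn ℝ ∞ Ψ U
  mapsTo : MapsTo Ψ U V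
  pullback : ∀ y ∈ U, G' y = (jac Ψ y).transpose * G (Ψ y) * jac Ψ y

namespace IsCoordChange

variable {G' G : Eucl d → Matrix (Fin d) (Fin d) ℝ} {Ψ : Eucl d → Eucl d}
  {U V : Set (Eucl d)} {y : Eucl d}

theorem det_eq (h : IsCoordChange G' G Ψ U V) (hy : y ∈ U) :
    (G' y).det = (jac Ψ y).det ^ 2 * (G (Ψ y)).det := by
  rw [h.pullback y hy, Matrix.det_mul, Matrix.det_mul, Matrix.det_transpose]; ring

/-- Invertibility of the Jacobian is forced by the pull-back relation: `det G' = (det J)² det G`,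
and the left side is positive. -/
theorem isUnit_det (h : IsCoordChange G' G Ψ U V) (hy : y ∈ U) : IsUnit (jac Ψ y).det := by
  rw [isUnit_iff_ne_zero]
  intro h0
  have := h.source.det_pos hy
  rw [h.det_eq hy, h0] at this
  simp at this

theorem inv_eq (h : IsCoordChange G' G Ψ U V) (hy : y ∈ U) :
    (G (Ψ y))⁻¹ = jac Ψ y * (G' y)⁻¹ * (jac Ψ y).transpose := by
  have hJ := h.isUnit_det hy
  have hJ' : IsUnit (jac Ψ y).transpose.det := by rwa [Matrix.det_transpose]
  rw [h.pullback y hy, Matrix.mul_inv_rev, Matrix.mul_inv_rev, ← mul_assoc, ← mul_assoc,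
    Matrix.mul_nonsing_inv _ hJ, one_mul, mul_assoc, Matrix.nonsing_inv_mul _ hJ', mul_one]

theorem smooth_coord (h : IsCoordChange G' G Ψ U V) (a : Fin d) :
    ContDiffOn ℝ ∞ (fun z => Ψ z a) U :=
  (EuclideanSpace.proj a : Eucl d →L[ℝ] ℝ).contDiff.comp_contDiffOn h.smooth

theorem smooth_jac (h : IsCoordChange G' G Ψ U V) : SmoothM (jac Ψ) U := fun a i =>
  contDiffOn_pd h.source.isOpen (h.smooth_coord a) i

theorem pd_jac_symm (h : IsCoordChange G' G Ψ U V) (hy : y ∈ U) (i j a : Fin d) :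
    pdM i (jac Ψ) y a j = pdM j (jac Ψ) y a i :=
  pd_comm h.source.isOpen hy (h.smooth_coord a) i j

theorem pd_comp_eq (h : IsCoordChange G' G Ψ U V) (hy : y ∈ U) {f : Eucl d → ℝ}
    (hf : ContDiffOn ℝ ∞ f V) (i : Fin d) :
    pd i (fun z => f (Ψ z)) y = ∑ a, jac Ψ y a i * pd a f (Ψ y) :=
  pd_comp i (differentiableAt_of_contDiffOn h.target.isOpen (h.mapsTo hy) hf)
    (differentiableAt_of_contDiffOn h.source.isOpen hy h.smooth)

theorem pdM_comp_eq (h : IsCoordChange G' G Ψ U V) (hy : y ∈ U) {m n : Type*}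
    {A : Eucl d → Matrix m n ℝ} (hA : SmoothM A V) (i : Fin d) :
    pdM i (fun z => A (Ψ z)) y = ∑ a, jac Ψ y a i • pdM a A (Ψ y) := by
  ext b c
  simp only [pdM, Matrix.of_apply, Matrix.sum_apply, Matrix.smul_apply, smul_eq_mul]
  exact h.pd_comp_eq hy (hA b c) i

theorem smoothM_comp (h : IsCoordChange G' G Ψ U V) {m n : Type*}
    {A : Eucl d → Matrix m n ℝ} (hA : SmoothM A V) : SmoothM (fun z => A (Ψ z)) U :=
  fun a b => (hA a b).comp h.smooth h.mapsTo

theorem sum_swap_jac (J : Matrix (Fin d) (Fin d) ℝ) (D : Fin d → Matrix (Fin d) (Fin d) ℝ)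
    (i j l : Fin d) :
    (J.transpose * (∑ a, J a i • D a) * J) j l
      = ∑ a, ∑ b, ∑ c, J a i * J b j * J c l * D a b c := by
  simp only [Matrix.mul_apply, Matrix.transpose_apply, Matrix.sum_apply, Matrix.smul_apply,
    smul_eq_mul, Finset.mul_sum, Finset.sum_mul]
  rw [Finset.sum_comm]
  refine Finset.sum_congr rfl fun a _ => ?_
  rw [Finset.sum_comm]
  refine Finset.sum_congr rfl fun b _ => Finset.sum_congr rfl fun c _ => ?_
  ring

/-- The transformation law of the Christoffel symbols. -/
theorem gam_transform (h : IsCoordChange G' G Ψ U V) (hy : y ∈ U) (i : Fin d) :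
    jac Ψ y * gam G' i y
      = (∑ a, jac Ψ y a i • gam G a (Ψ y)) * jac Ψ y + pdM i (jac Ψ) y := by
  have hJ := h.isUnit_det hy
  have hU := h.source.isOpen
  have hΨy := h.mapsTo hy
  set J := jac Ψ y with hJdef
  -- `N` collects the second derivatives of `Ψ`. By symmetry of mixed partials it is unchanged when
  -- the derivative index and the column index are exchanged; `Mm` collects the derivatives of `G`.
  set N : Fin d → Matrix (Fin d) (Fin d) ℝ := fun i =>
    J.transpose * G (Ψ y) * pdM i (jac Ψ) y with hN
  set Mm : Fin d → Matrix (Fin d) (Fin d) ℝ := fun i =>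
    J.transpose * (∑ a, J a i • pdM a G (Ψ y)) * J with hMm
  have hNs : ∀ i j l, N i l j = N j l i := fun i j l => by
    simp only [hN, Matrix.mul_apply (M := J.transpose * G (Ψ y))]
    exact Finset.sum_congr rfl fun e _ => by rw [h.pd_jac_symm hy]
  have hd : ∀ i, pdM i G' y = (N i).transpose + Mm i + N i := fun i => by
    have h1 : pdM i G' y = pdM i (fun z => (jac Ψ z).transpose * G (Ψ z) * jac Ψ z) y := by
      ext a b
      exact pd_congr_on i hU hy fun z hz => by rw [h.pullback z hz]
    have hT : SmoothM (fun z => (jac Ψ z).transpose) U := fun a b => h.smooth_jac b a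
    have h2 : pdM i (fun z => (jac Ψ z).transpose) y = (pdM i (jac Ψ) y).transpose := rfl
    rw [h1, pdM_mul hU hy i (hT.mul (h.smoothM_comp h.target.smooth)) h.smooth_jac,
      pdM_mul hU hy i hT (h.smoothM_comp h.target.smooth), h2,
      h.pdM_comp_eq hy h.target.smooth]
    simp only [hN, hMm, Matrix.transpose_mul, Matrix.transpose_transpose,
      h.target.transpose hΨy]
    rw [add_mul, mul_assoc (pdM i (jac Ψ) y).transpose]
  have hunit : IsUnit (J.transpose * G (Ψ y)).det := by
    rw [Matrix.det_mul, Matrix.det_transpose]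
    exact hJ.mul (h.target.isUnit_det hΨy)
  -- After multiplication by the invertible matrix `Jᵀ G` both sides are lowered Christoffel
  -- symbols. In the cyclic combination of derivatives of `G'` the `N` terms cancel in pairs except
  -- for one, which is the inhomogeneous term.
  have key : J.transpose * G (Ψ y) * (J * gam G' i y) = J.transpose * G (Ψ y) *
      ((∑ a, J a i • gam G a (Ψ y)) * J + pdM i (jac Ψ) y) := by
    rw [← mul_assoc, hJdef, ← h.pullback y hy, ← hJdef, mul_add, ← mul_assoc,
      mul_assoc J.transpose, Finset.mul_sum]
    simp only [Matrix.mul_smul]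
    ext l j
    rw [h.source.mul_gam_apply hy, hd, hd, hd, Matrix.add_apply (_ * J),
      sum_swap_jac J (fun a => G (Ψ y) * gam G a (Ψ y))]
    simp only [Matrix.add_apply, Matrix.transpose_apply, h.target.mul_gam_apply hΨy]
    change _ = _ + N i l j
    rw [hNs i l j, hNs j l i, hNs i j l]
    simp only [hMm, sum_swap_jac]
    have h1 : ∑ a, ∑ b, ∑ c, J a j * J b i * J c l * pdM a G (Ψ y) b c
        = ∑ a, ∑ b, ∑ c, J a i * J b j * J c l * pdM b G (Ψ y) a c := by
      rw [Finset.sum_comm]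
      exact Finset.sum_congr rfl fun a _ => Finset.sum_congr rfl fun b _ =>
        Finset.sum_congr rfl fun c _ => by ring
    have h2 : ∑ a, ∑ b, ∑ c, J a l * J b i * J c j * pdM a G (Ψ y) b c
        = ∑ a, ∑ b, ∑ c, J a i * J b j * J c l * pdM c G (Ψ y) a b := by
      rw [Finset.sum_comm]
      refine Finset.sum_congr rfl fun a _ => ?_
      rw [Finset.sum_comm]
      exact Finset.sum_congr rfl fun b _ => Finset.sum_congr rfl fun c _ => by ring
    have h3 : ∑ a, ∑ b, ∑ c, J a i * J b l * J c j *
          (1 / 2 * (pdM a G (Ψ y) c b + pdM c G (Ψ y) a b - pdM b G (Ψ y) a c))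
        = 1 / 2 * ((∑ a, ∑ b, ∑ c, J a i * J b j * J c l * pdM a G (Ψ y) b c)
          + (∑ a, ∑ b, ∑ c, J a i * J b j * J c l * pdM b G (Ψ y) a c)
          - ∑ a, ∑ b, ∑ c, J a i * J b j * J c l * pdM c G (Ψ y) a b) := by
      simp only [← Finset.sum_add_distrib, ← Finset.sum_sub_distrib, Finset.mul_sum]
      refine Finset.sum_congr rfl fun a _ => ?_
      rw [Finset.sum_comm]
      exact Finset.sum_congr rfl fun b _ => Finset.sum_congr rfl fun c _ => by ring
    rw [h1, h2, h3]
    ring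
  calc J * gam G' i y = (J.transpose * G (Ψ y))⁻¹ *
        (J.transpose * G (Ψ y) * (J * gam G' i y)) := by
        rw [← mul_assoc, Matrix.nonsing_inv_mul _ hunit, one_mul]
    _ = _ := by rw [key, ← mul_assoc, Matrix.nonsing_inv_mul _ hunit, one_mul]

end IsCoordChange

end Coord

/-! ### Coordinate invariance of curvature, Laplacian, gradient pairing and covariant derivative. -/

namespace Coord

variable {d : ℕ}

/-- The Ricci tensor, as a matrix. -/
noncomputable def ric (G : Eucl d → Matrix (Fin d) (Fin d) ℝ) (y : Eucl d) :
    Matrix (Fin d) (Fin d) ℝ :=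
  Matrix.of fun j k => ∑ i, riemMat G i j y i k

theorem scalar_eq_trace (G : Eucl d → Matrix (Fin d) (Fin d) ℝ) (y : Eucl d) :
    scalar G y = ((G y)⁻¹ * (ric G y).transpose).trace := by
  simp [scalar, ric, riemMat, Matrix.trace, Matrix.mul_apply]

/-- The covariant Hessian of a function. -/
noncomputable def hess (G : Eucl d → Matrix (Fin d) (Fin d) ℝ) (f : Eucl d → ℝ) (y : Eucl d) :
    Matrix (Fin d) (Fin d) ℝ :=
  Matrix.of fun i j => pd i (pd j f) y - ∑ k, gam G i y k j * pd k f y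

/-- The inner product of the differentials of two functions. -/
noncomputable def gradInner (G : Eucl d → Matrix (Fin d) (Fin d) ℝ) (u f : Eucl d → ℝ)
    (y : Eucl d) : ℝ :=
  ∑ i, ∑ j, (G y)⁻¹ i j * pd i u y * pd j f y

open Matrix in
theorem gradInner_eq_dotProduct (G : Eucl d → Matrix (Fin d) (Fin d) ℝ) (u f : Eucl d → ℝ)
    (y : Eucl d) : gradInner G u f y
      = (fun i => pd i u y) ⬝ᵥ ((G y)⁻¹ *ᵥ fun j => pd j f y) := by
  simp only [gradInner, dotProduct, Matrix.mulVec, Finset.mul_sum]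
  exact Finset.sum_congr rfl fun i _ => Finset.sum_congr rfl fun j _ => by ring

/-- Covariant derivative of a vector field, in components. -/
noncomputable def covVec (G : Eucl d → Matrix (Fin d) (Fin d) ℝ) (v : Fin d → ℝ)
    (Y : Fin d → Eucl d → ℝ) (k : Fin d) (y : Eucl d) : ℝ :=
  ∑ i, v i * (pd i (Y k) y + ∑ j, christoffel G k i j y * Y j y)

/-- Passing from divergence form to minus the trace of the Hessian makes invariance a matter of
tensor algebra. Jacobi's formula gives `∂ᵢ √det g = √det g · tr Γᵢ`, and compatibility gives the
derivative of the inverse metric. -/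
theorem IsMetricOn.laplacian_eq {G : Eucl d → Matrix (Fin d) (Fin d) ℝ} {U : Set (Eucl d)}
    {y : Eucl d} (hG : IsMetricOn G U) (hy : y ∈ U) {f : Eucl d → ℝ} (hf : ContDiffOn ℝ ∞ f U) :
    laplacian G f y = -((G y)⁻¹ * (hess G f y).transpose).trace := by
  have hU := hG.isOpen
  have hdet := hG.smooth.det
  have hs : ContDiffOn ℝ ∞ (fun z => Real.sqrt (G z).det) U :=
    hdet.sqrt fun z hz => (hG.det_pos hz).ne'
  have hX : ∀ i, ContDiffOn ℝ ∞ (fun z => ∑ j, (G z)⁻¹ i j * pd j f z) U := fun i =>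
    ContDiffOn.sum fun j _ => (hG.smooth_inv i j).mul (contDiffOn_pd hU hf j)
  have hsd : ∀ i, pd i (fun z => Real.sqrt (G z).det) y
      = Real.sqrt (G y).det * (gam G i y).trace := fun i => by
    have h1 : HasFDerivAt (fun z => Real.sqrt (G z).det) _ y :=
      (differentiableAt_of_contDiffOn hU hy hdet).hasFDerivAt.sqrt (hG.det_pos hy).ne'
    have h2 : ((G y)⁻¹ * pdM i G y).trace = 2 * (gam G i y).trace := by
      rw [hG.pdM_eq hy, mul_add, ← mul_assoc, Matrix.nonsing_inv_mul _ (hG.isUnit_det hy), one_mul,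
        Matrix.trace_add, Matrix.trace_mul_comm, mul_assoc,
        Matrix.mul_nonsing_inv _ (hG.isUnit_det hy), mul_one, Matrix.trace_transpose]
      ring
    have h3 := pd_det hU hy i hG.smooth (hG.det_pos hy).ne'
    rw [pd] at h3
    rw [pd, h1.fderiv, _root_.smul_apply, h3, h2, smul_eq_mul]
    have h4 := Real.sqrt_pos.mpr (hG.det_pos hy)
    nth_rewrite 2 [← Real.mul_self_sqrt (hG.det_pos hy).le]
    field_simp
  have hXd : ∀ i, pd i (fun z => ∑ j, (G z)⁻¹ i j * pd j f z) y
      = ∑ j, (pdM i (fun z => (G z)⁻¹) y i j * pd j f y + (G y)⁻¹ i j * pd i (pd j f) y) :=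
    fun i => by
    have h1 := fun j => differentiableAt_of_contDiffOn hU hy (hG.smooth_inv i j)
    have h2 := fun j => differentiableAt_of_contDiffOn hU hy (contDiffOn_pd hU hf j)
    rw [pd_sum _ _ fun j _ => (h1 j).fun_mul (h2 j)]
    exact Finset.sum_congr rfl fun j _ => pd_mul i (h1 j) (h2 j)
  have h4 := (Real.sqrt_pos.mpr (hG.det_pos hy)).ne'
  unfold laplacian
  congr 1
  have h5 : ∀ i, pd i (fun z => Real.sqrt (G z).det * ∑ j, (G z)⁻¹ i j * pd j f z) y
      = Real.sqrt (G y).det * ((gam G i y).trace * ∑ j, (G y)⁻¹ i j * pd j f y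
        + ∑ j, (pdM i (fun z => (G z)⁻¹) y i j * pd j f y + (G y)⁻¹ i j * pd i (pd j f) y)) :=
    fun i => by
    rw [pd_mul i (differentiableAt_of_contDiffOn hU hy hs)
      (differentiableAt_of_contDiffOn hU hy (hX i)), hsd, hXd]
    ring
  simp only [h5, ← Finset.mul_sum]
  rw [← mul_assoc, inv_mul_cancel₀ h4, one_mul]
  simp only [hG.pdM_inv_eq hy, Matrix.neg_apply, Matrix.add_apply, Matrix.mul_apply,
    Matrix.transpose_apply, Matrix.trace, Matrix.diag_apply, hess, Matrix.of_apply, gam,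
    Finset.mul_sum, Finset.sum_mul, neg_mul, add_mul, mul_sub, Finset.sum_add_distrib,
    Finset.sum_sub_distrib, Finset.sum_neg_distrib]
  -- The contribution of the volume density cancels one half of the derivative of `g⁻¹`, by symmetry
  -- of the Christoffel symbols. The other half is the Hessian correction.
  have e1 : ∑ i, ∑ j, ∑ k, christoffel G k i k y * ((G y)⁻¹ i j * pd j f y)
      = ∑ i, ∑ j, ∑ k, christoffel G i i k y * (G y)⁻¹ k j * pd j f y := by
    rw [Finset.sum_comm]
    conv_rhs => rw [Finset.sum_comm]
    refine Finset.sum_congr rfl fun j _ => ?_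
    conv_rhs => rw [Finset.sum_comm]
    exact Finset.sum_congr rfl fun i _ => Finset.sum_congr rfl fun k _ => by
      rw [hG.christoffel_symm hy]; ring
  have e2 : ∑ i, ∑ j, ∑ k, (G y)⁻¹ i k * christoffel G j i k y * pd j f y
      = ∑ i, ∑ j, ∑ k, (G y)⁻¹ i j * (christoffel G k i j y * pd k f y) :=
    Finset.sum_congr rfl fun i _ => by
      rw [Finset.sum_comm]
      exact Finset.sum_congr rfl fun k _ => Finset.sum_congr rfl fun j _ => by ring
  linarith [e1, e2]

namespace IsCoordChange

variable {G' G : Eucl d → Matrix (Fin d) (Fin d) ℝ} {Ψ : Eucl d → Eucl d}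
  {U V : Set (Eucl d)} {y : Eucl d}

theorem sum_comm4 (F : Fin d → Fin d → Fin d → Fin d → ℝ) :
    ∑ i, ∑ c, ∑ a, ∑ b, F i c a b = ∑ a, ∑ b, ∑ c, ∑ i, F i c a b := by
  rw [Finset.sum_congr rfl fun i _ => Finset.sum_comm (f := fun c a => ∑ b, F i c a b),
    Finset.sum_comm]
  refine Finset.sum_congr rfl fun a _ => ?_
  rw [Finset.sum_congr rfl fun i _ => Finset.sum_comm (f := fun c b => F i c a b),
    Finset.sum_comm]
  exact Finset.sum_congr rfl fun b _ => Finset.sum_comm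

theorem smul_sum_mul_apply (J : Matrix (Fin d) (Fin d) ℝ) (D : Fin d → Matrix (Fin d) (Fin d) ℝ)
    (i c j : Fin d) :
    ((∑ a, J a i • D a) * J) c j = ∑ a, ∑ b, J a i * D a c b * J b j := by
  simp only [Matrix.mul_apply, Matrix.sum_apply, Matrix.smul_apply, smul_eq_mul, Finset.sum_mul]
  rw [Finset.sum_comm]

theorem transpose_mul_mul_apply (J X : Matrix (Fin d) (Fin d) ℝ) (i j : Fin d) :
    (J.transpose * X * J) i j = ∑ a, ∑ b, J a i * J b j * X a b := by
  simp only [Matrix.mul_apply, Matrix.transpose_apply, Finset.sum_mul]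
  rw [Finset.sum_comm]
  exact Finset.sum_congr rfl fun a _ => Finset.sum_congr rfl fun b _ => by ring

/-- The transformation law of the curvature. -/
theorem riemMat_transform (h : IsCoordChange G' G Ψ U V) (hy : y ∈ U) (i j : Fin d) :
    jac Ψ y * riemMat G' i j y
      = (∑ a, ∑ b, (jac Ψ y a i * jac Ψ y b j) • riemMat G a b (Ψ y)) * jac Ψ y := by
  have hU := h.source.isOpen
  -- `B` is the pulled-back connection before the change of frame, so the Christoffel law reads `J
  -- Γ'ᵢ = Bᵢ J + ∂ᵢJ`. The identity `key` is its derivative.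
  set B : Fin d → Eucl d → Matrix (Fin d) (Fin d) ℝ := fun i z =>
    ∑ a, jac Ψ z a i • gam G a (Ψ z) with hB
  have hBs : ∀ i, SmoothM (B i) U := fun i p q => by
    simp only [hB, Matrix.sum_apply, Matrix.smul_apply, smul_eq_mul]
    exact ContDiffOn.sum fun a _ => (h.smooth_jac a i).mul
      (h.smoothM_comp (h.target.smooth_gam a) p q)
  have hdJ : ∀ i, SmoothM (pdM i (jac Ψ)) U := fun i p q =>
    contDiffOn_pd hU (h.smooth_jac p q) i
  have hdB : ∀ i j, pdM j (B i) y = ∑ a, (pdM j (jac Ψ) y a i • gam G a (Ψ y)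
      + jac Ψ y a i • ∑ b, jac Ψ y b j • pdM b (gam G a) (Ψ y)) := fun i j => by
    ext p q
    have h1 := fun a => differentiableAt_of_contDiffOn hU hy (h.smooth_jac a i)
    have h2 := fun a => differentiableAt_of_contDiffOn hU hy
      (h.smoothM_comp (h.target.smooth_gam a) p q)
    simp only [← h.pdM_comp_eq hy (h.target.smooth_gam _)]
    simp only [hB, Matrix.sum_apply, Matrix.smul_apply, smul_eq_mul, Matrix.add_apply, pdM,
      Matrix.of_apply]
    rw [pd_sum _ _ fun a _ => (h1 a).fun_mul (h2 a)]
    exact Finset.sum_congr rfl fun a _ => pd_mul j (h1 a) (h2 a)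
  have key : ∀ i j, pdM j (jac Ψ) y * gam G' i y + jac Ψ y * pdM j (gam G' i) y
      = pdM j (B i) y * jac Ψ y + B i y * pdM j (jac Ψ) y + pdM j (pdM i (jac Ψ)) y := by
    intro i j
    rw [← pdM_mul hU hy j h.smooth_jac (h.source.smooth_gam i),
      ← pdM_mul hU hy j (hBs i) h.smooth_jac]
    have h1 : pdM j (fun z => jac Ψ z * gam G' i z) y
        = pdM j (fun z => B i z * jac Ψ z + pdM i (jac Ψ) z) y := by
      ext p q
      exact pd_congr_on j hU hy fun z hz => by simp only [h.gam_transform hz i]; rfl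
    rw [h1]
    ext p q
    exact pd_add j (differentiableAt_of_contDiffOn hU hy (((hBs i).mul h.smooth_jac) p q))
      (differentiableAt_of_contDiffOn hU hy (hdJ i p q))
  have hcomm : pdM i (pdM j (jac Ψ)) y = pdM j (pdM i (jac Ψ)) y := by
    ext p q
    exact pd_comm hU hy (h.smooth_jac p q) i j
  have k1 := key i j
  have k2 := key j i
  have g1 := h.gam_transform hy i
  have g2 := h.gam_transform hy j
  change _ = B i y * _ + _ at g1
  change _ = B j y * _ + _ at g2
  -- The curvature of `B` is the pull-back of the curvature of `G`: the second derivatives of `Ψ`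
  -- cancel on antisymmetrizing.
  have hR : ∑ a, ∑ b, (jac Ψ y a i * jac Ψ y b j) • riemMat G a b (Ψ y)
      = pdM i (B j) y - pdM j (B i) y + (B i y * B j y - B j y * B i y) := by
    rw [hdB, hdB]
    simp only [IsMetricOn.riemMat_eq, smul_add, smul_sub, Finset.sum_add_distrib,
      Finset.sum_sub_distrib, Finset.smul_sum, smul_smul]
    have e1 : ∑ a, pdM i (jac Ψ) y a j • gam G a (Ψ y)
        = ∑ a, pdM j (jac Ψ) y a i • gam G a (Ψ y) :=
      Finset.sum_congr rfl fun a _ => by rw [h.pd_jac_symm hy]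
    have e2 : ∑ a, ∑ b, (jac Ψ y a j * jac Ψ y b i) • pdM b (gam G a) (Ψ y)
        = ∑ a, ∑ b, (jac Ψ y a i * jac Ψ y b j) • pdM a (gam G b) (Ψ y) := by
      rw [Finset.sum_comm]
      exact Finset.sum_congr rfl fun a _ => Finset.sum_congr rfl fun b _ => by rw [mul_comm]
    have e3 : B i y * B j y = ∑ a, ∑ b, (jac Ψ y a i * jac Ψ y b j) •
        (gam G a (Ψ y) * gam G b (Ψ y)) := by
      simp only [hB, Finset.sum_mul, Finset.mul_sum, Matrix.smul_mul, Matrix.mul_smul, smul_smul]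
      rw [Finset.sum_comm]
      exact Finset.sum_congr rfl fun a _ => Finset.sum_congr rfl fun b _ => by
        rw [mul_comm]
    have e4 : B j y * B i y = ∑ a, ∑ b, (jac Ψ y a i * jac Ψ y b j) •
        (gam G b (Ψ y) * gam G a (Ψ y)) := by
      simp only [hB, Finset.sum_mul, Finset.mul_sum, Matrix.smul_mul, Matrix.mul_smul, smul_smul]
    rw [e1, e2, e3, e4]
    abel
  rw [hR, IsMetricOn.riemMat_eq]
  have c1 : jac Ψ y * (gam G' i y * gam G' j y)
      = B i y * (B j y * jac Ψ y + pdM j (jac Ψ) y) + pdM i (jac Ψ) y * gam G' j y := by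
    rw [← mul_assoc, g1, add_mul, mul_assoc, g2]
  have c2 : jac Ψ y * (gam G' j y * gam G' i y)
      = B j y * (B i y * jac Ψ y + pdM i (jac Ψ) y) + pdM j (jac Ψ) y * gam G' i y := by
    rw [← mul_assoc, g2, add_mul, mul_assoc, g1]
  rw [mul_add, mul_sub, mul_sub, c1, c2, eq_sub_of_add_eq' k1, eq_sub_of_add_eq' k2, hcomm]
  noncomm_ring

/-- Contracting the upper index with a lower one pairs a Jacobian with its inverse. Only the two
free indices keep a Jacobian factor. -/
theorem ric_transform (h : IsCoordChange G' G Ψ U V) (hy : y ∈ U) :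
    ric G' y = (jac Ψ y).transpose * ric G (Ψ y) * jac Ψ y := by
  have hJ := h.isUnit_det hy
  set J := jac Ψ y with hJdef
  have h1 : ∀ i j, riemMat G' i j y
      = J⁻¹ * ((∑ a, ∑ b, (J a i * J b j) • riemMat G a b (Ψ y)) * J) := fun i j => by
    rw [← h.riemMat_transform hy, ← mul_assoc, Matrix.nonsing_inv_mul _ hJ, one_mul]
  have h2 : ∀ a c, ∑ i, J a i * J⁻¹ i c = if a = c then 1 else 0 := fun a c => by
    rw [← Matrix.mul_apply, Matrix.mul_nonsing_inv _ hJ, Matrix.one_apply]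
  ext j k
  have h3 : ∀ i c, ((∑ a, ∑ b, (J a i * J b j) • riemMat G a b (Ψ y)) * J) c k
      = ∑ a, ∑ b, J a i * J b j * (riemMat G a b (Ψ y) * J) c k := fun i c => by
    simp only [Finset.sum_mul, Matrix.smul_mul, Matrix.sum_apply, Matrix.smul_apply, smul_eq_mul]
  have h4 : ric G' y j k = ∑ a, ∑ b, ∑ c, (∑ i, J a i * J⁻¹ i c) * (J b j *
      (riemMat G a b (Ψ y) * J) c k) := by
    simp only [ric, Matrix.of_apply, h1]
    simp only [Matrix.mul_apply (M := J⁻¹)]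
    simp only [h3]
    simp only [Finset.mul_sum, Finset.sum_mul]
    rw [sum_comm4]
    exact Finset.sum_congr rfl fun a _ => Finset.sum_congr rfl fun b _ =>
      Finset.sum_congr rfl fun c _ => Finset.sum_congr rfl fun i _ => by ring
  rw [h4]
  simp only [h2, ite_mul, one_mul, zero_mul, Finset.sum_ite_eq, Finset.mem_univ, if_true]
  rw [transpose_mul_mul_apply]
  simp only [Matrix.mul_apply, ric, Matrix.of_apply, Finset.mul_sum]
  rw [Finset.sum_comm]
  refine Finset.sum_congr rfl fun b _ => ?_
  rw [Finset.sum_comm]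
  exact Finset.sum_congr rfl fun e _ => Finset.sum_congr rfl fun a _ => by ring

/-- The scalar curvature does not depend on the coordinates. -/
theorem scalar_eq (h : IsCoordChange G' G Ψ U V) (hy : y ∈ U) :
    scalar G' y = scalar G (Ψ y) := by
  rw [scalar_eq_trace, scalar_eq_trace, h.ric_transform hy, h.inv_eq hy, Matrix.transpose_mul,
    Matrix.transpose_mul, Matrix.transpose_transpose, ← mul_assoc, ← mul_assoc,
    Matrix.trace_mul_comm]
  simp only [mul_assoc]

/-- The second derivatives of `Ψ` produced by the chain rule cancel against the inhomogeneous term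
of the Christoffel law. -/
theorem hess_transform (h : IsCoordChange G' G Ψ U V) (hy : y ∈ U) {f : Eucl d → ℝ}
    (hf : ContDiffOn ℝ ∞ f V) :
    hess G' (fun z => f (Ψ z)) y = (jac Ψ y).transpose * hess G f (Ψ y) * jac Ψ y := by
  have hU := h.source.isOpen
  have hV := h.target.isOpen
  ext i j
  have h1 : pd i (pd j fun z => f (Ψ z)) y = ∑ a, (pdM i (jac Ψ) y a j * pd a f (Ψ y)
      + jac Ψ y a j * ∑ b, jac Ψ y b i * pd b (pd a f) (Ψ y)) := by
    have d1 := fun a => differentiableAt_of_contDiffOn hU hy (h.smooth_jac a j)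
    have d2 := fun a => differentiableAt_of_contDiffOn hU hy
      (f := fun z => pd a f (Ψ z)) ((contDiffOn_pd hV hf a).comp h.smooth h.mapsTo)
    rw [pd_congr_on i hU hy fun z hz => h.pd_comp_eq hz hf j,
      pd_sum _ _ fun a _ => (d1 a).fun_mul (d2 a)]
    refine Finset.sum_congr rfl fun a _ => ?_
    rw [← h.pd_comp_eq hy (contDiffOn_pd hV hf a) i]
    exact pd_mul i (d1 a) (d2 a)
  have h2 : ∑ k, gam G' i y k j * pd k (fun z => f (Ψ z)) y
      = ∑ c, (jac Ψ y * gam G' i y) c j * pd c f (Ψ y) := by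
    simp only [h.pd_comp_eq hy hf, Finset.mul_sum, Matrix.mul_apply, Finset.sum_mul]
    rw [Finset.sum_comm]
    exact Finset.sum_congr rfl fun c _ => Finset.sum_congr rfl fun k _ => by ring
  simp only [hess, Matrix.of_apply]
  rw [h1, h2, h.gam_transform hy]
  have h3 : ∑ a, jac Ψ y a j * ∑ b, jac Ψ y b i * pd b (pd a f) (Ψ y)
      = ∑ a, ∑ b, jac Ψ y a i * jac Ψ y b j * pd a (pd b f) (Ψ y) := by
    simp only [Finset.mul_sum]
    rw [Finset.sum_comm]
    exact Finset.sum_congr rfl fun a _ => Finset.sum_congr rfl fun b _ => by ring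
  have h4 : ∑ c, ((∑ a, jac Ψ y a i • gam G a (Ψ y)) * jac Ψ y) c j * pd c f (Ψ y)
      = ∑ a, ∑ b, jac Ψ y a i * jac Ψ y b j * ∑ c, gam G a (Ψ y) c b * pd c f (Ψ y) := by
    simp only [smul_sum_mul_apply, Finset.sum_mul, Finset.mul_sum]
    rw [Finset.sum_comm]
    refine Finset.sum_congr rfl fun a _ => ?_
    rw [Finset.sum_comm]
    exact Finset.sum_congr rfl fun b _ => Finset.sum_congr rfl fun c _ => by ring
  rw [transpose_mul_mul_apply]
  simp only [Matrix.add_apply, add_mul, Finset.sum_add_distrib, h3, h4, Matrix.of_apply, mul_sub,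
    Finset.sum_sub_distrib]
  ring

/-- The Laplacian does not depend on the coordinates. -/
theorem laplacian_eq (h : IsCoordChange G' G Ψ U V) (hy : y ∈ U) {f : Eucl d → ℝ}
    (hf : ContDiffOn ℝ ∞ f V) :
    laplacian G' (fun z => f (Ψ z)) y = laplacian G f (Ψ y) := by
  rw [h.source.laplacian_eq (f := fun z => f (Ψ z)) hy (hf.comp h.smooth h.mapsTo),
    h.target.laplacian_eq (h.mapsTo hy) hf, h.hess_transform hy hf, h.inv_eq hy,
    Matrix.transpose_mul,
    Matrix.transpose_mul, Matrix.transpose_transpose, ← mul_assoc, ← mul_assoc,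
    Matrix.trace_mul_comm]
  simp only [mul_assoc]

open Matrix in
theorem gradInner_eq (h : IsCoordChange G' G Ψ U V) (hy : y ∈ U) {u f : Eucl d → ℝ}
    (hu : ContDiffOn ℝ ∞ u V) (hf : ContDiffOn ℝ ∞ f V) :
    gradInner G' (fun z => u (Ψ z)) (fun z => f (Ψ z)) y = gradInner G u f (Ψ y) := by
  rw [gradInner_eq_dotProduct, gradInner_eq_dotProduct, h.inv_eq hy]
  have h1 : ∀ w : Eucl d → ℝ, ContDiffOn ℝ ∞ w V → (fun i => pd i (fun z => w (Ψ z)) y)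
      = (jac Ψ y).transpose *ᵥ fun a => pd a w (Ψ y) := fun w hw => by
    ext i
    rw [h.pd_comp_eq hy hw]
    rfl
  rw [h1 u hu, h1 f hf, ← Matrix.mulVec_mulVec, ← Matrix.mulVec_mulVec, Matrix.dotProduct_mulVec _ (jac Ψ y),
    Matrix.mulVec_transpose]

/-- The covariant derivative of vector fields does not depend on the coordinates. -/
theorem covVec_eq (h : IsCoordChange G' G Ψ U V) (hy : y ∈ U) {Y' Y : Fin d → Eucl d → ℝ}
    {v' v : Fin d → ℝ} (hv : ∀ a, v a = ∑ i, jac Ψ y a i * v' i)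
    (hYY : ∀ᶠ z in 𝓝 y, ∀ c, Y c (Ψ z) = ∑ k, jac Ψ z c k * Y' k z)
    (hY' : ∀ k, DifferentiableAt ℝ (Y' k) y) (hY : ∀ k, DifferentiableAt ℝ (Y k) (Ψ y))
    (c : Fin d) :
    covVec G v Y c (Ψ y) = ∑ k, jac Ψ y c k * covVec G' v' Y' k y := by
  have hU := h.source.isOpen
  have hv' : ∀ F : Fin d → ℝ, ∑ a, v a * F a = ∑ i, v' i * ∑ a, jac Ψ y a i * F a := fun F => by
    simp only [hv, Finset.sum_mul, Finset.mul_sum]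
    rw [Finset.sum_comm]
    exact Finset.sum_congr rfl fun i _ => Finset.sum_congr rfl fun a _ => by ring
  -- Differentiating the relation between the component functions creates a derivative of the
  -- Jacobian. In `h4` it is absorbed by the inhomogeneous Christoffel term.
  have h1 : ∀ i, ∑ a, jac Ψ y a i * pd a (Y c) (Ψ y)
      = ∑ k, (pdM i (jac Ψ) y c k * Y' k y + jac Ψ y c k * pd i (Y' k) y) := fun i => by
    have d1 := fun k => differentiableAt_of_contDiffOn hU hy (h.smooth_jac c k)
    have e1 := pd_comp i (hY c) (differentiableAt_of_contDiffOn hU hy h.smooth)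
    have e2 := pd_congr i (hYY.mono fun z hz => hz c)
    rw [e1, pd_sum _ _ fun k _ => (d1 k).fun_mul (hY' k)] at e2
    exact e2.trans (Finset.sum_congr rfl fun k _ => pd_mul i (d1 k) (hY' k))
  have h2 : ∀ i, ∑ k, jac Ψ y c k * ∑ j, christoffel G' k i j y * Y' j y
      = ∑ j, (jac Ψ y * gam G' i y) c j * Y' j y := fun i => by
    simp only [Matrix.mul_apply, Finset.mul_sum, Finset.sum_mul]
    rw [Finset.sum_comm]
    exact Finset.sum_congr rfl fun j _ => Finset.sum_congr rfl fun k _ => by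
      rw [← mul_assoc]; rfl
  have h3 : ∀ i, ∑ a, jac Ψ y a i * ∑ b, christoffel G c a b (Ψ y) * Y b (Ψ y)
      = ∑ j, ((∑ a, jac Ψ y a i • gam G a (Ψ y)) * jac Ψ y) c j * Y' j y := fun i => by
    simp only [hYY.self_of_nhds, smul_sum_mul_apply, Finset.mul_sum, Finset.sum_mul]
    rw [Finset.sum_comm (s := Finset.univ) (f := fun j a => ∑ b, _ * Y' j y)]
    refine Finset.sum_congr rfl fun a _ => ?_
    rw [Finset.sum_comm]
    exact Finset.sum_congr rfl fun j _ => Finset.sum_congr rfl fun b _ => by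
      simp only [gam, Matrix.of_apply]; ring
  have h4 : ∀ i, ∑ a, jac Ψ y a i * (pd a (Y c) (Ψ y) + ∑ j, christoffel G c a j (Ψ y) * Y j (Ψ y))
      = ∑ k, jac Ψ y c k * (pd i (Y' k) y + ∑ j, christoffel G' k i j y * Y' j y) := fun i => by
    simp only [mul_add, Finset.sum_add_distrib, h1, h2, h3, h.gam_transform hy, Matrix.add_apply,
      add_mul]
    ring
  simp only [covVec]
  rw [hv']
  simp only [h4, Finset.mul_sum]
  rw [Finset.sum_comm]
  refine Finset.sum_congr rfl fun k _ => Finset.sum_congr rfl fun i _ => ?_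
  ring


end IsCoordChange

end Coord

/-! ### Scalar comparison for Riccati inequalities. -/

theorem sub_le_mul_of_hasDerivAt_le {f f' : ℝ → ℝ} {a b c : ℝ} (hab : a ≤ b)
    (hf : ∀ x ∈ Icc a b, HasDerivAt f (f' x) x) (h : ∀ x ∈ Icc a b, f' x ≤ c) :
    f b - f a ≤ c * (b - a) := by
  refine (convex_Icc a b).image_sub_le_mul_sub_of_deriv_le (f := f)
    (fun x hx => (hf x hx).continuousAt.continuousWithinAt)
    (fun x hx => (hf x (interior_subset hx)).differentiableAt.differentiableWithinAt)
    (fun x hx => ?_) a (left_mem_Icc.mpr hab) b (right_mem_Icc.mpr hab) hab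
  rw [(hf x (interior_subset hx)).deriv]
  exact h x (interior_subset hx)

/-- A solution of the trace of the Riccati equation on a half-line, with right-hand side `O(ρ⁻³)`,
is `O(ρ⁻¹)`. -/
theorem abs_le_of_riccati {C ρ₀ : ℝ} (hC : 1 ≤ C) (hρ₀ : 1 ≤ ρ₀) {θ q θ' : ℝ → ℝ}
    (hθ : ∀ x ≥ ρ₀, HasDerivAt θ (θ' x) x) (h1 : ∀ x ≥ ρ₀, θ' x + q x ≤ C / x ^ 3)
    (h2 : ∀ x ≥ ρ₀, θ x ^ 2 ≤ C * q x) {ρ : ℝ} (hρ : 2 * ρ₀ ≤ ρ) : |θ ρ| ≤ 4 * C / ρ := by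
  have hρ0 : 0 < ρ := by linarith
  have hC0 : 0 < C := by linarith
  -- This bounds the derivative of `t² θ` for a weight `t` of unit slope. Since `θ' ≤ C / x³ - θ² /
  -- C`, completing the square absorbs `2 t θ`.
  have main : ∀ x ≥ ρ₀, ∀ t, |t| ≤ x → 2 * t * θ x + t ^ 2 * θ' x ≤ 2 * C := by
    intro x hx t ht
    have hx0 : 1 ≤ x := by linarith
    have a1 : t ^ 2 * θ' x ≤ t ^ 2 * (C / x ^ 3 - θ x ^ 2 / C) := by
      refine mul_le_mul_of_nonneg_left ?_ (sq_nonneg t)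
      have : θ x ^ 2 / C ≤ q x := by rw [div_le_iff₀ hC0]; linarith [h2 x hx]
      linarith [h1 x hx]
    have a2 : t ^ 2 * (C / x ^ 3) ≤ C := by
      have ht2 : t ^ 2 ≤ x ^ 2 := by
        rw [← sq_abs t]; exact pow_le_pow_left₀ (abs_nonneg t) ht 2
      rw [mul_div_assoc', div_le_iff₀ (by positivity)]
      have : x ^ 2 ≤ x ^ 3 := pow_le_pow_right₀ hx0 (by norm_num)
      nlinarith
    have a3 : 2 * t * θ x - t ^ 2 * (θ x ^ 2 / C) ≤ C := by
      have : 0 ≤ (t * θ x - C) ^ 2 / C := by positivity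
      have e : (t * θ x - C) ^ 2 / C = t ^ 2 * (θ x ^ 2 / C) - 2 * t * θ x + C := by
        field_simp; ring
      linarith
    nlinarith
  rw [abs_le]
  constructor
  -- Lower bound: the weight vanishes at `2ρ`, so the unknown value there drops out.
  · have := sub_le_mul_of_hasDerivAt_le (f := fun x => (2 * ρ - x) ^ 2 * θ x)
      (f' := fun x => 2 * (x - 2 * ρ) * θ x + (x - 2 * ρ) ^ 2 * θ' x) (a := ρ) (b := 2 * ρ)
      (c := 2 * C) (by linarith) (fun x hx => ?_) (fun x hx => ?_)
    · have e : -(4 * C / ρ) = -(4 * C * ρ) / ρ ^ 2 := by field_simp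
      rw [e, div_le_iff₀ (by positivity)]
      nlinarith [mul_pos hC0 hρ0]
    · have hd : HasDerivAt (fun x => (2 * ρ - x) ^ 2) (2 * (x - 2 * ρ)) x := by
        have := ((hasDerivAt_id x).const_sub (2 * ρ)).pow 2
        convert! this using 1
        simp; ring
      have := hd.mul (hθ x (by linarith [hx.1]))
      convert! this using 1
      ring
    · exact main x (by linarith [hx.1]) _ (by rw [abs_le]; constructor <;> linarith [hx.1, hx.2])
  -- Upper bound: the weight vanishes at `ρ / 2`, which is why `ρ` must be at least `2 * ρ₀`. This
  -- side produces the constant `4`.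
  · have := sub_le_mul_of_hasDerivAt_le (f := fun x => (x - ρ / 2) ^ 2 * θ x)
      (f' := fun x => 2 * (x - ρ / 2) * θ x + (x - ρ / 2) ^ 2 * θ' x) (a := ρ / 2) (b := ρ)
      (c := 2 * C) (by linarith) (fun x hx => ?_) (fun x hx => ?_)
    · rw [le_div_iff₀ hρ0]
      have h3 : (ρ - ρ / 2) ^ 2 * θ ρ ≤ 2 * C * (ρ - ρ / 2) := by
        have h0 : (ρ / 2 - ρ / 2) ^ 2 * θ (ρ / 2) = 0 := by ring
        linarith
      have h4 : ρ / 4 * (θ ρ * ρ) ≤ ρ / 4 * (4 * C) := by nlinarith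
      exact le_of_mul_le_mul_left h4 (by positivity)
    · have hd : HasDerivAt (fun x => (x - ρ / 2) ^ 2) (2 * (x - ρ / 2)) x := by
        have := ((hasDerivAt_id x).sub_const (ρ / 2)).pow 2
        convert! this using 1
        simp
      exact hd.mul (hθ x (by linarith [hx.1]))
    · exact main x (by linarith [hx.1]) _ (by rw [abs_le]; constructor <;> linarith [hx.1, hx.2])

/-- Decay of the square norm `q` of a solution of the Riccati equation with trace `θ`. -/
theorem le_of_riccati {C ρ₀ : ℝ} (hC : 1 ≤ C) (hρ₀ : 1 ≤ ρ₀) {θ q θ' q' : ℝ → ℝ}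
    (hθ : ∀ x ≥ ρ₀, HasDerivAt θ (θ' x) x) (hq : ∀ x ≥ ρ₀, HasDerivAt q (q' x) x)
    (hq0 : ∀ x ≥ ρ₀, 0 ≤ q x) (h1 : ∀ x ≥ ρ₀, θ' x + q x ≤ C / x ^ 3)
    (h2 : ∀ x ≥ ρ₀, θ x ^ 2 ≤ C * q x)
    (h3 : ∀ x ≥ ρ₀, -(C * (q x * √(q x))) - C * √(q x) / x ^ 3 ≤ q' x)
    {ρ : ℝ} (hρ : 2 * ρ₀ ≤ ρ) : q ρ ≤ ((1 + C) * (9 * C + 1) / ρ) ^ 2 := by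
  have hρ0 : 0 < ρ := by linarith
  have hρ1 : 1 ≤ ρ := by linarith
  have hC0 : 0 < C := by linarith
  -- The shift makes `√(q + ε)` positive and differentiable. The choice `ε = ρ⁻²` also dominates
  -- `x⁻³` for `x ≥ ρ`, so the curvature term is absorbed into `C y³`.
  set ε : ℝ := (ρ⁻¹) ^ 2 with hε
  have hε0 : 0 < ε := by positivity
  set y : ℝ → ℝ := fun x => √(q x + ε) with hy
  have hpos : ∀ x ≥ ρ₀, 0 < q x + ε := fun x hx => by linarith [hq0 x hx]
  have hy0 : ∀ x ≥ ρ₀, 0 < y x := fun x hx => Real.sqrt_pos.mpr (hpos x hx)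
  have hysq : ∀ x ≥ ρ₀, y x ^ 2 = q x + ε := fun x hx => Real.sq_sqrt (hpos x hx).le
  have hz : ∀ x ≥ ρ₀, HasDerivAt (fun x => (y x)⁻¹) (-(q' x / (2 * y x)) / y x ^ 2) x :=
    fun x hx => (((hq x hx).add_const ε).sqrt (hpos x hx).ne').inv (hy0 x hx).ne'
  -- The inequality `y' ≥ -C y²` says that `1 / y` grows at most linearly; hence `q + ε` stays above
  -- an explicit inverse square on `[ρ, 2ρ]`.
  have hz' : ∀ x ≥ ρ, -(q' x / (2 * y x)) / y x ^ 2 ≤ C := by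
    intro x hx
    have hx' : ρ₀ ≤ x := by linarith
    have hyx := hy0 x hx'
    have hs : √(q x) ≤ y x := Real.sqrt_le_sqrt (by linarith)
    have hs0 := Real.sqrt_nonneg (q x)
    have e1 : 1 / x ^ 3 ≤ y x ^ 2 := by
      have : 1 / x ^ 3 ≤ 1 / ρ ^ 2 := by
        apply one_div_le_one_div_of_le (by positivity)
        calc ρ ^ 2 ≤ x ^ 2 := pow_le_pow_left₀ hρ0.le hx 2
          _ ≤ x ^ 3 := pow_le_pow_right₀ (by linarith) (by norm_num)
      have h4 : 1 / ρ ^ 2 = ε := by rw [hε]; field_simp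
      rw [hysq x hx']
      linarith [hq0 x hx']
    have e2 : q x * √(q x) ≤ y x ^ 2 * y x :=
      mul_le_mul (by rw [hysq x hx']; linarith) hs hs0 (by positivity)
    have e3 : √(q x) / x ^ 3 ≤ y x * y x ^ 2 := by
      rw [div_eq_mul_one_div]
      exact mul_le_mul hs e1 (by have : 0 < x := by linarith
                                 positivity) hyx.le
    have e4 : -q' x ≤ 2 * C * (y x) ^ 3 := by
      have := h3 x hx'
      rw [mul_div_assoc] at this
      nlinarith
    rw [← neg_div, div_div, div_le_iff₀ (by positivity)]
    nlinarith
  set z₁ := (y ρ)⁻¹ with hz₁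
  have hρ' : ρ₀ ≤ ρ := by linarith
  have hz₁0 : 0 < z₁ := inv_pos.mpr (hy0 ρ hρ')
  have hzle : ∀ x ≥ ρ, (y x)⁻¹ ≤ z₁ + C * (x - ρ) := by
    intro x hx
    have := sub_le_mul_of_hasDerivAt_le hx (fun u hu => hz u (by linarith [hu.1]))
      (fun u hu => hz' u hu.1)
    linarith
  have hqge : ∀ x ≥ ρ, (z₁ + C * (x - ρ))⁻¹ ^ 2 ≤ q x + ε := by
    intro x hx
    have hx' : ρ₀ ≤ x := by linarith
    rw [← hysq x hx']
    have h4 : (z₁ + C * (x - ρ))⁻¹ ≤ y x := by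
      rw [inv_le_comm₀ (by have := mul_nonneg hC0.le (sub_nonneg.mpr hx); linarith) (hy0 x hx')]
      exact hzle x hx
    exact pow_le_pow_left₀ (inv_nonneg.mpr
      (by have := mul_nonneg hC0.le (sub_nonneg.mpr hx); linarith)) h4 2
  -- The subtracted term is minus a primitive of that inverse square. The traced equation therefore
  -- bounds the derivative by `C / x³ + ε`, and the values of `θ` at both ends are already known to
  -- be `O(ρ⁻¹)`.
  have hΦ := sub_le_mul_of_hasDerivAt_le (f := fun x => θ x - C⁻¹ * (z₁ + C * (x - ρ))⁻¹)
      (f' := fun x => θ' x - C⁻¹ * (-C / (z₁ + C * (x - ρ)) ^ 2)) (a := ρ) (b := 2 * ρ)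
      (c := (C + 1) * ε) (by linarith) (fun x hx => ?_) (fun x hx => ?_)
  · have t1 := abs_le.mp (abs_le_of_riccati hC hρ₀ hθ h1 h2 hρ)
    have t2 := abs_le.mp (abs_le_of_riccati hC hρ₀ hθ h1 h2 (show 2 * ρ₀ ≤ 2 * ρ by linarith))
    have t3 : 4 * C / (2 * ρ) ≤ 4 * C / ρ :=
      div_le_div_of_nonneg_left (by linarith) hρ0 (by linarith)
    have e1 : (C + 1) * ε * (2 * ρ - ρ) = (C + 1) / ρ := by rw [hε]; field_simp; ring
    have e2 : C⁻¹ * (z₁ + C * (ρ - ρ))⁻¹ = C⁻¹ * z₁⁻¹ := by simp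
    have e3 : 2 * ρ - ρ = ρ := by ring
    simp only [e2] at hΦ
    rw [e1, e3] at hΦ
    have e4 : C⁻¹ * z₁⁻¹ - C⁻¹ * (z₁ + C * ρ)⁻¹ ≤ (9 * C + 1) / ρ := by
      have : (9 * C + 1) / ρ = (C + 1) / ρ + 4 * C / ρ + 4 * C / ρ := by ring
      linarith [t1.1, t1.2, t2.1, t2.2]
    have e5 : z₁ ≤ ρ := by
      rw [hz₁, inv_le_comm₀ (hy0 ρ hρ') hρ0]
      refine Real.le_sqrt_of_sq_le ?_
      linarith [hq0 ρ hρ']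
    -- As `z₁ ≤ ρ`, the integral of the inverse square over an interval of length `ρ` is at least a
    -- fixed fraction of `y ρ`. The integrated bound thus becomes a bound on `y ρ`.
    have e6 : z₁⁻¹ / (1 + C) ≤ C⁻¹ * z₁⁻¹ - C⁻¹ * (z₁ + C * ρ)⁻¹ := by
      have : C⁻¹ * z₁⁻¹ - C⁻¹ * (z₁ + C * ρ)⁻¹ = z₁⁻¹ * (ρ / (z₁ + C * ρ)) := by
        have : 0 < z₁ + C * ρ := by positivity
        field_simp; ring
      rw [this, div_eq_mul_inv]
      refine mul_le_mul_of_nonneg_left ?_ (inv_nonneg.mpr hz₁0.le)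
      rw [inv_eq_one_div, div_le_div_iff₀ (by positivity) (by positivity)]
      nlinarith
    have e7 : y ρ ≤ (1 + C) * (9 * C + 1) / ρ := by
      have : z₁⁻¹ = y ρ := by rw [hz₁, inv_inv]
      rw [← this]
      have h5 := e6.trans e4
      rw [div_le_iff₀ (by positivity)] at h5
      calc z₁⁻¹ ≤ _ := h5
        _ = _ := by ring
    calc q ρ ≤ y ρ ^ 2 := by rw [hysq ρ hρ']; linarith
      _ ≤ _ := pow_le_pow_left₀ (hy0 ρ hρ').le e7 2
  · have hp : 0 < z₁ + C * (x - ρ) := by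
      have := mul_nonneg hC0.le (sub_nonneg.mpr hx.1); linarith
    have hd : HasDerivAt (fun x => z₁ + C * (x - ρ)) C x := by
      simpa using (((hasDerivAt_id x).sub_const ρ).const_mul C).const_add z₁
    exact (hθ x (by linarith [hx.1])).sub ((hd.inv hp.ne').const_mul C⁻¹)
  · have hx0 : ρ₀ ≤ x := by linarith [hx.1]
    have e1 := hqge x hx.1
    have e2 := h1 x hx0
    have e3 : C / x ^ 3 ≤ C * ε := by
      rw [hε, div_eq_mul_inv]
      refine mul_le_mul_of_nonneg_left ?_ hC0.le
      rw [inv_pow]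
      apply inv_anti₀ (by positivity)
      calc ρ ^ 2 ≤ x ^ 2 := pow_le_pow_left₀ hρ0.le hx.1 2
          _ ≤ x ^ 3 := pow_le_pow_right₀ (by linarith [hx.1]) (by norm_num)
    have e4 : C⁻¹ * (-C / (z₁ + C * (x - ρ)) ^ 2) = -((z₁ + C * (x - ρ))⁻¹ ^ 2) := by
      rw [inv_pow, neg_div, mul_neg, div_eq_mul_inv, ← mul_assoc, inv_mul_cancel₀ hC0.ne', one_mul]
    rw [e4]
    linarith

/-! ### Orthonormal frames, tensor norms and the bound of `ds` by `∇R`. -/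

namespace Coord

variable {d : ℕ}

theorem sum_fin_succ_fun {n : ℕ} {α : Type*} [Fintype α] (f : (Fin (n + 1) → α) → ℝ) :
    ∑ J, f J = ∑ a, ∑ J : Fin n → α, f (Fin.cons a J) := by
  rw [← (Fin.consEquiv fun _ => α).sum_comp, Fintype.sum_prod_type]
  rfl

/-- The components of a covariant tensor in the frame whose vectors are the columns of `E`. -/
def frameComp (E : Matrix (Fin d) (Fin d) ℝ) {r : ℕ} (T : (Fin r → Fin d) → ℝ)
    (A : Fin r → Fin d) : ℝ :=
  ∑ J, (∏ s, E (J s) (A s)) * T J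

/-- The columns of `E` are orthonormal for the inner product with matrix `G`. -/
def IsFrame (E G : Matrix (Fin d) (Fin d) ℝ) : Prop := E.transpose * G * E = 1

open scoped MatrixOrder Matrix.Norms.L2Operator in
-- Write `G = Bᵀ B` with `B` invertible and take the columns of `B⁻¹`.
theorem exists_isFrame {G : Matrix (Fin d) (Fin d) ℝ} (hG : G.PosDef) : ∃ E, IsFrame E G := by
  obtain ⟨B, hB⟩ := CStarAlgebra.nonneg_iff_eq_star_mul_self.mp hG.posSemidef.nonneg
  rw [Matrix.star_eq_conjTranspose] at hB
  have hu : IsUnit B.det := by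
    rw [isUnit_iff_ne_zero]
    intro h0
    have := hG.det_pos
    rw [hB, Matrix.det_mul, h0] at this
    simp at this
  refine ⟨B⁻¹, ?_⟩
  rw [IsFrame, hB, Matrix.conjTranspose_eq_transpose_of_trivial, ← mul_assoc,
    ← Matrix.transpose_mul, Matrix.mul_nonsing_inv _ hu, Matrix.transpose_one, one_mul,
    Matrix.mul_nonsing_inv _ hu]

namespace IsFrame

variable {E G : Matrix (Fin d) (Fin d) ℝ}

theorem mul_left (h : IsFrame E G) : E * (E.transpose * G) = 1 := mul_eq_one_comm.mp h

theorem inv_eq (h : IsFrame E G) : G⁻¹ = E * E.transpose :=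
  Matrix.inv_eq_left_inv (by rw [mul_assoc]; exact h.mul_left)

/-- Because `G⁻¹ = E Eᵀ`, contracting every slot with `G⁻¹` yields a sum of squares of frame
components. Each single component is then at most the tensor norm. -/
theorem tensorNorm_sq {G : Eucl d → Matrix (Fin d) (Fin d) ℝ} {y : Eucl d}
    (h : IsFrame E (G y)) {r : ℕ} (T : (Fin r → Fin d) → Eucl d → ℝ) :
    ∑ J, ∑ L, (∏ s, (G y)⁻¹ (J s) (L s)) * T J y * T L y
      = ∑ A, frameComp E (fun J => T J y) A ^ 2 := by
  have h1 : ∀ J L : Fin r → Fin d, ∏ s, (G y)⁻¹ (J s) (L s)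
      = ∑ A : Fin r → Fin d, (∏ s, E (J s) (A s)) * ∏ s, E (L s) (A s) := by
    intro J L
    simp only [h.inv_eq, Matrix.mul_apply, Matrix.transpose_apply, Finset.prod_univ_sum,
      Fintype.piFinset_univ, Finset.prod_mul_distrib]
  simp only [h1, frameComp, sq, Finset.sum_mul, Finset.mul_sum]
  rw [Finset.sum_congr rfl fun J _ => Finset.sum_comm, Finset.sum_comm]
  refine Finset.sum_congr rfl fun A _ => ?_
  rw [Finset.sum_comm]
  exact Finset.sum_congr rfl fun J _ => Finset.sum_congr rfl fun L _ => by ring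

theorem abs_frameComp_le {G : Eucl d → Matrix (Fin d) (Fin d) ℝ} {y : Eucl d}
    (h : IsFrame E (G y)) {r : ℕ} (T : (Fin r → Fin d) → Eucl d → ℝ) (A : Fin r → Fin d) :
    |frameComp E (fun J => T J y) A| ≤ tensorNorm G T y := by
  rw [tensorNorm, h.tensorNorm_sq]
  exact Real.abs_le_sqrt (Finset.single_le_sum
    (f := fun A => frameComp E (fun J => T J y) A ^ 2) (fun _ _ => sq_nonneg _)
    (Finset.mem_univ A))

open Matrix in
/-- The frame components of a unit vector are at most one. -/
theorem exists_eq_mulVec (h : IsFrame E G) (v : Fin d → ℝ) (hv : v ⬝ᵥ (G *ᵥ v) = 1) :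
    ∃ u : Fin d → ℝ, v = E *ᵥ u ∧ ∀ c, |u c| ≤ 1 := by
  refine ⟨(E.transpose * G) *ᵥ v, ?_, fun c => ?_⟩
  · rw [Matrix.mulVec_mulVec, h.mul_left, Matrix.one_mulVec]
  · set u := (E.transpose * G) *ᵥ v with hu
    have hvu : v = E *ᵥ u := by rw [hu, Matrix.mulVec_mulVec, h.mul_left, Matrix.one_mulVec]
    have h1 : u ⬝ᵥ u = 1 := by
      have h3 : (E *ᵥ u) ⬝ᵥ (G *ᵥ (E *ᵥ u)) = u ⬝ᵥ ((E.transpose * G * E) *ᵥ u) := by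
        rw [← Matrix.mulVec_mulVec, ← Matrix.mulVec_mulVec, Matrix.dotProduct_mulVec u,
          Matrix.vecMul_transpose]
      rw [← hv, hvu, h3, h, Matrix.one_mulVec]
    have h2 : u c ^ 2 ≤ 1 := by
      rw [← h1, dotProduct, sq]
      exact Finset.single_le_sum (f := fun c => u c * u c) (fun _ _ => mul_self_nonneg _)
        (Finset.mem_univ c)
    exact (sq_le_one_iff_abs_le_one _).mp h2

end IsFrame

theorem frameComp_five (E : Matrix (Fin d) (Fin d) ℝ) (T : (Fin 5 → Fin d) → ℝ)
    (A : Fin 5 → Fin d) : frameComp E T A = ∑ m, ∑ l, ∑ k, ∑ i, ∑ j,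
      E m (A 0) * E l (A 1) * E k (A 2) * E i (A 3) * E j (A 4) * T ![m, l, k, i, j] := by
  simp only [frameComp, sum_fin_succ_fun, Fin.prod_univ_five, Finset.univ_unique,
    Finset.sum_singleton]
  rfl

theorem frameComp_four (E : Matrix (Fin d) (Fin d) ℝ) (T : (Fin 4 → Fin d) → ℝ)
    (A : Fin 4 → Fin d) : frameComp E T A = ∑ l, ∑ k, ∑ i, ∑ j,
      E l (A 0) * E k (A 1) * E i (A 2) * E j (A 3) * T ![l, k, i, j] := by
  simp only [frameComp, sum_fin_succ_fun, Fin.prod_univ_four, Finset.univ_unique,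
    Finset.sum_singleton]
  rfl

/-- Moves connection terms from the inverse metric to the contracted tensor; `H` will be `G⁻¹` and
`g` a connection matrix. -/
theorem sum_mul_add_mul_transpose (H g T : Matrix (Fin d) (Fin d) ℝ) :
    ∑ j, ∑ k, (g * H + H * g.transpose) j k * T j k
      = ∑ j, ∑ k, H j k * (∑ p, g p j * T p k + ∑ p, g p k * T j p) := by
  simp only [Matrix.add_apply, Matrix.mul_apply, Matrix.transpose_apply, add_mul, mul_add,
    Finset.sum_add_distrib, Finset.sum_mul, Finset.mul_sum]
  congr 1
  · rw [Finset.sum_congr rfl fun j _ => Finset.sum_comm, Finset.sum_comm]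
    refine Finset.sum_congr rfl fun p _ => ?_
    rw [Finset.sum_comm]
    exact Finset.sum_congr rfl fun k _ => Finset.sum_congr rfl fun j _ => by ring
  · refine Finset.sum_congr rfl fun j _ => ?_
    rw [Finset.sum_comm]
    exact Finset.sum_congr rfl fun p _ => Finset.sum_congr rfl fun k _ => by ring

theorem covDeriv_four (G : Eucl d → Matrix (Fin d) (Fin d) ℝ)
    (T : (Fin 4 → Fin d) → Eucl d → ℝ) (m l k i j : Fin d) (y : Eucl d) :
    covDeriv G T ![m, l, k, i, j] y = pd m (T ![l, k, i, j]) y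
      - (∑ p, gam G m y p l * T ![p, k, i, j] y + ∑ p, gam G m y p k * T ![l, p, i, j] y
        + ∑ p, gam G m y p i * T ![l, k, p, j] y + ∑ p, gam G m y p j * T ![l, k, i, p] y) := by
  have h0 : Fin.tail ![m, l, k, i, j] = ![l, k, i, j] := rfl
  have u0 : ∀ p, Function.update ![l, k, i, j] 0 p = ![p, k, i, j] := fun p => by
    funext s; fin_cases s <;> rfl
  have u1 : ∀ p, Function.update ![l, k, i, j] 1 p = ![l, p, i, j] := fun p => by
    funext s; fin_cases s <;> rfl
  have u2 : ∀ p, Function.update ![l, k, i, j] 2 p = ![l, k, p, j] := fun p => by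
    funext s; fin_cases s <;> rfl
  have u3 : ∀ p, Function.update ![l, k, i, j] 3 p = ![l, k, i, p] := fun p => by
    funext s; fin_cases s <;> rfl
  unfold covDeriv
  rw [h0, Fin.sum_univ_four]
  simp only [u0, u1, u2, u3]
  rfl

namespace IsMetricOn

variable {G : Eucl d → Matrix (Fin d) (Fin d) ℝ} {U : Set (Eucl d)} {y : Eucl d}

theorem riemannUp_eq_sum (hG : IsMetricOn G U) (hy : y ∈ U) (p k i j : Fin d) :
    riemannUp G p k i j y = ∑ l, (G y)⁻¹ p l * riemannDown G ![l, k, i, j] y := by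
  have h : ∀ l, riemannDown G ![l, k, i, j] y = (G y * riemMat G i j y) l k := fun l => rfl
  simp only [h]
  rw [← Matrix.mul_apply, ← mul_assoc, Matrix.nonsing_inv_mul _ (hG.isUnit_det hy), one_mul]
  rfl

/-- The differential of the scalar curvature is a contraction of `∇R`. -/
theorem pd_scalar (hG : IsMetricOn G U) (hy : y ∈ U) (m : Fin d) :
    pd m (scalar G) y = ∑ j, ∑ k, (G y)⁻¹ j k * ∑ i, ∑ l, (G y)⁻¹ i l *
      nablaRiemann G 1 ![m, l, k, i, j] y := by
  have hU := hG.isOpen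
  set T : Fin d → Fin d → Fin d → Fin d → Eucl d → ℝ := fun l k i j =>
    riemannDown G ![l, k, i, j] with hT
  set A : Fin d → Fin d → Eucl d → ℝ := fun j k z =>
    ∑ i, ∑ l, (G z)⁻¹ i l * T l k i j z with hA
  set g := gam G m y with hg
  have dH := fun i l => differentiableAt_of_contDiffOn hU hy (hG.smooth_inv i l)
  have dT := fun l k i j => differentiableAt_of_contDiffOn hU hy
    (hG.smooth_riemannDown ![l, k, i, j])
  have pH : ∀ i l, pd m (fun z => (G z)⁻¹ i l) y
      = -(g * (G y)⁻¹ + (G y)⁻¹ * g.transpose) i l := fun i l => by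
    rw [hg, ← Matrix.neg_apply, ← hG.pdM_inv_eq hy]; rfl
  have dA : ∀ j k, DifferentiableAt ℝ (A j k) y := fun j k =>
    DifferentiableAt.fun_sum fun i _ => DifferentiableAt.fun_sum fun l _ =>
      (dH i l).fun_mul (dT l k i j)
  -- The derivative of `gⁱˡ` supplies the connection terms of slots `i` and `l`. The outer
  -- contraction later supplies those of `j` and `k`, which completes `∇R`.
  have pA : ∀ j k, pd m (A j k) y = ∑ i, ∑ l, (G y)⁻¹ i l * (pd m (T l k i j) y
      - (∑ p, g p i * T l k p j y + ∑ p, g p l * T p k i j y)) := fun j k => by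
    have e : pd m (A j k) y = ∑ i, ∑ l, (-(g * (G y)⁻¹ + (G y)⁻¹ * g.transpose) i l * T l k i j y
        + (G y)⁻¹ i l * pd m (T l k i j) y) := by
      rw [hA]
      rw [pd_sum _ _ fun i _ => DifferentiableAt.fun_sum fun l _ => (dH i l).fun_mul (dT l k i j)]
      refine Finset.sum_congr rfl fun i _ => ?_
      rw [pd_sum _ _ fun l _ => (dH i l).fun_mul (dT l k i j)]
      refine Finset.sum_congr rfl fun l _ => ?_
      rw [pd_mul m (dH i l) (dT l k i j), pH]
    have e2 := sum_mul_add_mul_transpose (G y)⁻¹ g (Matrix.of fun i l => T l k i j y)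
    simp only [Matrix.of_apply] at e2
    rw [e]
    simp only [Finset.sum_add_distrib, mul_sub, Finset.sum_sub_distrib, neg_mul,
      Finset.sum_neg_distrib, e2]
    ring
  have hs : pd m (scalar G) y = pd m (fun z => ∑ j, ∑ k, (G z)⁻¹ j k * A j k z) y := by
    refine pd_congr_on m hU hy fun z hz => ?_
    simp only [scalar, hA, hT]
    refine Finset.sum_congr rfl fun j _ => Finset.sum_congr rfl fun k _ => ?_
    congr 1
    exact Finset.sum_congr rfl fun i _ => hG.riemannUp_eq_sum hz i k i j
  have hs2 : pd m (scalar G) y = ∑ j, ∑ k, (-(g * (G y)⁻¹ + (G y)⁻¹ * g.transpose) j k * A j k y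
        + (G y)⁻¹ j k * pd m (A j k) y) := by
    rw [hs, pd_sum _ _ fun j _ => DifferentiableAt.fun_sum fun k _ => (dH j k).fun_mul (dA j k)]
    refine Finset.sum_congr rfl fun j _ => ?_
    rw [pd_sum _ _ fun k _ => (dH j k).fun_mul (dA j k)]
    refine Finset.sum_congr rfl fun k _ => ?_
    rw [pd_mul m (dH j k) (dA j k), pH]
  have e2 := sum_mul_add_mul_transpose (G y)⁻¹ g (Matrix.of fun j k => A j k y)
  simp only [Matrix.of_apply] at e2
  have e3 : pd m (scalar G) y = ∑ j, ∑ k, (G y)⁻¹ j k * (pd m (A j k) y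
      - (∑ p, g p j * A p k y + ∑ p, g p k * A j p y)) := by
    rw [hs2]
    simp only [Finset.sum_add_distrib, mul_sub, Finset.sum_sub_distrib, neg_mul,
      Finset.sum_neg_distrib, e2]
    ring
  rw [e3]
  refine Finset.sum_congr rfl fun j _ => Finset.sum_congr rfl fun k _ => ?_
  congr 1
  have c1 : ∑ p, g p j * A p k y = ∑ i, ∑ l, (G y)⁻¹ i l * ∑ p, g p j * T l k i p y := by
    simp only [hA, Finset.mul_sum]
    rw [Finset.sum_comm]
    refine Finset.sum_congr rfl fun i _ => ?_
    rw [Finset.sum_comm]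
    exact Finset.sum_congr rfl fun l _ => Finset.sum_congr rfl fun p _ => by ring
  have c2 : ∑ p, g p k * A j p y = ∑ i, ∑ l, (G y)⁻¹ i l * ∑ p, g p k * T l p i j y := by
    simp only [hA, Finset.mul_sum]
    rw [Finset.sum_comm]
    refine Finset.sum_congr rfl fun i _ => ?_
    rw [Finset.sum_comm]
    exact Finset.sum_congr rfl fun l _ => Finset.sum_congr rfl fun p _ => by ring
  rw [pA, c1, c2]
  simp only [← Finset.sum_add_distrib, ← Finset.sum_sub_distrib]
  refine Finset.sum_congr rfl fun i _ => Finset.sum_congr rfl fun l _ => ?_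
  rw [show nablaRiemann G 1 = covDeriv G (riemannDown G) from rfl, covDeriv_four]
  simp only [Finset.sum_add_distrib, hT, hg]
  ring

/-- The derivative of the scalar curvature in a unit direction is bounded by `|∇R|`. -/
theorem abs_fderiv_scalar_le (hG : IsMetricOn G U) (hy : y ∈ U) (v : Fin d → ℝ)
    (hv : ∑ i, ∑ j, G y i j * v i * v j = 1) :
    |∑ m, v m * pd m (scalar G) y| ≤ d ^ 3 * tensorNorm G (nablaRiemann G 1) y := by
  obtain ⟨E, hE⟩ := exists_isFrame (hG.posDef y hy)
  obtain ⟨u, hu, hu1⟩ := hE.exists_eq_mulVec v (by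
    rw [← hv, dotProduct]
    refine Finset.sum_congr rfl fun i _ => ?_
    rw [Matrix.mulVec, dotProduct, Finset.mul_sum]
    exact Finset.sum_congr rfl fun j _ => by ring)
  -- In an orthonormal frame `ds(v)` is a triple sum of frame components of `∇R`, weighted by the
  -- coordinates of `v`. These are at most one, which gives the factor `d ^ 3`.
  have key : ∑ m, v m * pd m (scalar G) y = ∑ c, ∑ a, ∑ b, u c *
      frameComp E (fun J => nablaRiemann G 1 J y) ![c, b, a, b, a] := by
    simp only [hG.pd_scalar hy, hu, hE.inv_eq, frameComp_five, Matrix.mulVec, dotProduct,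
      Matrix.mul_apply, Matrix.transpose_apply, Finset.sum_mul, Finset.mul_sum]
    simp only [← Fintype.sum_prod_type']
    -- Both sides are one eightfold sum; the equivalence only permutes the indices.
    exact Fintype.sum_equiv
      { toFun := fun (m, j, k, i, l, b, a, c) => (c, a, b, m, l, k, i, j)
        invFun := fun (c, a, b, m, l, k, i, j) => (m, j, k, i, l, b, a, c)
        left_inv := fun _ => rfl
        right_inv := fun _ => rfl } _ _ fun ⟨m, j, k, i, l, b, a, c⟩ => by
      simp only [Equiv.coe_fn_mk]
      change _ = u c * (E m c * E l b * E k a * E i b * E j a * _)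
      ring
  rw [key]
  have hb : ∀ c a b, |u c * frameComp E (fun J => nablaRiemann G 1 J y) ![c, b, a, b, a]|
      ≤ tensorNorm G (nablaRiemann G 1) y := fun c a b => by
    rw [abs_mul]
    calc _ ≤ 1 * tensorNorm G (nablaRiemann G 1) y :=
          mul_le_mul (hu1 c) (hE.abs_frameComp_le _ _) (abs_nonneg _) zero_le_one
      _ = _ := one_mul _
  have hN : ∀ f : Fin d → ℝ, ∀ K, (∀ c, |f c| ≤ K) → |∑ c, f c| ≤ d * K := fun f K hf => by
    refine (Finset.abs_sum_le_sum_abs _ _).trans ((Finset.sum_le_sum fun c _ => hf c).trans ?_)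
    simp
  calc _ ≤ d * (d * (d * tensorNorm G (nablaRiemann G 1) y)) :=
        hN _ _ fun c => hN _ _ fun a => hN _ _ fun b => hb c a b
    _ = _ := by ring

end IsMetricOn

end Coord

/-! ### The shape operator of a normal foliation and its Riccati equation. -/

namespace Coord

variable {d : ℕ}

theorem abs_sum_le_card_mul {f : Fin d → ℝ} {K : ℝ} (hf : ∀ c, |f c| ≤ K) :
    |∑ c, f c| ≤ d * K := by
  refine (Finset.abs_sum_le_sum_abs _ _).trans ((Finset.sum_le_sum fun c _ => hf c).trans ?_)
  simp

open Matrix in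
theorem dotProduct_mulVec_eq_sum (A : Matrix (Fin d) (Fin d) ℝ) (v w : Fin d → ℝ) :
    v ⬝ᵥ (A *ᵥ w) = ∑ i, ∑ j, A i j * v i * w j := by
  simp only [dotProduct, Matrix.mulVec, Finset.mul_sum]
  exact Finset.sum_congr rfl fun i _ => Finset.sum_congr rfl fun j _ => by ring

namespace IsFrame

variable {E G : Matrix (Fin d) (Fin d) ℝ}

theorem trace_conj (h : IsFrame E G) (X : Matrix (Fin d) (Fin d) ℝ) :
    (E.transpose * G * X * E).trace = X.trace := by
  rw [Matrix.trace_mul_comm, ← mul_assoc, h.mul_left, one_mul]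

theorem conj_mul (h : IsFrame E G) (X Y : Matrix (Fin d) (Fin d) ℝ) :
    E.transpose * G * (X * Y) * E
      = (E.transpose * G * X * E) * (E.transpose * G * Y * E) := by
  have : (E.transpose * G * X * E) * (E.transpose * G * Y * E)
      = E.transpose * G * X * (E * (E.transpose * G)) * Y * E := by noncomm_ring
  rw [this, h.mul_left]; noncomm_ring

end IsFrame

theorem IsFrame.conj_symm {E G S : Matrix (Fin d) (Fin d) ℝ}
    (hS : (G * S).transpose = G * S) :
    (E.transpose * G * S * E).transpose = E.transpose * G * S * E := by
  rw [mul_assoc E.transpose, Matrix.transpose_mul, Matrix.transpose_mul, hS,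
    Matrix.transpose_transpose, mul_assoc, mul_assoc, mul_assoc]

/-- The inverse of `E` is `Eᵀ G`, so `Eᵀ G S E` is the matrix of `S` in the frame. Self-adjointness
makes it symmetric, and `tr S²` is then the sum of the squares of its entries. -/
theorem IsFrame.trace_sq_eq {E G S : Matrix (Fin d) (Fin d) ℝ} (h : IsFrame E G)
    (hS : (G * S).transpose = G * S) :
    (S * S).trace = ∑ a, ∑ b, (E.transpose * G * S * E) a b ^ 2 := by
  have hs := IsFrame.conj_symm (E := E) hS
  rw [← h.trace_conj, h.conj_mul]
  set X := E.transpose * G * S * E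
  have hX : ∀ a b, X b a = X a b := fun a b => congrFun (congrFun hs a) b
  refine Finset.sum_congr rfl fun a _ => ?_
  rw [Matrix.diag_apply, Matrix.mul_apply]
  exact Finset.sum_congr rfl fun b _ => by rw [hX a b, sq]

/-- The entries of a self-adjoint endomorphism in an orthonormal frame. -/
theorem IsFrame.abs_conj_le {E G S : Matrix (Fin d) (Fin d) ℝ} (h : IsFrame E G)
    (hS : (G * S).transpose = G * S) (a b : Fin d) :
    |(E.transpose * G * S * E) a b| ≤ √((S * S).trace) := by
  rw [h.trace_sq_eq hS]
  refine Real.abs_le_sqrt ((Finset.single_le_sum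
    (f := fun b => (E.transpose * G * S * E) a b ^ 2) (fun _ _ => sq_nonneg _)
    (Finset.mem_univ b)).trans (Finset.single_le_sum
    (f := fun a => ∑ b, (E.transpose * G * S * E) a b ^ 2)
    (fun _ _ => Finset.sum_nonneg fun _ _ => sq_nonneg _) (Finset.mem_univ a)))

theorem abs_trace_le {A : Matrix (Fin d) (Fin d) ℝ} {K : ℝ} (h : ∀ a b, |A a b| ≤ K) :
    |A.trace| ≤ d * K :=
  abs_sum_le_card_mul fun a => h a a

theorem abs_mul_le {A B : Matrix (Fin d) (Fin d) ℝ} {K L : ℝ} (hK : ∀ a b, |A a b| ≤ K)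
    (hL : ∀ a b, |B a b| ≤ L) (a b : Fin d) : |(A * B) a b| ≤ d * (K * L) := by
  rw [Matrix.mul_apply]
  refine abs_sum_le_card_mul fun c => ?_
  rw [abs_mul]
  exact mul_le_mul (hK a c) (hL c b) (abs_nonneg _) ((abs_nonneg _).trans (hK a c))

/-- The metric `G` is of the form `dy_κ² + …`, so that `∂_κ` is the unit normal of the slices. -/
structure IsNormalMetricOn (G : Eucl d → Matrix (Fin d) (Fin d) ℝ) (κ : Fin d)
    (U : Set (Eucl d)) : Prop extends IsMetricOn G U where
  normal : ∀ y ∈ U, ∀ i, G y i κ = if i = κ then 1 else 0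

/-- The curvature endomorphism `R(·, ∂_κ)∂_κ`. -/
noncomputable def normalRiem (G : Eucl d → Matrix (Fin d) (Fin d) ℝ) (κ : Fin d) (y : Eucl d) :
    Matrix (Fin d) (Fin d) ℝ :=
  Matrix.of fun l i => riemannUp G l κ i κ y

namespace IsNormalMetricOn

variable {G : Eucl d → Matrix (Fin d) (Fin d) ℝ} {κ : Fin d} {U : Set (Eucl d)} {y : Eucl d}

theorem pd_normal (hG : IsNormalMetricOn G κ U) (hy : y ∈ U) (k i : Fin d) :
    pdM k G y i κ = 0 :=
  (pd_congr_on k hG.isOpen hy fun _ hz => hG.normal _ hz i).trans (pd_const k _)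

theorem pd_normal' (hG : IsNormalMetricOn G κ U) (hy : y ∈ U) (k i : Fin d) :
    pdM k G y κ i = 0 :=
  (pd_congr_on k hG.isOpen hy fun _ hz => hG.symm hz κ i).trans (hG.pd_normal hy k i)

/-- Identifies `gam G κ` as the shape operator of the slices: its lowered form is half the normal
derivative of the metric. -/
theorem mul_shape (hG : IsNormalMetricOn G κ U) (hy : y ∈ U) (l j : Fin d) :
    (G y * gam G κ y) l j = 1 / 2 * pdM κ G y j l := by
  rw [hG.mul_gam_apply hy, hG.pd_normal' hy, hG.pd_normal' hy]; ring

theorem mul_shape_symm (hG : IsNormalMetricOn G κ U) (hy : y ∈ U) :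
    (G y * gam G κ y).transpose = G y * gam G κ y := by
  ext l j
  rw [Matrix.transpose_apply, hG.mul_shape hy, hG.mul_shape hy]
  congr 1
  exact pd_congr_on κ hG.isOpen hy fun z hz => hG.symm hz _ _

/-- The coordinate lines in direction `κ` are geodesics, because the `κ`-th row of the metric is
constant. -/
theorem christoffel_normal (hG : IsNormalMetricOn G κ U) (hy : y ∈ U) (l : Fin d) :
    christoffel G l κ κ y = 0 := by
  have h : gam G κ y = (G y)⁻¹ * (G y * gam G κ y) := by
    rw [← mul_assoc, Matrix.nonsing_inv_mul _ (hG.isUnit_det hy), one_mul]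
  have h2 : christoffel G l κ κ y = gam G κ y l κ := rfl
  rw [h2, h, Matrix.mul_apply]
  exact Finset.sum_eq_zero fun m _ => by rw [hG.mul_shape hy, hG.pd_normal' hy]; ring

/-- The `κ`-th Christoffel symbols are the second fundamental form. -/
theorem christoffel_normal_upper (hG : IsNormalMetricOn G κ U) (hy : y ∈ U) (i j : Fin d) :
    christoffel G κ i j y = (G y * gam G i y) κ j := by
  rw [Matrix.mul_apply]
  have : ∀ k, G y κ k = if k = κ then 1 else 0 := fun k => by
    rw [hG.symm hy, hG.normal y hy]
  simp only [this, ite_mul, one_mul, zero_mul, Finset.sum_ite_eq', Finset.mem_univ, if_true]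
  rfl

theorem christoffel_normal_upper' (hG : IsNormalMetricOn G κ U) (hy : y ∈ U) (i j : Fin d) :
    christoffel G κ i j y = -(G y * gam G κ y) i j := by
  rw [hG.christoffel_normal_upper hy, hG.mul_gam_apply hy, hG.mul_shape hy, hG.pd_normal hy,
    hG.pd_normal hy]
  have : pdM κ G y i j = pdM κ G y j i :=
    pd_congr_on κ hG.isOpen hy fun z hz => hG.symm hz _ _
  rw [this]; ring

/-- The **Riccati equation** for the shape operator of the slices. -/
theorem riccati (hG : IsNormalMetricOn G κ U) (hy : y ∈ U) :
    pdM κ (gam G κ) y = -(gam G κ y * gam G κ y) - normalRiem G κ y := by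
  ext l i
  -- The symbols `Γˡ_κκ` vanish on the whole open set, so both their derivatives and their products
  -- drop out of the curvature.
  have h1 : pd i (christoffel G l κ κ) y = 0 :=
    (pd_congr_on i hG.isOpen hy fun z hz => hG.christoffel_normal hz l).trans (pd_const i 0)
  have h2 : pd κ (christoffel G l i κ) y = pdM κ (gam G κ) y l i :=
    pd_congr_on κ hG.isOpen hy fun z hz => hG.christoffel_symm hz l i κ
  simp only [Matrix.sub_apply, Matrix.neg_apply, normalRiem, Matrix.of_apply, riemannUp, h1, h2,
    hG.christoffel_normal hy, mul_zero, zero_sub, Finset.sum_neg_distrib, Matrix.mul_apply]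
  have h3 : ∑ m, christoffel G l κ m y * christoffel G m i κ y
      = ∑ j, gam G κ y l j * gam G κ y j i :=
    Finset.sum_congr rfl fun m _ => by rw [hG.christoffel_symm hy m i κ]; rfl
  rw [h3]; ring

theorem pd_trace {A : Eucl d → Matrix (Fin d) (Fin d) ℝ} (hU : IsOpen U) (hy : y ∈ U)
    (hA : SmoothM A U) (k : Fin d) : pd k (fun z => (A z).trace) y = (pdM k A y).trace :=
  pd_sum _ _ fun i _ => differentiableAt_of_contDiffOn hU hy (hA i i)

theorem smoothM_trace {A : Eucl d → Matrix (Fin d) (Fin d) ℝ}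
    (hA : SmoothM A U) : ContDiffOn ℝ ∞ (fun z => (A z).trace) U :=
  ContDiffOn.sum fun i _ => hA i i

theorem pd_trace_shape (hG : IsNormalMetricOn G κ U) (hy : y ∈ U) :
    pd κ (fun z => (gam G κ z).trace) y
      = -(gam G κ y * gam G κ y).trace - (normalRiem G κ y).trace := by
  rw [pd_trace hG.isOpen hy (hG.smooth_gam κ), hG.riccati hy, Matrix.trace_sub, Matrix.trace_neg]

theorem pd_trace_shape_sq (hG : IsNormalMetricOn G κ U) (hy : y ∈ U) :
    pd κ (fun z => (gam G κ z * gam G κ z).trace) y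
      = -(2 * (gam G κ y * (gam G κ y * gam G κ y)).trace)
        - 2 * (gam G κ y * normalRiem G κ y).trace := by
  rw [pd_trace hG.isOpen hy ((hG.smooth_gam κ).mul (hG.smooth_gam κ)),
    pdM_mul hG.isOpen hy κ (hG.smooth_gam κ) (hG.smooth_gam κ), Matrix.trace_add,
    Matrix.trace_mul_comm (pdM κ (gam G κ) y), hG.riccati hy, mul_sub, mul_neg, Matrix.trace_sub,
    Matrix.trace_neg]
  ring

/-- The unit vector `∂_κ` fills two slots of the curvature tensor, and its frame coordinates are at
most one. An entry is thus a sum of `d ^ 2` bounded terms. -/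
theorem abs_conj_normalRiem_le (hG : IsNormalMetricOn G κ U) (hy : y ∈ U)
    {E : Matrix (Fin d) (Fin d) ℝ} (hE : IsFrame E (G y)) (a b : Fin d) :
    |(E.transpose * G y * normalRiem G κ y * E) a b|
      ≤ d ^ 2 * tensorNorm G (nablaRiemann G 0) y := by
  obtain ⟨u, hu, hu1⟩ := hE.exists_eq_mulVec (Pi.single κ 1) (by
    simp [hG.normal y hy])
  have huk : ∀ k, ∑ c, E k c * u c = if k = κ then 1 else 0 := fun k => by
    have := congrFun hu k
    rw [Pi.single_apply] at this
    rw [this]; rfl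
  set T : (Fin 4 → Fin d) → Eucl d → ℝ := nablaRiemann G 0 with hT
  have key : (E.transpose * G y * normalRiem G κ y * E) a b
      = ∑ c, ∑ e, u c * u e * frameComp E (fun J => T J y) ![a, c, b, e] := by
    have h1 : ∀ l i, (G y * normalRiem G κ y) l i = T ![l, κ, i, κ] y := fun l i => rfl
    have h2 : (E.transpose * G y * normalRiem G κ y * E) a b
        = ∑ l, ∑ k, ∑ i, ∑ j, E l a * (∑ c, E k c * u c) * E i b * (∑ e, E j e * u e) *
          T ![l, k, i, j] y := by
      simp only [huk, mul_ite, mul_one, mul_zero, ite_mul, zero_mul, Finset.sum_ite_eq',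
        Finset.mem_univ, if_true, Finset.sum_ite_irrel, Finset.sum_const_zero]
      rw [mul_assoc E.transpose, Matrix.mul_apply]
      simp only [Matrix.mul_apply (M := E.transpose), h1, Matrix.transpose_apply, Finset.sum_mul]
      rw [Finset.sum_comm]
      exact Finset.sum_congr rfl fun l _ => Finset.sum_congr rfl fun i _ => by ring
    rw [h2]
    simp only [frameComp_four, Finset.mul_sum, Finset.sum_mul]
    simp only [← Fintype.sum_prod_type']
    exact Fintype.sum_equiv
      { toFun := fun (l, k, i, j, e, c) => (c, e, l, k, i, j)
        invFun := fun (c, e, l, k, i, j) => (l, k, i, j, e, c)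
        left_inv := fun _ => rfl
        right_inv := fun _ => rfl } _ _ fun ⟨l, k, i, j, e, c⟩ => by
      simp only [Equiv.coe_fn_mk]
      change _ = u c * u e * (E l a * E k c * E i b * E j e * _)
      ring
  rw [key]
  have hb : ∀ c e, |u c * u e * frameComp E (fun J => T J y) ![a, c, b, e]|
      ≤ tensorNorm G T y := fun c e => by
    rw [abs_mul, abs_mul]
    calc _ ≤ (1 * 1) * tensorNorm G T y :=
          mul_le_mul (mul_le_mul (hu1 c) (hu1 e) (abs_nonneg _) zero_le_one)
            (hE.abs_frameComp_le _ _) (abs_nonneg _) (by norm_num)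
      _ = _ := by ring
  calc _ ≤ d * (d * tensorNorm G T y) :=
        abs_sum_le_card_mul fun c => abs_sum_le_card_mul fun e => hb c e
    _ = _ := by ring

theorem trace_shape_sq_nonneg (hG : IsNormalMetricOn G κ U) (hy : y ∈ U) :
    0 ≤ (gam G κ y * gam G κ y).trace := by
  obtain ⟨E, hE⟩ := exists_isFrame (hG.posDef y hy)
  rw [hE.trace_sq_eq (hG.mul_shape_symm hy)]
  exact Finset.sum_nonneg fun _ _ => Finset.sum_nonneg fun _ _ => sq_nonneg _

/-- The second fundamental form of the slices on unit vectors. -/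
theorem abs_shape_le (hG : IsNormalMetricOn G κ U) (hy : y ∈ U) (v w : Fin d → ℝ)
    (hv : ∑ i, ∑ j, G y i j * v i * v j = 1) (hw : ∑ i, ∑ j, G y i j * w i * w j = 1) :
    |∑ i, ∑ j, (G y * gam G κ y) i j * v i * w j|
      ≤ d ^ 2 * √((gam G κ y * gam G κ y).trace) := by
  obtain ⟨E, hE⟩ := exists_isFrame (hG.posDef y hy)
  obtain ⟨u, hu, hu1⟩ := hE.exists_eq_mulVec v (by rw [dotProduct_mulVec_eq_sum, hv])
  obtain ⟨t, ht, ht1⟩ := hE.exists_eq_mulVec w (by rw [dotProduct_mulVec_eq_sum, hw])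
  have key : ∑ i, ∑ j, (G y * gam G κ y) i j * v i * w j
      = ∑ a, ∑ b, (E.transpose * G y * gam G κ y * E) a b * u a * t b := by
    rw [← dotProduct_mulVec_eq_sum, ← dotProduct_mulVec_eq_sum, hu, ht, mul_assoc E.transpose,
      mul_assoc E.transpose, ← Matrix.mulVec_mulVec t E.transpose, Matrix.dotProduct_mulVec u,
      Matrix.vecMul_transpose, Matrix.mulVec_mulVec]
  rw [key]
  have hb : ∀ a b, |(E.transpose * G y * gam G κ y * E) a b * u a * t b|
      ≤ √((gam G κ y * gam G κ y).trace) := fun a b => by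
    rw [abs_mul, abs_mul]
    calc _ ≤ √((gam G κ y * gam G κ y).trace) * 1 * 1 :=
          mul_le_mul (mul_le_mul (hE.abs_conj_le (hG.mul_shape_symm hy) a b) (hu1 a)
            (abs_nonneg _) (Real.sqrt_nonneg _)) (ht1 b) (abs_nonneg _) (by positivity)
      _ = _ := by ring
  calc _ ≤ d * (d * √((gam G κ y * gam G κ y).trace)) :=
        abs_sum_le_card_mul fun a => abs_sum_le_card_mul fun b => hb a b
    _ = _ := by ring

/-- Decay of the shape operator along a half-line on which the curvature decays cubically. -/
theorem trace_shape_sq_le (hG : IsNormalMetricOn G κ U) {γ : ℝ → Eucl d}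
    (hγ : ∀ x, HasDerivAt γ (EuclideanSpace.single κ 1) x) {ρ₀ C : ℝ} (hρ₀ : 1 ≤ ρ₀) (hC : 0 ≤ C)
    (hγU : ∀ x ≥ ρ₀, γ x ∈ U)
    (hR : ∀ x ≥ ρ₀, tensorNorm G (nablaRiemann G 0) (γ x) ≤ C / x ^ 3) {ρ : ℝ}
    (hρ : 2 * ρ₀ ≤ ρ) :
    (gam G κ (γ ρ) * gam G κ (γ ρ)).trace ≤
      ((1 + 2 * d ^ 4 * (C + 1)) * (9 * (2 * d ^ 4 * (C + 1)) + 1) / ρ) ^ 2 := by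
  have hd : (1 : ℝ) ≤ d := by
    have : 0 < d := Fin.pos κ
    exact_mod_cast this
  have hd4 : (1 : ℝ) ≤ d ^ 4 := one_le_pow₀ hd
  have hderiv : ∀ f : Eucl d → ℝ, ContDiffOn ℝ ∞ f U → ∀ x ≥ ρ₀,
      HasDerivAt (fun x => f (γ x)) (pd κ f (γ x)) x := fun f hf x hx =>
    (differentiableAt_of_contDiffOn hG.isOpen (hγU x hx) hf).hasFDerivAt.comp_hasDerivAt x (hγ x)
  have hS := hG.smooth_gam κ
  -- This constant dominates all three needs: `d³` for the trace of the curvature, `d²` for `θ² ≤ d²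
  -- q`, and `2d³`, `2d⁴` for the cubic and curvature terms of `q'`. The summand `1` keeps it at
  -- least `1`.
  refine le_of_riccati (θ := fun x => (gam G κ (γ x)).trace)
    (q := fun x => (gam G κ (γ x) * gam G κ (γ x)).trace) (C := 2 * d ^ 4 * (C + 1)) (ρ₀ := ρ₀)
    (by nlinarith) hρ₀
    (hderiv (fun z => (gam G κ z).trace) (smoothM_trace hS))
    (hderiv (fun z => (gam G κ z * gam G κ z).trace) (smoothM_trace (hS.mul hS)))
    (fun x hx => hG.trace_shape_sq_nonneg (hγU x hx)) (fun x hx => ?_) (fun x hx => ?_)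
    (fun x hx => ?_) hρ
  all_goals
    have hy := hγU x hx
    obtain ⟨E, hE⟩ := exists_isFrame (hG.posDef _ hy)
    have hq := hG.trace_shape_sq_nonneg hy
    have hSb := hE.abs_conj_le (hG.mul_shape_symm hy)
    have hWb := hG.abs_conj_normalRiem_le hy hE
    have hs := Real.sqrt_nonneg (gam G κ (γ x) * gam G κ (γ x)).trace
    have hN := hR x hx
    set N := tensorNorm G (nablaRiemann G 0) (γ x)
    have hx0 : 0 < x := by linarith
    have hCx : 0 ≤ C / x ^ 3 := by positivity
  · have h1 := abs_trace_le hWb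
    rw [hE.trace_conj] at h1
    rw [hG.pd_trace_shape hy]
    have h2 : (d : ℝ) * (d ^ 2 * N) ≤ 2 * d ^ 4 * (C + 1) / x ^ 3 := by
      have : (d : ℝ) ^ 3 ≤ 2 * d ^ 4 := by
        have : (d : ℝ) ^ 3 ≤ d ^ 4 := pow_le_pow_right₀ hd (by norm_num)
        nlinarith
      calc (d : ℝ) * (d ^ 2 * N) = d ^ 3 * N := by ring
        _ ≤ 2 * d ^ 4 * (C / x ^ 3) :=
          mul_le_mul this hN (Real.sqrt_nonneg _) (by positivity)
        _ ≤ 2 * d ^ 4 * ((C + 1) / x ^ 3) := by gcongr; linarith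
        _ = _ := by ring
    have := (abs_le.mp h1).1
    linarith
  · have h1 := abs_trace_le hSb
    rw [hE.trace_conj] at h1
    have h2 : (gam G κ (γ x)).trace ^ 2 ≤ d ^ 2 * (gam G κ (γ x) * gam G κ (γ x)).trace := by
      rw [← sq_abs]
      calc _ ≤ (d * √(gam G κ (γ x) * gam G κ (γ x)).trace) ^ 2 :=
            pow_le_pow_left₀ (abs_nonneg _) h1 2
        _ = _ := by rw [mul_pow, Real.sq_sqrt hq]
    refine h2.trans (mul_le_mul_of_nonneg_right ?_ hq)
    have : (d : ℝ) ^ 2 ≤ d ^ 4 := pow_le_pow_right₀ hd (by norm_num)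
    nlinarith
  · have h1 := abs_trace_le (abs_mul_le hSb (abs_mul_le hSb hSb))
    rw [← hE.conj_mul, ← hE.conj_mul, hE.trace_conj] at h1
    have h2 := abs_trace_le (abs_mul_le hSb hWb)
    rw [← hE.conj_mul, hE.trace_conj] at h2
    rw [hG.pd_trace_shape_sq hy]
    set q := (gam G κ (γ x) * gam G κ (γ x)).trace
    have h3 : (d : ℝ) * (d * (√q * (d * (√q * √q)))) ≤ d ^ 4 * (q * √q) := by
      rw [Real.mul_self_sqrt hq]
      have : (d : ℝ) ^ 3 ≤ d ^ 4 := pow_le_pow_right₀ hd (by norm_num)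
      calc (d : ℝ) * (d * (√q * (d * q))) = d ^ 3 * (q * √q) := by ring
        _ ≤ _ := mul_le_mul_of_nonneg_right this (by positivity)
    have h4 : (d : ℝ) * (d * (√q * (d ^ 2 * N))) ≤ d ^ 4 * (√q * (C / x ^ 3)) := by
      calc (d : ℝ) * (d * (√q * (d ^ 2 * N))) = d ^ 4 * (√q * N) := by ring
        _ ≤ _ := by gcongr
    have e1 : 2 * (d : ℝ) ^ 4 * (C + 1) * √q / x ^ 3
        = 2 * (d ^ 4 * (√q * (C / x ^ 3))) + 2 * (d ^ 4 * (√q * (1 / x ^ 3))) := by ring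
    have e2 : 0 ≤ (d : ℝ) ^ 4 * (√q * (1 / x ^ 3)) := by positivity
    have e3 : 2 * (d : ℝ) ^ 4 * (C + 1) * (q * √q)
        = 2 * (d ^ 4 * (q * √q)) + 2 * (d ^ 4 * C * (q * √q)) := by ring
    have e4 : 0 ≤ (d : ℝ) ^ 4 * C * (q * √q) := by positivity
    have a1 := (abs_le.mp h1).2
    have a2 := (abs_le.mp h2).2
    rw [e1, e3]
    linarith

end IsNormalMetricOn

end Coord

/-! ### Two-tensors on a manifold in charts. -/

namespace Geom

section Pullback

variable {d : ℕ} {X : Type*} [TopologicalSpace X] [ChartedSpace (Eucl d) X]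

/-- Bilinearity of a 2-tensor field. -/
def IsBilin (T : ∀ x : X, TangentSpace (𝓡 d) x → TangentSpace (𝓡 d) x → ℝ) : Prop :=
  ∀ x, ∃ B : TangentSpace (𝓡 d) x →ₗ[ℝ] TangentSpace (𝓡 d) x →ₗ[ℝ] ℝ, ∀ v w, T x v w = B v w

variable {E' H' Y : Type*} [NormedAddCommGroup E'] [NormedSpace ℝ E'] [TopologicalSpace H']
  {I' : ModelWithCorners ℝ E' H'} [TopologicalSpace Y] [ChartedSpace H' Y]

variable (I') in
/-- The pull-back of a 2-tensor field along a map. -/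
noncomputable def pull (T : ∀ x : X, TangentSpace (𝓡 d) x → TangentSpace (𝓡 d) x → ℝ) (f : Y → X) (y : Y)
    (v w : E') : ℝ :=
  T (f y) (mfderiv I' (𝓡 d) f y v) (mfderiv I' (𝓡 d) f y w)

variable {T : ∀ x : X, TangentSpace (𝓡 d) x → TangentSpace (𝓡 d) x → ℝ}

/-- All tangent spaces unfold to the model space. Vectors at points that are only propositionally
equal can therefore be compared there. -/
theorem apply_congr {p q : X} (h : p = q) {v w v' w' : Eucl d} (hv : v = v') (hw : w = w') :
    (T p : Eucl d → Eucl d → ℝ) v w = (T q : Eucl d → Eucl d → ℝ) v' w' := by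
  subst h hv hw; rfl

theorem pull_congr {f g : Y → X} {y : Y} (h : f =ᶠ[𝓝 y] g) (v w : E') :
    pull I' T f y v w = pull I' T g y v w := by
  have h2 : (mfderiv I' (𝓡 d) f y : E' →L[ℝ] Eucl d) = mfderiv I' (𝓡 d) g y := h.mfderiv_eq
  exact apply_congr h.eq_of_nhds (congrArg (fun L : E' →L[ℝ] Eucl d => L v) h2)
    (congrArg (fun L : E' →L[ℝ] Eucl d => L w) h2)

theorem pull_comp {E₂ H₂ Z : Type*} [NormedAddCommGroup E₂] [NormedSpace ℝ E₂]
    [TopologicalSpace H₂] {I₂ : ModelWithCorners ℝ E₂ H₂} [TopologicalSpace Z] [ChartedSpace H₂ Z]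
    {f : Y → X} {g : Z → Y} {z : Z} (hf : MDifferentiableAt I' (𝓡 d) f (g z))
    (hg : MDifferentiableAt I₂ I' g z) (v w : E₂) :
    pull I₂ T (f ∘ g) z v w
      = pull I' T f (g z) (mfderiv I₂ I' g z v) (mfderiv I₂ I' g z w) := by
  unfold pull
  rw [mfderiv_comp z hf hg]
  rfl

theorem comps_apply (e : OpenPartialHomeomorph X (Eucl d)) (y : Eucl d) (i j : Fin d) :
    comps T e y i j = pull (𝓡 d) T e.symm y (EuclideanSpace.single i (1 : ℝ))
      (EuclideanSpace.single j (1 : ℝ)) := rfl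

theorem IsBilin.pull_add_smul (hT : IsBilin T) (f : Y → X) (y : Y) :
    ∃ B : E' →ₗ[ℝ] E' →ₗ[ℝ] ℝ, ∀ v w : E', pull I' T f y v w = B v w := by
  obtain ⟨B, hB⟩ := hT (f y)
  let L : E' →ₗ[ℝ] TangentSpace (𝓡 d) (f y) :=
    (show E' →L[ℝ] TangentSpace (𝓡 d) (f y) from mfderiv I' (𝓡 d) f y).toLinearMap
  exact ⟨B.compl₁₂ L L, fun v w => hB _ _⟩

theorem bilin_eq_sum {B : Eucl d →ₗ[ℝ] Eucl d →ₗ[ℝ] ℝ} (v w : Eucl d) :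
    B v w = ∑ i, ∑ j, v i * w j *
      B (EuclideanSpace.single i 1) (EuclideanSpace.single j 1) := by
  conv_lhs => rw [← (EuclideanSpace.basisFun (Fin d) ℝ).sum_repr v,
    ← (EuclideanSpace.basisFun (Fin d) ℝ).sum_repr w]
  simp only [map_sum, map_smul, LinearMap.sum_apply, LinearMap.smul_apply, smul_eq_mul,
    EuclideanSpace.basisFun_repr, EuclideanSpace.basisFun_apply, Finset.mul_sum]
  rw [Finset.sum_comm]
  exact Finset.sum_congr rfl fun i _ => Finset.sum_congr rfl fun j _ => by ring

/-- A bilinear 2-tensor in coordinates. -/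
theorem IsBilin.pull_symm_eq_sum (hT : IsBilin T) (e : OpenPartialHomeomorph X (Eucl d))
    (y v w : Eucl d) :
    pull (𝓡 d) T e.symm y v w = ∑ i, ∑ j, v i * w j * comps T e y i j := by
  obtain ⟨B, hB⟩ := hT.pull_add_smul (I' := 𝓡 d) e.symm y
  simp only [comps_apply, hB]
  exact bilin_eq_sum v w

variable {e e' : OpenPartialHomeomorph X (Eucl d)}

theorem mdifferentiableAt_symm (he : e ∈ IsManifold.maximalAtlas (𝓡 d) ∞ X) {y : Eucl d}
    (hy : y ∈ e.target) : MDifferentiableAt (𝓡 d) (𝓡 d) e.symm y :=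
  (contMDiffAt_symm_of_mem_maximalAtlas he hy).mdifferentiableAt (by simp)

theorem mdifferentiableAt_chart (he : e ∈ IsManifold.maximalAtlas (𝓡 d) ∞ X) {x : X}
    (hx : x ∈ e.source) : MDifferentiableAt (𝓡 d) (𝓡 d) e x :=
  (contMDiffAt_of_mem_maximalAtlas he hx).mdifferentiableAt (by simp)

theorem contDiffOn_transition (he : e ∈ IsManifold.maximalAtlas (𝓡 d) ∞ X)
    (he' : e' ∈ IsManifold.maximalAtlas (𝓡 d) ∞ X) :
    ContDiffOn ℝ ∞ (e' ∘ e.symm) (e.target ∩ e.symm ⁻¹' e'.source) := by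
  rw [← contMDiffOn_iff_contDiffOn]
  exact (contMDiffOn_of_mem_maximalAtlas he').comp
    ((contMDiffOn_symm_of_mem_maximalAtlas he).mono inter_subset_left) fun y hy => hy.2

theorem isOpen_transition {X : Type*} [TopologicalSpace X]
    (e e' : OpenPartialHomeomorph X (Eucl d)) :
    IsOpen (e.target ∩ e.symm ⁻¹' e'.source) :=
  e.isOpen_inter_preimage_symm e'.open_source

theorem symm_eventuallyEq {X : Type*} [TopologicalSpace X]
    {e e' : OpenPartialHomeomorph X (Eucl d)} {y : Eucl d} (hy : y ∈ e.target ∩ e.symm ⁻¹' e'.source) :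
    e.symm =ᶠ[𝓝 y] e'.symm ∘ (e' ∘ e.symm) := by
  filter_upwards [(isOpen_transition e e').mem_nhds hy] with z hz
  exact (e'.left_inv hz.2).symm

theorem fderiv_single_eq_jac {Ψ : Eucl d → Eucl d} {y : Eucl d}
    (hΨ : DifferentiableAt ℝ Ψ y) (i a : Fin d) :
    fderiv ℝ Ψ y (EuclideanSpace.single i 1) a = Coord.jac Ψ y a i := by
  rw [← Coord.fderiv_coord hΨ]; rfl

/-- The components of a 2-tensor in two charts. -/
theorem comps_transition (hT : IsBilin T) (he : e ∈ IsManifold.maximalAtlas (𝓡 d) ∞ X)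
    (he' : e' ∈ IsManifold.maximalAtlas (𝓡 d) ∞ X) {y : Eucl d}
    (hy : y ∈ e.target ∩ e.symm ⁻¹' e'.source) :
    comps T e y = (Coord.jac (e' ∘ e.symm) y).transpose * comps T e' (e' (e.symm y))
      * Coord.jac (e' ∘ e.symm) y := by
  have hd : DifferentiableAt ℝ (e' ∘ e.symm) y :=
    Coord.differentiableAt_of_contDiffOn (isOpen_transition e e') hy (contDiffOn_transition he he')
  ext i j
  rw [comps_apply, pull_congr (symm_eventuallyEq hy), pull_comp (f := e'.symm) (g := e' ∘ e.symm)
    (mdifferentiableAt_symm he' (e'.map_source hy.2)) hd.mdifferentiableAt, mfderiv_eq_fderiv,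
    Coord.IsCoordChange.transpose_mul_mul_apply]
  refine (hT.pull_symm_eq_sum e' _ _ _).trans ?_
  exact Finset.sum_congr rfl fun a _ => Finset.sum_congr rfl fun b _ =>
    congrArg₂ (fun p q => p * q * comps T e' (e' (e.symm y)) a b)
      (fderiv_single_eq_jac hd i a) (fderiv_single_eq_jac hd j b)

/-- A bilinear 2-tensor at a point of a chart, in components. -/
theorem IsBilin.apply_eq_sum (hT : IsBilin T) (he : e ∈ IsManifold.maximalAtlas (𝓡 d) ∞ X)
    {x : X} (hx : x ∈ e.source) (v w : TangentSpace (𝓡 d) x) :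
    T x v w = ∑ i, ∑ j, comps T e (e x) i j * vecComp e x v i * vecComp e x w j := by
  have h1 : (id : X → X) =ᶠ[𝓝 x] e.symm ∘ e := by
    filter_upwards [e.open_source.mem_nhds hx] with z hz
    exact (e.left_inv hz).symm
  have h2 : T x v w = pull (𝓡 d) T (id : X → X) x v w := by
    simp [pull, mfderiv_id]
  refine h2.trans ((pull_congr h1 _ _).trans ((pull_comp (f := e.symm) (g := e)
    (mdifferentiableAt_symm he (e.map_source hx)) (mdifferentiableAt_chart he hx) _ _).trans
    ((hT.pull_symm_eq_sum e _ _ _).trans ?_)))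
  exact Finset.sum_congr rfl fun a _ => Finset.sum_congr rfl fun b _ => by
    simp only [vecComp]; ring

/-- The components of a vector in two charts. -/
theorem vecComp_transition (he : e ∈ IsManifold.maximalAtlas (𝓡 d) ∞ X)
    (he' : e' ∈ IsManifold.maximalAtlas (𝓡 d) ∞ X) {x : X} (hx : x ∈ e.source)
    (hx' : x ∈ e'.source) (v : TangentSpace (𝓡 d) x) (a : Fin d) :
    vecComp e' x v a = ∑ i, Coord.jac (e' ∘ e.symm) (e x) a i * vecComp e x v i := by
  have hy : e x ∈ e.target ∩ e.symm ⁻¹' e'.source :=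
    ⟨e.map_source hx, by simpa [e.left_inv hx] using hx'⟩
  have hd : DifferentiableAt ℝ (e' ∘ e.symm) (e x) :=
    Coord.differentiableAt_of_contDiffOn (isOpen_transition e e') hy (contDiffOn_transition he he')
  have h1 : (e' : X → Eucl d) =ᶠ[𝓝 x] (e' ∘ e.symm) ∘ e := by
    filter_upwards [e.open_source.mem_nhds hx] with z hz
    simp [e.left_inv hz]
  have h2 : (mfderiv (𝓡 d) (𝓡 d) e' x : Eucl d →L[ℝ] Eucl d)
      = (fderiv ℝ (e' ∘ e.symm) (e x)).comp (mfderiv (𝓡 d) (𝓡 d) e x : Eucl d →L[ℝ] Eucl d) := by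
    have h3 : (mfderiv (𝓡 d) (𝓡 d) e' x : Eucl d →L[ℝ] Eucl d)
        = mfderiv (𝓡 d) (𝓡 d) ((e' ∘ e.symm) ∘ e) x := h1.mfderiv_eq
    rw [h3, mfderiv_comp x hd.mdifferentiableAt (mdifferentiableAt_chart he hx), mfderiv_eq_fderiv]
    rfl
  have h4 : vecComp e' x v a = fderiv ℝ (e' ∘ e.symm) (e x)
      (show Eucl d from mfderiv (𝓡 d) (𝓡 d) e x v) a :=
    congrArg (fun L : Eucl d →L[ℝ] Eucl d => L v a) h2
  rw [h4, ← Coord.fderiv_coord hd, Coord.fderiv_eq_sum_pd]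
  exact Finset.sum_congr rfl fun i _ => by rw [mul_comm]; rfl

/-- A coordinate field is the tangent map of `e.symm` applied to a constant field. Its smoothness as
a section is what makes the metric matrix smooth. -/
theorem contMDiffOn_coordVec [IsManifold (𝓡 d) ∞ X] (he : e ∈ IsManifold.maximalAtlas (𝓡 d) ∞ X) (i : Fin d) :
    ContMDiffOn (𝓡 d) (𝓡 d).tangent ∞
      (fun y => (⟨e.symm y, coordVec e y i⟩ : TangentBundle (𝓡 d) X)) e.target := by
  have h1 := (contMDiffOn_symm_of_mem_maximalAtlas he).contMDiffOn_tangentMapWithin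
    (m := ∞) (by simp) e.open_target.uniqueMDiffOn
  have h2 : ContMDiffOn (𝓡 d) (𝓡 d).tangent ∞ (fun y : Eucl d =>
      (⟨y, (EuclideanSpace.single i (1 : ℝ) : Eucl d)⟩ : TangentBundle (𝓡 d) (Eucl d)))
      e.target := by
    have := (contMDiffOn_vectorSpace_iff_contDiffOn (𝕜 := ℝ) (n := ∞) (s := e.target)
      (V := fun _ : Eucl d => (EuclideanSpace.single i (1 : ℝ) : Eucl d))).2 contDiffOn_const
    exact this
  refine (h1.comp h2 fun y hy => hy).congr fun y hy => ?_
  simp only [Function.comp, tangentMapWithin, coordVec]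
  rw [mfderivWithin_of_isOpen e.open_target hy]

end Pullback

section Metric

variable {d : ℕ} {M : Type*} [TopologicalSpace M] [ChartedSpace (Eucl d) M]
  [RiemannianBundle (fun x : M => TangentSpace (𝓡 d) x)]

theorem isBilin_metric : IsBilin (metric (d := d) (M := M)) := fun x =>
  ⟨LinearMap.mk₂ ℝ (fun v w => metric x v w) (fun _ _ _ => inner_add_left _ _ _)
    (fun _ _ _ => real_inner_smul_left _ _ _) (fun _ _ _ => inner_add_right _ _ _)
    (fun _ _ _ => real_inner_smul_right _ _ _), fun _ _ => rfl⟩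

variable [IsManifold (𝓡 d) ∞ M]
  [IsContMDiffRiemannianBundle (𝓡 d) ∞ (Eucl d) (fun x : M => TangentSpace (𝓡 d) x)]
  {e e' : OpenPartialHomeomorph M (Eucl d)}

/-- The matrix of the metric in a chart is smooth and positive definite. -/
theorem isMetricOn_metricMat (he : e ∈ IsManifold.maximalAtlas (𝓡 d) ∞ M) :
    Coord.IsMetricOn (metricMat e) e.target := by
  refine ⟨e.open_target, fun i j => ?_, fun y hy => ?_⟩
  · rw [← contMDiffOn_iff_contDiffOn]
    exact (contMDiffOn_coordVec he i).inner_bundle (contMDiffOn_coordVec he j)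
  · have hinj : Function.Injective (mfderiv (𝓡 d) (𝓡 d) e.symm y) := by
      have h : e.MDifferentiable (𝓡 d) (𝓡 d) :=
        ⟨(contMDiffOn_of_mem_maximalAtlas he).mdifferentiableOn (by simp),
          (contMDiffOn_symm_of_mem_maximalAtlas he).mdifferentiableOn (by simp)⟩
      exact h.symm.mfderiv_injective hy
    refine Matrix.PosDef.of_dotProduct_mulVec_pos ?_ fun v hv => ?_
    · ext i j
      exact real_inner_comm (coordVec e y i) (coordVec e y j)
    · have h1 := (isBilin_metric (d := d) (M := M)).pull_symm_eq_sum e y (WithLp.toLp 2 v) (WithLp.toLp 2 v)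
      have h2 : star v ⬝ᵥ (metricMat e y).mulVec v
          = pull (𝓡 d) (metric (d := d) (M := M)) e.symm y (WithLp.toLp 2 v) (WithLp.toLp 2 v) := by
        rw [h1, star_trivial, Coord.dotProduct_mulVec_eq_sum]
        exact Finset.sum_congr rfl fun i _ => Finset.sum_congr rfl fun j _ => by
          simp only [metricMat]; ring
      rw [h2]
      refine real_inner_self_pos.mpr fun h0 => hv ?_
      have h3 := hinj (h0.trans (map_zero _).symm)
      exact congrArg WithLp.ofLp h3

/-- The bridge to the coordinate theory: with it, every transformation law above applies to any two
charts of the maximal atlas. -/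
theorem isCoordChange (he : e ∈ IsManifold.maximalAtlas (𝓡 d) ∞ M)
    (he' : e' ∈ IsManifold.maximalAtlas (𝓡 d) ∞ M) :
    Coord.IsCoordChange (metricMat e) (metricMat e') (e' ∘ e.symm)
      (e.target ∩ e.symm ⁻¹' e'.source) e'.target where
  source :=
    { isOpen := isOpen_transition e e'
      smooth := fun i j => ((isMetricOn_metricMat he).smooth i j).mono inter_subset_left
      posDef := fun _ hy => (isMetricOn_metricMat he).posDef _ hy.1 }
  target := isMetricOn_metricMat he'
  smooth := contDiffOn_transition he he'
  mapsTo := fun _ hy => e'.map_source hy.2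
  pullback := fun _ hy => comps_transition isBilin_metric he he' hy

end Metric

end Geom

/-! ### Chart independence of the pointwise quantities on the manifold. -/

namespace Coord

variable {d : ℕ}

theorem pd_eventuallyEq {f g : Eucl d → ℝ} {y : Eucl d} (k : Fin d) (h : f =ᶠ[𝓝 y] g) :
    pd k f =ᶠ[𝓝 y] pd k g := by
  filter_upwards [h.eventuallyEq_nhds] with z hz
  exact pd_congr k hz

theorem laplacian_congr {G : Eucl d → Matrix (Fin d) (Fin d) ℝ} {f g : Eucl d → ℝ} {y : Eucl d}
    (h : f =ᶠ[𝓝 y] g) : laplacian G f y = laplacian G g y := by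
  unfold laplacian
  congr 2
  refine Finset.sum_congr rfl fun i _ => pd_congr i ?_
  filter_upwards [eventually_all.mpr fun j => pd_eventuallyEq j h] with z hz
  simp only [hz]

theorem gradInner_congr {G : Eucl d → Matrix (Fin d) (Fin d) ℝ} {u u' f f' : Eucl d → ℝ}
    {y : Eucl d} (hu : u =ᶠ[𝓝 y] u') (hf : f =ᶠ[𝓝 y] f') :
    gradInner G u f y = gradInner G u' f' y := by
  simp only [gradInner, pd_congr _ hu, pd_congr _ hf]

end Coord

namespace Geom

section ChartVector

variable {d : ℕ} {X : Type*} [TopologicalSpace X] [ChartedSpace (Eucl d) X]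
  {e : OpenPartialHomeomorph X (Eucl d)}

/-- The differential of a function in coordinates. -/
theorem mfderiv_eq_sum (he : e ∈ IsManifold.maximalAtlas (𝓡 d) ∞ X) {x : X} (hx : x ∈ e.source)
    {f : X → ℝ} (hf : MDifferentiableAt (𝓡 d) 𝓘(ℝ, ℝ) f x) (v : TangentSpace (𝓡 d) x) :
    (mfderiv (𝓡 d) 𝓘(ℝ, ℝ) f x v : ℝ)
      = ∑ k, vecComp e x v k * Coord.pd k (f ∘ e.symm) (e x) := by
  have h1 : f =ᶠ[𝓝 x] (f ∘ e.symm) ∘ e := by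
    filter_upwards [e.open_source.mem_nhds hx] with z hz
    simp [e.left_inv hz]
  have h0 : MDifferentiableAt (𝓡 d) 𝓘(ℝ, ℝ) f (e.symm (e x)) := by rwa [e.left_inv hx]
  have hd : MDifferentiableAt (𝓡 d) 𝓘(ℝ, ℝ) (f ∘ e.symm) (e x) :=
    h0.comp (e x) (mdifferentiableAt_symm he (e.map_source hx))
  have h2 : (mfderiv (𝓡 d) 𝓘(ℝ, ℝ) f x : Eucl d →L[ℝ] ℝ)
      = (fderiv ℝ (f ∘ e.symm) (e x)).comp (mfderiv (𝓡 d) (𝓡 d) e x : Eucl d →L[ℝ] Eucl d) := by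
    have h3 : (mfderiv (𝓡 d) 𝓘(ℝ, ℝ) f x : Eucl d →L[ℝ] ℝ)
        = mfderiv (𝓡 d) 𝓘(ℝ, ℝ) ((f ∘ e.symm) ∘ e) x := h1.mfderiv_eq
    rw [h3, mfderiv_comp x hd (mdifferentiableAt_chart he hx), mfderiv_eq_fderiv]
    rfl
  have h4 : (mfderiv (𝓡 d) 𝓘(ℝ, ℝ) f x v : ℝ) = fderiv ℝ (f ∘ e.symm) (e x)
      (show Eucl d from mfderiv (𝓡 d) (𝓡 d) e x v) :=
    congrArg (fun L : Eucl d →L[ℝ] ℝ => L v) h2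
  rw [h4, Coord.fderiv_eq_sum_pd]
  rfl

theorem vecComp_coordVec (he : e ∈ IsManifold.maximalAtlas (𝓡 d) ∞ X) {x : X} (hx : x ∈ e.source)
    (k l : Fin d) : vecComp e x (coordVec e (e x) k : TangentSpace (𝓡 d) x) l
      = if l = k then 1 else 0 := by
  have h : e.MDifferentiable (𝓡 d) (𝓡 d) :=
    ⟨(contMDiffOn_of_mem_maximalAtlas he).mdifferentiableOn (by simp),
      (contMDiffOn_symm_of_mem_maximalAtlas he).mdifferentiableOn (by simp)⟩
  have h1 := h.comp_symm_deriv (e.map_source hx)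
  have h2 : ∀ x', x' = x → (mfderiv (𝓡 d) (𝓡 d) e x' : Eucl d →L[ℝ] Eucl d)
      = mfderiv (𝓡 d) (𝓡 d) e x := by rintro _ rfl; rfl
  have h3 : (mfderiv (𝓡 d) (𝓡 d) e x : Eucl d →L[ℝ] Eucl d).comp
      (mfderiv (𝓡 d) (𝓡 d) e.symm (e x) : Eucl d →L[ℝ] Eucl d) = .id ℝ _ := by
    rw [← h2 _ (e.left_inv hx)]; exact h1
  have h4 := congrArg (fun L : Eucl d →L[ℝ] Eucl d => L (EuclideanSpace.single k 1) l) h3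
  refine Eq.trans ?_ (h4.trans ?_)
  · rfl
  · change (EuclideanSpace.single k (1 : ℝ) : Eucl d) l = _
    simp

theorem vecComp_sum {X : Type*} [TopologicalSpace X] [ChartedSpace (Eucl d) X]
    (e : OpenPartialHomeomorph X (Eucl d)) (x : X) (a : Fin d → ℝ)
    (V : Fin d → TangentSpace (𝓡 d) x) (l : Fin d) :
    vecComp e x (∑ k, a k • V k) l = ∑ k, a k * vecComp e x (V k) l := by
  let L : TangentSpace (𝓡 d) x →ₗ[ℝ] Eucl d :=
    (show TangentSpace (𝓡 d) x →L[ℝ] Eucl d from mfderiv (𝓡 d) (𝓡 d) e x).toLinearMap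
  change (EuclideanSpace.proj l : Eucl d →L[ℝ] ℝ) (L (∑ k, a k • V k)) = _
  rw [map_sum, map_sum]
  refine Finset.sum_congr rfl fun k _ => ?_
  rw [map_smul, map_smul]
  rfl

theorem vecComp_congr {X : Type*} [TopologicalSpace X] [ChartedSpace (Eucl d) X]
    (e : OpenPartialHomeomorph X (Eucl d)) (Y : ∀ x : X, TangentSpace (𝓡 d) x) {p q : X}
    (h : p = q) (l : Fin d) : vecComp e p (Y p) l = vecComp e q (Y q) l := by
  rw [h]

theorem mem_transition {X : Type*} [TopologicalSpace X]
    {e e' : OpenPartialHomeomorph X (Eucl d)} {x : X} (hx : x ∈ e.source)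
    (hx' : x ∈ e'.source) : e x ∈ e.target ∩ e.symm ⁻¹' e'.source :=
  ⟨e.map_source hx, by simpa [e.left_inv hx] using hx'⟩

theorem transition_apply {X : Type*} [TopologicalSpace X]
    {e e' : OpenPartialHomeomorph X (Eucl d)} {x : X} (hx : x ∈ e.source) :
    (e' ∘ e.symm) (e x) = e' x := by simp [e.left_inv hx]

theorem contDiffOn_comp_symm (he : e ∈ IsManifold.maximalAtlas (𝓡 d) ∞ X) {f : X → ℝ}
    (hf : ContMDiff (𝓡 d) 𝓘(ℝ, ℝ) ∞ f) : ContDiffOn ℝ ∞ (f ∘ e.symm) e.target :=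
  contMDiffOn_iff_contDiffOn.mp (hf.comp_contMDiffOn (contMDiffOn_symm_of_mem_maximalAtlas he))

variable [IsManifold (𝓡 d) ∞ X]

/-- Smooth vector fields have smooth components. -/
theorem contDiffOn_vecComp (he : e ∈ IsManifold.maximalAtlas (𝓡 d) ∞ X) {U : Set X}
    {Y : ∀ z : X, TangentSpace (𝓡 d) z}
    (hY : ContMDiffOn (𝓡 d) (𝓡 d).tangent ∞ (fun x => (⟨x, Y x⟩ : TangentBundle (𝓡 d) X)) U)
    (k : Fin d) :
    ContDiffOn ℝ ∞ (fun y => vecComp e (e.symm y) (Y (e.symm y)) k)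
      (e.target ∩ e.symm ⁻¹' U) := by
  have h1 := (contMDiffOn_of_mem_maximalAtlas he).contMDiffOn_tangentMapWithin
    (m := ∞) (by simp) e.open_source.uniqueMDiffOn
  have h2 := h1.comp (hY.comp ((contMDiffOn_symm_of_mem_maximalAtlas he).mono
    (inter_subset_left (t := e.symm ⁻¹' U))) fun y hy => hy.2) fun y hy => e.map_target hy.1
  have h3 : ContMDiffOn (𝓡 d) (𝓡 d).tangent ∞ (fun y : Eucl d =>
      (⟨y, mfderiv (𝓡 d) (𝓡 d) e (e.symm y) (Y (e.symm y))⟩ : TangentBundle (𝓡 d) (Eucl d)))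
      (e.target ∩ e.symm ⁻¹' U) := by
    refine h2.congr fun y hy => ?_
    simp only [Function.comp, tangentMapWithin]
    rw [mfderivWithin_of_isOpen e.open_source (e.map_target hy.1)]
    have := e.right_inv hy.1
    congr 1
    exact this.symm
  have h4 := (contMDiffOn_vectorSpace_iff_contDiffOn (𝕜 := ℝ) (n := ∞)
    (V := fun y : Eucl d => (mfderiv (𝓡 d) (𝓡 d) e (e.symm y) (Y (e.symm y)) : Eucl d))).1 h3
  exact (EuclideanSpace.proj k : Eucl d →L[ℝ] ℝ).contDiff.comp_contDiffOn h4

theorem comp_symm_eventuallyEq {X : Type*} [TopologicalSpace X]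
    {e e' : OpenPartialHomeomorph X (Eucl d)} {x : X}
    (hx : x ∈ e.source) (hx' : x ∈ e'.source) (f : X → ℝ) :
    f ∘ e.symm =ᶠ[𝓝 (e x)] fun z => (f ∘ e'.symm) ((e' ∘ e.symm) z) := by
  filter_upwards [symm_eventuallyEq (mem_transition hx hx')] with z hz
  simp only [Function.comp] at hz ⊢
  rw [← hz]

end ChartVector

section Invariance

variable {d : ℕ} {M : Type*} [TopologicalSpace M] [ChartedSpace (Eucl d) M]
  [RiemannianBundle (fun x : M => TangentSpace (𝓡 d) x)]
  [IsManifold (𝓡 d) ∞ M]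
  [IsContMDiffRiemannianBundle (𝓡 d) ∞ (Eucl d) (fun x : M => TangentSpace (𝓡 d) x)]
  {e : OpenPartialHomeomorph M (Eucl d)}

/-- The definition uses a chart that depends on the point, so even continuity of the scalar
curvature requires its evaluation in one fixed chart around the point. -/
theorem scalarCurv_eq (he : e ∈ IsManifold.maximalAtlas (𝓡 d) ∞ M) {x : M} (hx : x ∈ e.source) :
    scalarCurv d x = Coord.scalar (metricMat e) (e x) := by
  have hc := IsManifold.chart_mem_maximalAtlas (I := 𝓡 d) (n := ∞) x
  rw [scalarCurv, (isCoordChange hc he).scalar_eq (mem_transition (mem_chart_source _ x) hx),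
    transition_apply (mem_chart_source _ x)]

theorem scalarCurv_comp_symm (he : e ∈ IsManifold.maximalAtlas (𝓡 d) ∞ M) :
    EqOn (scalarCurv (M := M) d ∘ e.symm) (Coord.scalar (metricMat e)) e.target := fun y hy => by
  rw [Function.comp, scalarCurv_eq he (e.map_target hy), e.right_inv hy]

theorem contMDiff_scalarCurv : ContMDiff (𝓡 d) 𝓘(ℝ, ℝ) ∞ (scalarCurv (M := M) d) := by
  intro x
  have hc := IsManifold.chart_mem_maximalAtlas (I := 𝓡 d) (n := ∞) x
  have h1 := (isMetricOn_metricMat hc).smooth_scalar.contMDiffOn.comp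
    (contMDiffOn_of_mem_maximalAtlas hc) fun y hy => (chartAt (Eucl d) x).map_source hy
  refine (h1.congr fun y hy => ?_).contMDiffAt (chart_source_mem_nhds (Eucl d) x)
  exact scalarCurv_eq hc hy

theorem laplace_eq (he : e ∈ IsManifold.maximalAtlas (𝓡 d) ∞ M) {x : M} (hx : x ∈ e.source)
    {f : M → ℝ} (hf : ContMDiff (𝓡 d) 𝓘(ℝ, ℝ) ∞ f) :
    laplace d f x = Coord.laplacian (metricMat e) (f ∘ e.symm) (e x) := by
  have hc := IsManifold.chart_mem_maximalAtlas (I := 𝓡 d) (n := ∞) x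
  have hxc := mem_chart_source (Eucl d) x
  rw [laplace, Coord.laplacian_congr (comp_symm_eventuallyEq hxc hx f),
    (isCoordChange hc he).laplacian_eq (mem_transition hxc hx) (contDiffOn_comp_symm he hf),
    transition_apply hxc]

variable (d) in
/-- The inner product of the differentials of two functions. -/
noncomputable def gradPair (u f : M → ℝ) (x : M) : ℝ :=
  Coord.gradInner (metricMat (chartAt (Eucl d) x)) (u ∘ (chartAt (Eucl d) x).symm)
    (f ∘ (chartAt (Eucl d) x).symm) (chartAt (Eucl d) x x)

theorem gradPair_eq (he : e ∈ IsManifold.maximalAtlas (𝓡 d) ∞ M) {x : M} (hx : x ∈ e.source)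
    {u f : M → ℝ} (hu : ContMDiff (𝓡 d) 𝓘(ℝ, ℝ) ∞ u) (hf : ContMDiff (𝓡 d) 𝓘(ℝ, ℝ) ∞ f) :
    gradPair d u f x
      = Coord.gradInner (metricMat e) (u ∘ e.symm) (f ∘ e.symm) (e x) := by
  have hc := IsManifold.chart_mem_maximalAtlas (I := 𝓡 d) (n := ∞) x
  have hxc := mem_chart_source (Eucl d) x
  rw [gradPair, Coord.gradInner_congr (comp_symm_eventuallyEq hxc hx u)
    (comp_symm_eventuallyEq hxc hx f),
    (isCoordChange hc he).gradInner_eq (mem_transition hxc hx) (contDiffOn_comp_symm he hu)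
      (contDiffOn_comp_symm he hf), transition_apply hxc]

/-- The covariant derivative of a vector field in an arbitrary chart. -/
theorem vecComp_covDerivVec (he : e ∈ IsManifold.maximalAtlas (𝓡 d) ∞ M) {x : M}
    (hx : x ∈ e.source) (v : TangentSpace (𝓡 d) x) {U : Set M} (hU : IsOpen U) (hxU : x ∈ U)
    {Y : ∀ z : M, TangentSpace (𝓡 d) z}
    (hY : ContMDiffOn (𝓡 d) (𝓡 d).tangent ∞ (fun x => (⟨x, Y x⟩ : TangentBundle (𝓡 d) M)) U)
    (k : Fin d) :
    vecComp e x (covDerivVec x v Y) k = Coord.covVec (metricMat e) (vecComp e x v)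
      (fun k y => vecComp e (e.symm y) (Y (e.symm y)) k) k (e x) := by
  have hc := IsManifold.chart_mem_maximalAtlas (I := 𝓡 d) (n := ∞) x
  have hxc := mem_chart_source (Eucl d) x
  set c := chartAt (Eucl d) x with hcdef
  have hdiff : ∀ e' ∈ IsManifold.maximalAtlas (𝓡 d) ∞ M, x ∈ e'.source → ∀ k,
      DifferentiableAt ℝ (fun y => vecComp e' (e'.symm y) (Y (e'.symm y)) k) (e' x) :=
    fun e' he' hx' k => Coord.differentiableAt_of_contDiffOn
      (e'.isOpen_inter_preimage_symm hU)
      ⟨e'.map_source hx', by simpa [e'.left_inv hx'] using hxU⟩ (contDiffOn_vecComp he' hY k)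
  have h1 : ∀ l, vecComp c x (covDerivVec x v Y) l = Coord.covVec (metricMat c) (vecComp c x v)
      (fun k y => vecComp c (c.symm y) (Y (c.symm y)) k) l (c x) := fun l => by
    refine (vecComp_sum _ _ _ _ _).trans ?_
    refine (Finset.sum_congr rfl fun m _ => congrArg (_ * ·)
      (vecComp_coordVec hc hxc m l)).trans ?_
    simp only [mul_ite, mul_one, mul_zero, Finset.sum_ite_eq, Finset.mem_univ, if_true]
    rfl
  rw [vecComp_transition hc he hxc hx]
  simp only [h1]
  have h3 := (isCoordChange hc he).covVec_eq (mem_transition hxc hx)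
    (v' := vecComp c x v) (v := vecComp e x v)
    (Y' := fun k y => vecComp c (c.symm y) (Y (c.symm y)) k)
    (Y := fun k y => vecComp e (e.symm y) (Y (e.symm y)) k)
    (fun a => vecComp_transition hc he hxc hx v a) ?_ (hdiff c hc hxc)
    (by rw [transition_apply hxc]; exact hdiff e he hx) k
  · rw [transition_apply hxc] at h3
    exact h3.symm
  · filter_upwards [(isOpen_transition c e).mem_nhds (mem_transition hxc hx)] with z hz a
    have hz1 := c.map_target hz.1
    have h4 := vecComp_transition hc he hz1 hz.2 (Y (c.symm z)) a
    rw [c.right_inv hz.1] at h4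
    have h5 : e.symm ((e ∘ c.symm) z) = c.symm z := e.left_inv hz.2
    exact (vecComp_congr e Y h5 a).trans h4

end Invariance

end Geom

/-! ### The Riemannian volume in charts. -/

theorem ContinuousOn.measurableSet_preimage_inter {α β : Type*} [TopologicalSpace α]
    [MeasurableSpace α] [OpensMeasurableSpace α] [TopologicalSpace β] [MeasurableSpace β]
    [BorelSpace β] {f : α → β} {t : Set α} (hf : ContinuousOn f t) (ht : MeasurableSet t)
    {s : Set β} (hs : MeasurableSet s) : MeasurableSet (f ⁻¹' s ∩ t) := by
  have h := ht.subtype_image ((continuousOn_iff_continuous_domRestrict.1 hf).measurable hs)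
  convert h using 1
  ext x
  simp [and_comm]

namespace Geom

section ChartVolume

variable {d : ℕ} {X : Type*} [TopologicalSpace X] [ChartedSpace (Eucl d) X]
  [MeasurableSpace X] [BorelSpace X]
  {T : ∀ x : X, TangentSpace (𝓡 d) x → TangentSpace (𝓡 d) x → ℝ}
  {e e' : OpenPartialHomeomorph X (Eucl d)}

theorem aemeasurable_chart_symm {X : Type*} [TopologicalSpace X] [MeasurableSpace X]
    [BorelSpace X] (e : OpenPartialHomeomorph X (Eucl d)) (f : Eucl d → ENNReal) :
    AEMeasurable e.symm (((volume : Measure (Eucl d)).restrict e.target).withDensity f) :=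
  (e.continuousOn_symm.aemeasurable e.open_target.measurableSet).mono_ac
    (withDensity_absolutelyContinuous _ _)

theorem chartVolume_apply {S : Set X} (hS : MeasurableSet S) :
    chartVolume T e S
      = ∫⁻ y in e.symm ⁻¹' S ∩ e.target, ENNReal.ofReal (Real.sqrt (comps T e y).det) := by
  rw [chartVolume, Measure.map_apply_of_aemeasurable (aemeasurable_chart_symm e _) hS,
    withDensity_apply', Measure.restrict_restrict' e.open_target.measurableSet]

theorem chartVolume_compl_source : chartVolume T e e.sourceᶜ = 0 := by
  rw [chartVolume_apply e.open_source.measurableSet.compl]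
  have : e.symm ⁻¹' e.sourceᶜ ∩ e.target = ∅ := by
    ext y
    simp only [mem_inter_iff, mem_preimage, mem_compl_iff, mem_empty_iff_false, iff_false, not_and]
    exact fun h hy => h (e.map_target hy)
  rw [this, Measure.restrict_empty, lintegral_zero_measure]

theorem det_fderiv_eq_det_jac {Ψ : Eucl d → Eucl d} {y : Eucl d} (hΨ : DifferentiableAt ℝ Ψ y) :
    (fderiv ℝ Ψ y).det = (Coord.jac Ψ y).det := by
  have h := LinearMap.det_toMatrix (EuclideanSpace.basisFun (Fin d) ℝ).toBasis
    (fderiv ℝ Ψ y : Eucl d →ₗ[ℝ] Eucl d)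
  rw [ContinuousLinearMap.det, ← h]
  congr 1
  ext a i
  rw [LinearMap.toMatrix_apply, ← fderiv_single_eq_jac hΨ]
  simp

/-- The volume of a set in two charts. -/
theorem chartVolume_eq (hT : IsBilin T) (he : e ∈ IsManifold.maximalAtlas (𝓡 d) ∞ X)
    (he' : e' ∈ IsManifold.maximalAtlas (𝓡 d) ∞ X) {S : Set X} (hS : MeasurableSet S)
    (hSe : S ⊆ e.source) (hSe' : S ⊆ e'.source) : chartVolume T e S = chartVolume T e' S := by
  rw [chartVolume_apply hS, chartVolume_apply hS]
  set D := e.symm ⁻¹' S ∩ e.target with hD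
  have hDt : D ⊆ e.target ∩ e.symm ⁻¹' e'.source := fun y hy => ⟨hy.2, hSe' hy.1⟩
  have himg : e'.symm ⁻¹' S ∩ e'.target = (e' ∘ e.symm) '' D := by
    ext z
    constructor
    · rintro ⟨hz, hz'⟩
      refine ⟨e (e'.symm z), ⟨by simpa [e.left_inv (hSe hz)] using hz, e.map_source (hSe hz)⟩, ?_⟩
      simp [e.left_inv (hSe hz), e'.right_inv hz']
    · rintro ⟨y, hy, rfl⟩
      refine ⟨?_, e'.map_source (hSe' hy.1)⟩
      simpa [e'.left_inv (hSe' hy.1)] using hy.1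
  have hdiff : ∀ y ∈ D, DifferentiableAt ℝ (e' ∘ e.symm) y := fun y hy =>
    Coord.differentiableAt_of_contDiffOn (isOpen_transition e e') (hDt hy)
      (contDiffOn_transition he he')
  have hDm : MeasurableSet D :=
    e.continuousOn_symm.measurableSet_preimage_inter e.open_target.measurableSet hS
  rw [himg, lintegral_image_eq_lintegral_abs_det_fderiv_mul volume hDm
    (fun y hy => (hdiff y hy).hasFDerivAt.hasFDerivWithinAt)
    (fun y hy z hz hyz => ?_)]
  -- The density transforms by `√det(Jᵀ G J) = |det J| √det G`, exactly the factor in the change of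
  -- variables formula.
  · refine setLIntegral_congr_fun hDm fun y hy => ?_
    rw [det_fderiv_eq_det_jac (hdiff y hy), comps_transition hT he he' (hDt hy),
      ← ENNReal.ofReal_mul (abs_nonneg _), ← Real.sqrt_sq_eq_abs, ← Real.sqrt_mul (sq_nonneg _)]
    simp only [Matrix.det_mul, Matrix.det_transpose, Function.comp]
    congr 2
    ring
  · have := congrArg e'.symm hyz
    simp only [Function.comp, e'.left_inv (hSe' hy.1), e'.left_inv (hSe' hz.1)] at this
    rw [← e.right_inv hy.2, this, e.right_inv hz.2]

variable [IsManifold (𝓡 d) ∞ X] [SigmaCompactSpace X] [Nonempty X]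

/-- The volume measure in an arbitrary chart. -/
theorem volumeMeasure_apply (hT : IsBilin T) (he : e ∈ IsManifold.maximalAtlas (𝓡 d) ∞ X)
    {S : Set X} (hS : MeasurableSet S) (hSe : S ⊆ e.source) :
    volumeMeasure T S = chartVolume T e S := by
  let c := (exists_chart_sequence d X).choose
  have hc : ⋃ n, (chartAt (Eucl d) (c n)).source = univ := (exists_chart_sequence d X).choose_spec
  have hm := MeasurableSet.disjointed
    fun n => (chartAt (Eucl d) (c n)).open_source.measurableSet
  -- Each disjoint piece of `S` lies both in its gluing chart and in `e`, so the two chart volumes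
  -- agree piece by piece.
  have h1 : volumeMeasure T S = ∑' n, chartVolume T e
      (S ∩ disjointed (fun k => (chartAt (Eucl d) (c k)).source) n) := by
    rw [volumeMeasure, Measure.sum_apply _ hS]
    refine tsum_congr fun n => ?_
    rw [Measure.restrict_apply hS]
    exact chartVolume_eq hT (IsManifold.chart_mem_maximalAtlas _) he (hS.inter (hm n))
      (inter_subset_right.trans (disjointed_subset _ _)) (inter_subset_left.trans hSe)
  rw [h1, ← measure_iUnion (fun i j hij => ((disjoint_disjointed _ hij).mono inter_subset_right
    inter_subset_right)) fun n => hS.inter (hm n), ← inter_iUnion, iUnion_disjointed, hc,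
    inter_univ]

theorem volumeMeasure_restrict (hT : IsBilin T) (he : e ∈ IsManifold.maximalAtlas (𝓡 d) ∞ X) :
    (volumeMeasure T).restrict e.source = chartVolume T e := by
  ext S hS
  rw [Measure.restrict_apply hS,
    volumeMeasure_apply hT he (hS.inter e.open_source.measurableSet) inter_subset_right]
  exact measure_inter_conull chartVolume_compl_source

/-- Volumes are at most the coordinate volume times a bound of the density. -/
theorem volumeMeasure_le (hT : IsBilin T) (he : e ∈ IsManifold.maximalAtlas (𝓡 d) ∞ X)
    {Q : Set (Eucl d)} (hQt : Q ⊆ e.target) {S : Set X} (hS : MeasurableSet S)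
    (hSQ : S ⊆ e.symm '' Q) {C : ℝ}
    (hC : ∀ y ∈ Q, Real.sqrt (comps T e y).det ≤ C) :
    volumeMeasure T S ≤ ENNReal.ofReal C * volume Q := by
  have hSe : S ⊆ e.source := hSQ.trans (by rintro _ ⟨y, hy, rfl⟩; exact e.map_target (hQt hy))
  have hsub : e.symm ⁻¹' S ∩ e.target ⊆ Q := by
    rintro y ⟨hy, hyt⟩
    obtain ⟨z, hz, hzy⟩ := hSQ hy
    rwa [← e.right_inv hyt, ← hzy, e.right_inv (hQt hz)]
  rw [volumeMeasure_apply hT he hS hSe, chartVolume_apply hS]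
  calc _ ≤ ∫⁻ _ in e.symm ⁻¹' S ∩ e.target, ENNReal.ofReal C :=
        setLIntegral_mono' (e.continuousOn_symm.measurableSet_preimage_inter
          e.open_target.measurableSet hS) fun y hy => ENNReal.ofReal_le_ofReal (hC y (hsub hy))
    _ = ENNReal.ofReal C * volume (e.symm ⁻¹' S ∩ e.target) := by simp
    _ ≤ _ := by gcongr

/-- Integration in a chart. -/
theorem integral_eq_chart (hT : IsBilin T) (he : e ∈ IsManifold.maximalAtlas (𝓡 d) ∞ X)
    (hcont : ContinuousOn (fun y => (comps T e y).det) e.target) {f : X → ℝ}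
    (hf : AEStronglyMeasurable f (volumeMeasure T)) (hsupp : ∀ x ∉ e.source, f x = 0) :
    ∫ x, f x ∂(volumeMeasure T)
      = ∫ y in e.target, Real.sqrt (comps T e y).det * f (e.symm y) := by
  rw [← setIntegral_eq_integral_of_forall_compl_eq_zero hsupp, volumeMeasure_restrict hT he,
    chartVolume, integral_map (aemeasurable_chart_symm e _),
    integral_withDensity_eq_integral_toReal_smul₀]
  · simp only [ENNReal.toReal_ofReal (Real.sqrt_nonneg _), smul_eq_mul]
  · exact ((hcont.aemeasurable e.open_target.measurableSet).sqrt).ennreal_ofReal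
  · exact Eventually.of_forall fun _ => ENNReal.ofReal_lt_top
  · have := hf.restrict (s := e.source)
    rwa [volumeMeasure_restrict hT he, chartVolume] at this

/-- The continuous density is bounded on a closed coordinate ball around each point. -/
theorem isLocallyFiniteMeasure_volumeMeasure (hT : IsBilin T)
    (hcont : ∀ x : X, ContinuousOn (fun y => (comps T (chartAt (Eucl d) x) y).det)
      (chartAt (Eucl d) x).target) : IsLocallyFiniteMeasure (volumeMeasure T) := by
  refine ⟨fun x => ?_⟩
  set e := chartAt (Eucl d) x
  have hx : x ∈ e.source := mem_chart_source _ x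
  obtain ⟨r, hr, hr2⟩ := Metric.nhds_basis_closedBall.mem_iff.1
    (e.open_target.mem_nhds (e.map_source hx))
  obtain ⟨C, hC⟩ := ((isCompact_closedBall (e x) r).bddAbove_image
    ((hcont x).mono hr2).sqrt)
  have hopen : IsOpen (e.source ∩ e ⁻¹' Metric.ball (e x) r) :=
    e.isOpen_inter_preimage Metric.isOpen_ball
  refine ⟨_, hopen.mem_nhds ⟨hx, Metric.mem_ball_self hr⟩, lt_of_le_of_lt
    (volumeMeasure_le hT (IsManifold.chart_mem_maximalAtlas x) hr2 hopen.measurableSet (C := C)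
      ?_ fun y hy => hC (mem_image_of_mem _ hy)) ?_⟩
  · rintro z ⟨hz, hz'⟩
    exact ⟨e z, Metric.ball_subset_closedBall hz', e.left_inv hz⟩
  · exact ENNReal.mul_lt_top ENNReal.ofReal_lt_top (isCompact_closedBall _ _).measure_lt_top

end ChartVolume

end Geom

/-! ### Green's formula in one chart. -/

namespace Coord

variable {d : ℕ}

theorem IsMetricOn.contDiffOn_flux {G : Eucl d → Matrix (Fin d) (Fin d) ℝ} {U : Set (Eucl d)}
    (hG : IsMetricOn G U) {f : Eucl d → ℝ} (hf : ContDiffOn ℝ ∞ f U) (i : Fin d) :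
    ContDiffOn ℝ ∞ (fun z => Real.sqrt (G z).det * ∑ j, (G z)⁻¹ i j * pd j f z) U :=
  (hG.smooth.det.sqrt fun _ hy => (hG.det_pos hy).ne').mul
    (ContDiffOn.sum fun j _ => (hG.smooth_inv i j).mul (contDiffOn_pd hG.isOpen hf j))

theorem IsMetricOn.continuousOn_laplacian {G : Eucl d → Matrix (Fin d) (Fin d) ℝ}
    {U : Set (Eucl d)} (hG : IsMetricOn G U) {f : Eucl d → ℝ} (hf : ContDiffOn ℝ ∞ f U) :
    ContinuousOn (laplacian G f) U := by
  have h1 := (hG.smooth.det.sqrt fun y hy => (hG.det_pos hy).ne').continuousOn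
  exact ((h1.inv₀ fun y hy => (Real.sqrt_pos.2 (hG.det_pos hy)).ne').mul
    (continuousOn_finsetSum _ fun i _ =>
      (contDiffOn_pd hG.isOpen (hG.contDiffOn_flux hf i) i).continuousOn)).neg

theorem IsMetricOn.continuousOn_gradInner {G : Eucl d → Matrix (Fin d) (Fin d) ℝ}
    {U : Set (Eucl d)} (hG : IsMetricOn G U) {u f : Eucl d → ℝ} (hu : ContDiffOn ℝ ∞ u U)
    (hf : ContDiffOn ℝ ∞ f U) : ContinuousOn (gradInner G u f) U :=
  continuousOn_finsetSum _ fun i _ => continuousOn_finsetSum _ fun j _ =>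
    ((hG.smooth_inv i j).continuousOn.mul (contDiffOn_pd hG.isOpen hu i).continuousOn).mul
      (contDiffOn_pd hG.isOpen hf j).continuousOn

theorem tsupport_pd_subset (k : Fin d) (u : Eucl d → ℝ) : tsupport (pd k u) ⊆ tsupport u :=
  (closure_mono fun y hy => by
    contrapose! hy
    simp only [pd, Function.mem_support, not_not]
    have : fderiv ℝ u y = 0 := by
      by_contra h
      exact hy (support_fderiv_subset ℝ h)
    simp [this]).trans isClosed_closure.closure_subset

/-- Green's formula in coordinates. -/
theorem IsMetricOn.integral_mul_laplacian {G : Eucl d → Matrix (Fin d) (Fin d) ℝ}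
    {U : Set (Eucl d)} (hG : IsMetricOn G U) {u f : Eucl d → ℝ} (hu : ContDiff ℝ ∞ u)
    (hc : HasCompactSupport u) (huU : tsupport u ⊆ U) (hf : ContDiffOn ℝ ∞ f U) :
    ∫ y in U, Real.sqrt (G y).det * (u y * laplacian G f y)
      = ∫ y in U, Real.sqrt (G y).det * gradInner G u f y := by
  set W : Fin d → Eucl d → ℝ :=
    fun i z => Real.sqrt (G z).det * ∑ j, (G z)⁻¹ i j * pd j f z with hW
  have hWs : ∀ i, ContDiffOn ℝ ∞ (W i) U := fun i => hG.contDiffOn_flux hf i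
  have hpu : ∀ i, tsupport (pd i u) ⊆ tsupport u := fun i => tsupport_pd_subset i u
  -- The factors are continuous only on `U`, but the support of the product is compact inside `U`.
  -- This supplies every integrability condition for integration by parts.
  have hint : ∀ {g w : Eucl d → ℝ}, ContinuousOn g U → ContinuousOn w U →
      tsupport w ⊆ tsupport u → Integrable (fun y => g y * w y) volume := fun {g w} hg hw hs => by
    have hs2 : tsupport (fun y => g y * w y) ⊆ tsupport u :=
      (tsupport_mul_subset_right (f := g) (g := w)).trans hs
    exact ((hg.mul hw).continuous_of_tsupport_subset hG.isOpen
      (hs2.trans huU)).integrable_of_hasCompactSupport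
        (hc.of_isClosed_subset (isClosed_tsupport _) hs2)
  have hpc : ∀ i, ContinuousOn (pd i u) U := fun i =>
    (contDiffOn_pd hG.isOpen hu.contDiffOn i).continuousOn
  have hWc : ∀ i, ContinuousOn (pd i (W i)) U := fun i =>
    (contDiffOn_pd hG.isOpen (hWs i) i).continuousOn
  have h1 : ∀ y ∈ U, Real.sqrt (G y).det * (u y * laplacian G f y)
      = -∑ i, pd i (W i) y * u y := fun y hy => by
    have := (Real.sqrt_pos.2 (hG.det_pos hy)).ne'
    rw [laplacian, ← Finset.sum_mul]
    field_simp
    rfl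
  have h2 : ∀ y, Real.sqrt (G y).det * gradInner G u f y = ∑ i, W i y * pd i u y := fun y => by
    simp only [gradInner, hW, Finset.mul_sum, Finset.sum_mul]
    exact Finset.sum_congr rfl fun i _ => Finset.sum_congr rfl fun j _ => by ring
  have hz : ∀ y ∉ U, u y = 0 := fun y hy => image_eq_zero_of_notMem_tsupport fun h => hy (huU h)
  have hz' : ∀ i, ∀ y ∉ U, pd i u y = 0 := fun i y hy =>
    image_eq_zero_of_notMem_tsupport fun h => hy (huU (hpu i h))
  rw [setIntegral_congr_fun hG.isOpen.measurableSet h1,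
    setIntegral_eq_integral_of_forall_compl_eq_zero (fun y hy => by simp [hz y hy])]
  simp only [h2]
  rw [setIntegral_eq_integral_of_forall_compl_eq_zero (fun y hy => by simp [hz' _ y hy]),
    integral_neg, integral_finsetSum _ fun i _ => hint (hWc i) hu.continuous.continuousOn
      subset_rfl, integral_finsetSum _ fun i _ => hint (hWs i).continuousOn (hpc i) (hpu i),
    ← Finset.sum_neg_distrib]
  refine Finset.sum_congr rfl fun i _ => ?_
  exact (integral_mul_fderiv_eq_neg_fderiv_mul_of_integrable
    (v := (EuclideanSpace.single i 1 : Eucl d)) (f := W i) (g := u)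
    (hint (hWc i) hu.continuous.continuousOn subset_rfl)
    (hint (hWs i).continuousOn (hpc i) (hpu i))
    (hint (hWs i).continuousOn hu.continuous.continuousOn subset_rfl)
    (fun y hy => differentiableAt_of_contDiffOn hG.isOpen (huU hy) (hWs i))
    (fun y _ => hu.differentiable (by simp) y)).symm

end Coord

/-! ### Green's formula on the manifold. -/

namespace Geom

section Green

variable {d : ℕ} {M : Type*} [TopologicalSpace M] [ChartedSpace (Eucl d) M]
  [RiemannianBundle (fun x : M => TangentSpace (𝓡 d) x)]
  [IsManifold (𝓡 d) ∞ M]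
  [IsContMDiffRiemannianBundle (𝓡 d) ∞ (Eucl d) (fun x : M => TangentSpace (𝓡 d) x)]
  {u f : M → ℝ}

theorem continuous_laplace (hf : ContMDiff (𝓡 d) 𝓘(ℝ, ℝ) ∞ f) : Continuous (laplace d f) := by
  refine continuous_iff_continuousAt.2 fun x => ?_
  have hc := IsManifold.chart_mem_maximalAtlas (I := 𝓡 d) (n := ∞) x
  have h1 : ContinuousOn (fun z => Coord.laplacian (metricMat (chartAt (Eucl d) x))
      (f ∘ (chartAt (Eucl d) x).symm) (chartAt (Eucl d) x z)) (chartAt (Eucl d) x).source :=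
    ((isMetricOn_metricMat hc).continuousOn_laplacian (contDiffOn_comp_symm hc hf)).comp
      (chartAt (Eucl d) x).continuousOn fun y hy => (chartAt (Eucl d) x).map_source hy
  exact (h1.congr fun z hz => laplace_eq hc hz hf).continuousAt (chart_source_mem_nhds _ x)

theorem continuous_gradPair (hu : ContMDiff (𝓡 d) 𝓘(ℝ, ℝ) ∞ u)
    (hf : ContMDiff (𝓡 d) 𝓘(ℝ, ℝ) ∞ f) : Continuous (gradPair d u f) := by
  refine continuous_iff_continuousAt.2 fun x => ?_
  have hc := IsManifold.chart_mem_maximalAtlas (I := 𝓡 d) (n := ∞) x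
  have h1 : ContinuousOn (fun z => Coord.gradInner (metricMat (chartAt (Eucl d) x))
      (u ∘ (chartAt (Eucl d) x).symm) (f ∘ (chartAt (Eucl d) x).symm) (chartAt (Eucl d) x z))
      (chartAt (Eucl d) x).source :=
    ((isMetricOn_metricMat hc).continuousOn_gradInner (contDiffOn_comp_symm hc hu)
      (contDiffOn_comp_symm hc hf)).comp
      (chartAt (Eucl d) x).continuousOn fun y hy => (chartAt (Eucl d) x).map_source hy
  exact (h1.congr fun z hz => gradPair_eq hc hz hu hf).continuousAt (chart_source_mem_nhds _ x)

theorem gradPair_congr {M : Type*} [TopologicalSpace M] [ChartedSpace (Eucl d) M]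
    [RiemannianBundle (fun x : M => TangentSpace (𝓡 d) x)] {u u' f : M → ℝ} {x : M}
    (h : u =ᶠ[𝓝 x] u') : gradPair d u f x = gradPair d u' f x := by
  refine Coord.gradInner_congr ?_ EventuallyEq.rfl
  have hx := mem_chart_source (Eucl d) x
  have h2 := (chartAt (Eucl d) x).continuousAt_symm ((chartAt (Eucl d) x).map_source hx)
  rw [ContinuousAt, (chartAt (Eucl d) x).left_inv hx] at h2
  exact h2.eventually h

theorem gradPair_const {M : Type*} [TopologicalSpace M] [ChartedSpace (Eucl d) M]
    [RiemannianBundle (fun x : M => TangentSpace (𝓡 d) x)] {f : M → ℝ} (c : ℝ) (x : M) :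
    gradPair d (fun _ => c) f x = 0 := by
  have : (fun _ => c) ∘ (chartAt (Eucl d) x).symm = fun _ => c := rfl
  simp [gradPair, Coord.gradInner, this, Coord.pd_const]

theorem support_gradPair_subset {M : Type*} [TopologicalSpace M] [ChartedSpace (Eucl d) M]
    [RiemannianBundle (fun x : M => TangentSpace (𝓡 d) x)] {u f : M → ℝ} :
    Function.support (gradPair d u f) ⊆ tsupport u := fun x hx => by
  by_contra h
  refine hx ?_
  rw [gradPair_congr (u' := fun _ => 0) (notMem_tsupport_iff_eventuallyEq.1 h), gradPair_const]

theorem gradPair_sum {M : Type*} [TopologicalSpace M] [ChartedSpace (Eucl d) M]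
    [RiemannianBundle (fun x : M => TangentSpace (𝓡 d) x)] [IsManifold (𝓡 d) ∞ M] {f : M → ℝ}
    {ι : Type*} (F : Finset ι) {v : ι → M → ℝ}
    (hv : ∀ i ∈ F, ContMDiff (𝓡 d) 𝓘(ℝ, ℝ) ∞ (v i)) (x : M) :
    gradPair d (fun z => ∑ i ∈ F, v i z) f x = ∑ i ∈ F, gradPair d (v i) f x := by
  have hc := IsManifold.chart_mem_maximalAtlas (I := 𝓡 d) (n := ∞) x
  have hx := (chartAt (Eucl d) x).map_source (mem_chart_source (Eucl d) x)
  have h1 : ∀ k, Coord.pd k ((fun z => ∑ i ∈ F, v i z) ∘ (chartAt (Eucl d) x).symm)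
      (chartAt (Eucl d) x x) = ∑ i ∈ F, Coord.pd k (v i ∘ (chartAt (Eucl d) x).symm)
        (chartAt (Eucl d) x x) := fun k =>
    Coord.pd_sum F k fun i hi => Coord.differentiableAt_of_contDiffOn
      (chartAt (Eucl d) x).open_target hx (contDiffOn_comp_symm hc (hv i hi))
  simp only [gradPair, Coord.gradInner, h1, Finset.mul_sum, Finset.sum_mul]
  conv_rhs => rw [Finset.sum_comm]
  refine Finset.sum_congr rfl fun i _ => ?_
  rw [Finset.sum_comm]


/-- A function supported in a chart, as a function on the model space. -/
theorem contDiff_indicator_chart {M : Type*} [TopologicalSpace M] [ChartedSpace (Eucl d) M]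
    [T2Space M] {u : M → ℝ} {e : OpenPartialHomeomorph M (Eucl d)}
    (he : e ∈ IsManifold.maximalAtlas (𝓡 d) ∞ M) (hu : ContMDiff (𝓡 d) 𝓘(ℝ, ℝ) ∞ u)
    (hc : HasCompactSupport u) (hue : tsupport u ⊆ e.source) :
    ContDiff ℝ ∞ (e.target.indicator (u ∘ e.symm)) ∧
      HasCompactSupport (e.target.indicator (u ∘ e.symm)) ∧
      tsupport (e.target.indicator (u ∘ e.symm)) ⊆ e.target := by
  have hK : IsCompact (e '' tsupport u) := hc.isCompact.image_of_continuousOn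
    (e.continuousOn.mono hue)
  have hs : tsupport (e.target.indicator (u ∘ e.symm)) ⊆ e '' tsupport u :=
    closure_minimal (fun y hy => by
      have hy' : y ∈ e.target := by
        by_contra h
        exact hy (indicator_of_notMem h _)
      rw [Function.mem_support, indicator_of_mem hy'] at hy
      exact ⟨e.symm y, subset_tsupport _ hy, e.right_inv hy'⟩) hK.isClosed
  have ht : e '' tsupport u ⊆ e.target := by
    rintro _ ⟨x, hx, rfl⟩
    exact e.map_source (hue hx)
  refine ⟨contDiff_iff_contDiffAt.2 fun y => ?_, hK.of_isClosed_subset (isClosed_tsupport _) hs,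
    hs.trans ht⟩
  by_cases hy : y ∈ tsupport (e.target.indicator (u ∘ e.symm))
  swap
  · exact (contDiffAt_const (c := (0 : ℝ))).congr_of_eventuallyEq
      (notMem_tsupport_iff_eventuallyEq.1 hy)
  have hy' := e.open_target.mem_nhds (ht (hs hy))
  refine ((contDiffOn_comp_symm he hu).contDiffAt hy').congr_of_eventuallyEq ?_
  filter_upwards [hy'] with z hz
  exact indicator_of_mem hz _

variable [T2Space M] [MeasurableSpace M] [BorelSpace M] [SigmaCompactSpace M] [Nonempty M]

/-- Extension by zero turns `u` into a smooth compactly supported function on the model space, where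
the coordinate formula applies. -/
theorem integral_mul_laplace_of_tsupport_subset {e : OpenPartialHomeomorph M (Eucl d)}
    (he : e ∈ IsManifold.maximalAtlas (𝓡 d) ∞ M) (hu : ContMDiff (𝓡 d) 𝓘(ℝ, ℝ) ∞ u)
    (hf : ContMDiff (𝓡 d) 𝓘(ℝ, ℝ) ∞ f)
    (hc : HasCompactSupport u) (hue : tsupport u ⊆ e.source) :
    ∫ x, u x * laplace d f x ∂(volumeMeasure (metric (d := d) (M := M)))
      = ∫ x, gradPair d u f x ∂(volumeMeasure (metric (d := d) (M := M))) := by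
  have hG := isMetricOn_metricMat he
  have hz : ∀ x ∉ e.source, u x = 0 := fun x hx =>
    image_eq_zero_of_notMem_tsupport fun h => hx (hue h)
  have hz' : ∀ x ∉ e.source, gradPair d u f x = 0 := fun x hx => by
    by_contra h
    exact hx (hue (support_gradPair_subset h))
  obtain ⟨h1, h2, h3⟩ := contDiff_indicator_chart he hu hc hue
  have hdet : ContinuousOn (fun y => (comps (metric (d := d) (M := M)) e y).det) e.target :=
    hG.smooth.det.continuousOn
  rw [integral_eq_chart (f := fun x => u x * laplace d f x) isBilin_metric he hdet
      (hu.continuous.mul (continuous_laplace hf)).aestronglyMeasurable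
      (fun x hx => by simp [hz x hx]),
    integral_eq_chart isBilin_metric he hdet (continuous_gradPair hu hf).aestronglyMeasurable hz']
  refine Eq.trans ?_ ((hG.integral_mul_laplacian h1 h2 h3 (contDiffOn_comp_symm he hf)).trans ?_)
  · refine setIntegral_congr_fun e.open_target.measurableSet fun y hy => ?_
    simp only [indicator_of_mem hy, Function.comp, laplace_eq he (e.map_target hy) hf,
      e.right_inv hy]
    rfl
  · refine setIntegral_congr_fun e.open_target.measurableSet fun y hy => ?_
    simp only [gradPair_eq he (e.map_target hy) hu hf, e.right_inv hy]
    refine congrArg (_ * ·) (Coord.gradInner_congr ?_ EventuallyEq.rfl)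
    filter_upwards [e.open_target.mem_nhds hy] with z hz
    exact indicator_of_mem hz _

instance : IsLocallyFiniteMeasure (volumeMeasure (metric (d := d) (M := M))) :=
  isLocallyFiniteMeasure_volumeMeasure isBilin_metric fun x =>
    (isMetricOn_metricMat (IsManifold.chart_mem_maximalAtlas x)).smooth.det.continuousOn

/-- Green's formula for a compactly supported function. -/
theorem integral_mul_laplace (hu : ContMDiff (𝓡 d) 𝓘(ℝ, ℝ) ∞ u)
    (hf : ContMDiff (𝓡 d) 𝓘(ℝ, ℝ) ∞ f) (hc : HasCompactSupport u) :
    ∫ x, u x * laplace d f x ∂(volumeMeasure (metric (d := d) (M := M)))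
      = ∫ x, gradPair d u f x ∂(volumeMeasure (metric (d := d) (M := M))) := by
  obtain ⟨p, hp⟩ := SmoothPartitionOfUnity.exists_isSubordinate (𝓡 d) (s := (univ : Set M))
    isClosed_univ (fun x : M => (chartAt (Eucl d) x).source)
    (fun x => (chartAt (Eucl d) x).open_source)
    fun x _ => mem_iUnion.2 ⟨x, mem_chart_source _ x⟩
  -- Only finitely many partition functions meet the support of `u`. Thus `u` is a finite sum of
  -- functions, each supported in one chart.
  have hfin := p.locallyFinite.finite_nonempty_inter_compact hc.isCompact
  set F := hfin.toFinset with hF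
  have hv : ∀ i, ContMDiff (𝓡 d) 𝓘(ℝ, ℝ) ∞ (fun x => p i x * u x) := fun i =>
    (p i).contMDiff.mul hu
  have hvc : ∀ i, HasCompactSupport (fun x => p i x * u x) := fun i => hc.mul_left
  have hvs : ∀ i, tsupport (fun x => p i x * u x) ⊆ (chartAt (Eucl d) i).source := fun i =>
    (tsupport_mul_subset_left (f := p i) (g := u)).trans (hp i)
  have hsum : ∀ x, u x = ∑ i ∈ F, p i x * u x := fun x => by
    rw [← Finset.sum_mul]
    by_cases hx : u x = 0
    · simp [hx]
    · have h1 : ∑ i ∈ F, p i x = 1 := by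
        rw [← p.sum_eq_one (mem_univ x)]
        refine (finsum_eq_sum_of_support_subset _ fun i hi => ?_).symm
        simp only [hF, Finite.coe_toFinset, mem_ofPred_eq]
        exact ⟨x, hi, subset_tsupport _ hx⟩
      rw [h1, one_mul]
  have hint1 : ∀ i ∈ F, Integrable (fun x => p i x * u x * laplace d f x)
      (volumeMeasure (metric (d := d) (M := M))) := fun i _ =>
    ((hv i).continuous.mul (continuous_laplace hf)).integrable_of_hasCompactSupport
      (hvc i).mul_right
  have hint2 : ∀ i ∈ F, Integrable (fun x => gradPair d (fun x => p i x * u x) f x)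
      (volumeMeasure (metric (d := d) (M := M))) := fun i _ =>
    (continuous_gradPair (hv i) hf).integrable_of_hasCompactSupport
      ((hvc i).mono' support_gradPair_subset)
  calc _ = ∫ x, ∑ i ∈ F, p i x * u x * laplace d f x
          ∂(volumeMeasure (metric (d := d) (M := M))) := by
        refine integral_congr_ae (Eventually.of_forall fun x => ?_)
        simp only [← Finset.sum_mul]
        rw [Finset.sum_mul, ← hsum]
    _ = ∫ x, ∑ i ∈ F, gradPair d (fun x => p i x * u x) f x
          ∂(volumeMeasure (metric (d := d) (M := M))) := by
        rw [integral_finsetSum _ hint1, integral_finsetSum _ hint2]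
        exact Finset.sum_congr rfl fun i _ => integral_mul_laplace_of_tsupport_subset
          (IsManifold.chart_mem_maximalAtlas i) (hv i) hf (hvc i) (hvs i)
    _ = _ := by
        refine integral_congr_ae (Eventually.of_forall fun x => ?_)
        simp only
        rw [← gradPair_sum F fun i _ => hv i]
        exact congrArg (fun w => gradPair d w f x) (funext fun z => (hsum z).symm)

end Green

end Geom

/-! ### Splitting off the radial coordinate. -/

/-- The identification `ℝᵈ × ℝ = ℝᵈ⁺¹`, the last coordinate being the second factor. -/
noncomputable def euclSnoc (d : ℕ) : (Eucl d × ℝ) ≃L[ℝ] Eucl (d + 1) :=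
  LinearEquiv.toContinuousLinearEquiv
    { toFun := fun p => WithLp.toLp 2 (Fin.snoc (α := fun _ => ℝ) p.1.ofLp p.2)
      invFun := fun y => (WithLp.toLp 2 (Fin.init (α := fun _ => ℝ) y.ofLp), y (Fin.last d))
      map_add' := fun p q => by
        ext i
        refine Fin.lastCases ?_ (fun i => ?_) i <;> simp
      map_smul' := fun c p => by
        ext i
        refine Fin.lastCases ?_ (fun i => ?_) i <;> simp
      left_inv := fun p => by simp
      right_inv := fun y => by simp }

section EuclSnoc

variable {d : ℕ}

@[simp] theorem euclSnoc_castSucc (p : Eucl d × ℝ) (i : Fin d) :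
    euclSnoc d p i.castSucc = p.1 i :=
  Fin.snoc_castSucc (α := fun _ => ℝ) _ _ _

@[simp] theorem euclSnoc_last (p : Eucl d × ℝ) : euclSnoc d p (Fin.last d) = p.2 :=
  Fin.snoc_last (α := fun _ => ℝ) _ _

theorem euclSnoc_single_castSucc (i : Fin d) :
    (euclSnoc d).symm (EuclideanSpace.single i.castSucc 1) = (EuclideanSpace.single i 1, 0) := by
  rw [ContinuousLinearEquiv.symm_apply_eq]
  ext j
  refine Fin.lastCases ?_ (fun j => ?_) j
  · simp [(Fin.castSucc_lt_last i).ne']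
  · simp

theorem euclSnoc_single_last :
    (euclSnoc d).symm (EuclideanSpace.single (Fin.last d) 1) = (0, 1) := by
  rw [ContinuousLinearEquiv.symm_apply_eq]
  ext j
  refine Fin.lastCases ?_ (fun j => ?_) j
  · simp
  · simp [(Fin.castSucc_lt_last j).ne]

/-- By uniqueness of Haar measure a linear identification changes volume by a constant. Its value is
immaterial for volume growth. -/
theorem exists_volume_image_euclSnoc (d : ℕ) : ∃ κ : NNReal, ∀ (Q : Set (Eucl d)) (I : Set ℝ),
    volume (euclSnoc d '' (Q ×ˢ I)) = κ * (volume Q * volume I) := by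
  have h1 := (euclSnoc d).symm.isAddHaarMeasure_map volume
  refine ⟨((volume : Measure (Eucl (d + 1))).map (euclSnoc d).symm).addHaarScalarFactor
    ((volume : Measure (Eucl d)).prod (volume : Measure ℝ)), fun Q I => ?_⟩
  · have h2 := Measure.isAddLeftInvariant_eq_smul
      ((volume : Measure (Eucl (d + 1))).map (euclSnoc d).symm) ((volume : Measure (Eucl d)).prod (volume : Measure ℝ))
    have h3 := congrArg (fun m => m (Q ×ˢ I)) h2
    simp only [Measure.smul_apply] at h3
    rw [Measure.prod_prod] at h3
    rw [ContinuousLinearEquiv.image_eq_preimage_symm]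
    have h4 := (euclSnoc d).symm.toHomeomorph.toMeasurableEquiv.map_apply
      (μ := (volume : Measure (Eucl (d + 1)))) (Q ×ˢ I)
    exact h4.symm.trans h3

end EuclSnoc

theorem Matrix.det_eq_of_last_row {n : ℕ} {A : Matrix (Fin (n + 1)) (Fin (n + 1)) ℝ}
    (h : ∀ j, A (Fin.last n) j = if j = Fin.last n then 1 else 0) :
    A.det = (A.submatrix Fin.castSucc Fin.castSucc).det := by
  rw [Matrix.det_succ_row A (Fin.last n), Finset.sum_eq_single (Fin.last n)]
  · have : (-1 : ℝ) ^ (n + n) = 1 := by rw [← two_mul, pow_mul]; simp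
    simp [h, this, Fin.succAbove_last]
  · intro j _ hj
    simp [h, hj]
  · simp

theorem Geom.pull_zero_right {d : ℕ} {X : Type*} [TopologicalSpace X] [ChartedSpace (Eucl d) X]
    (T : ∀ x : X, TangentSpace (𝓡 d) x →L[ℝ] TangentSpace (𝓡 d) x →L[ℝ] ℝ)
    (f : Eucl d → X) (y v : Eucl d) :
    Geom.pull (𝓡 d) (fun x v w => T x v w) f y v 0 = 0 := by
  have h : mfderiv (𝓡 d) (𝓡 d) f y (0 : Eucl d) = 0 := map_zero (mfderiv (𝓡 d) (𝓡 d) f y)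
  exact (congrArg (T (f y) (mfderiv (𝓡 d) (𝓡 d) f y v)) h).trans (map_zero _)

/-! ### The product chart of the end and the metric in it. -/

namespace ALFStructure

variable {M N B : Type*}
  [TopologicalSpace M] [ChartedSpace (Eucl 4) M] [IsManifold (𝓡 4) ∞ M]
  [RiemannianBundle (fun x : M => TangentSpace (𝓡 4) x)]
  [TopologicalSpace N] [ChartedSpace (Eucl 3) N] [IsManifold (𝓡 3) ∞ N]
  [TopologicalSpace B] [ChartedSpace (Eucl 2) B] [IsManifold (𝓡 2) ∞ B]
  (A : ALFStructure M N B)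

theorem mem_source {n : N} {ρ : ℝ} (hρ : 0 < ρ) : (n, ρ) ∈ A.φ.source := by
  rw [A.φ_source]; exact ⟨mem_univ _, hρ⟩

theorem mdifferentiableAt_φ {n : N} {ρ : ℝ} (hρ : 0 < ρ) :
    MDifferentiableAt ((𝓡 3).prod 𝓘(ℝ, ℝ)) (𝓡 4) A.φ (n, ρ) :=
  ((A.φ_smooth _ (A.mem_source hρ)).contMDiffAt
    (A.φ.open_source.mem_nhds (A.mem_source hρ))).mdifferentiableAt (by simp)

/-- The chart `(c, ρ)` of the end of `M`, for the chart `c` of `N`. -/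
noncomputable def prodChart (q : N) : OpenPartialHomeomorph M (Eucl 4) :=
  (A.φ.symm.trans ((chartAt (Eucl 3) q).prod (OpenPartialHomeomorph.refl ℝ))).transHomeomorph
    (euclSnoc 3).toHomeomorph

variable {q : N}

theorem prodChart_symm_apply (y : Eucl 4) : (A.prodChart q).symm y
    = A.φ ((chartAt (Eucl 3) q).symm ((euclSnoc 3).symm y).1, ((euclSnoc 3).symm y).2) := rfl

theorem mem_prodChart_target {y : Eucl 4} : y ∈ (A.prodChart q).target ↔
    ((euclSnoc 3).symm y).1 ∈ (chartAt (Eucl 3) q).target ∧ 0 < ((euclSnoc 3).symm y).2 := by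
  simp [prodChart, A.φ_source]

theorem φ_mem_prodChart_source {n : N} {ρ : ℝ} (hρ : 0 < ρ) :
    A.φ (n, ρ) ∈ (A.prodChart q).source ↔ n ∈ (chartAt (Eucl 3) q).source := by
  have := A.φ.map_source (A.mem_source (n := n) hρ)
  simp [prodChart, A.φ.left_inv (A.mem_source (n := n) hρ), this]

theorem prodChart_apply_φ {n : N} {ρ : ℝ} (hρ : 0 < ρ) :
    A.prodChart q (A.φ (n, ρ)) = euclSnoc 3 (chartAt (Eucl 3) q n, ρ) := by
  simp [prodChart, A.φ.left_inv (A.mem_source (n := n) hρ)]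

/-- The curvature decay is stated for all charts of the maximal atlas, so membership is what allows
it to be read in the product chart. -/
theorem prodChart_mem_maximalAtlas : A.prodChart q ∈ IsManifold.maximalAtlas (𝓡 4) ∞ M := by
  have hc := IsManifold.chart_mem_maximalAtlas (I := 𝓡 3) (n := ∞) q
  refine OpenPartialHomeomorph.mem_maximalAtlas_of_contMDiffOn _ ?_ ?_
  · have h1 : ContMDiffOn ((𝓡 3).prod 𝓘(ℝ, ℝ)) 𝓘(ℝ, Eucl 4) ∞
        (fun p : N × ℝ => euclSnoc 3 (chartAt (Eucl 3) q p.1, p.2))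
        (((chartAt (Eucl 3) q).source) ×ˢ univ) := by
      have h2 := (euclSnoc 3).contDiff (n := ∞)
      refine h2.contMDiff.comp_contMDiffOn ?_
      rw [modelWithCornersSelf_prod, ← chartedSpaceSelf_prod]
      exact ((contMDiffOn_of_mem_maximalAtlas hc).comp contMDiffOn_fst fun p hp => hp.1).prodMk
        contMDiffOn_snd
    refine h1.comp (A.φ_symm_smooth.mono fun x hx => ?_) fun x hx => ?_
    · simp [prodChart] at hx; exact hx.1
    · simp [prodChart] at hx; exact ⟨hx.2, mem_univ _⟩
  · have h1 : ContMDiffOn (𝓡 4) ((𝓡 3).prod 𝓘(ℝ, ℝ)) ∞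
        (fun y : Eucl 4 => ((chartAt (Eucl 3) q).symm ((euclSnoc 3).symm y).1,
          ((euclSnoc 3).symm y).2)) (A.prodChart q).target := by
      have h2 := (euclSnoc 3).symm.contDiff (n := ∞)
      refine ((contMDiffOn_symm_of_mem_maximalAtlas hc).comp (h2.fst.contMDiff.contMDiffOn)
        fun y hy => (A.mem_prodChart_target.1 hy).1).prodMk h2.snd.contMDiff.contMDiffOn
    exact A.φ_smooth.comp h1 fun y hy => A.mem_source (A.mem_prodChart_target.1 hy).2

theorem mfderiv_prodChart_symm {y : Eucl 4} (hy : y ∈ (A.prodChart q).target) (v : Eucl 4) :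
    (mfderiv (𝓡 4) (𝓡 4) (A.prodChart q).symm y v : Eucl 4)
      = mfderiv ((𝓡 3).prod 𝓘(ℝ, ℝ)) (𝓡 4) A.φ
        ((chartAt (Eucl 3) q).symm ((euclSnoc 3).symm y).1, ((euclSnoc 3).symm y).2)
        ((mfderiv (𝓡 3) (𝓡 3) (chartAt (Eucl 3) q).symm ((euclSnoc 3).symm y).1
          ((euclSnoc 3).symm v).1, ((euclSnoc 3).symm v).2) : Eucl 3 × ℝ) := by
  obtain ⟨hy1, hy2⟩ := A.mem_prodChart_target.1 hy
  have hc := IsManifold.chart_mem_maximalAtlas (I := 𝓡 3) (n := ∞) q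
  set g : Eucl 4 → N × ℝ := fun y =>
    ((chartAt (Eucl 3) q).symm ((euclSnoc 3).symm y).1, ((euclSnoc 3).symm y).2) with hg
  have hL1 : HasFDerivAt (fun y => ((euclSnoc 3).symm y).1) _ y :=
    (euclSnoc 3).symm.hasFDerivAt.fst
  have hL2 : HasFDerivAt (fun y => ((euclSnoc 3).symm y).2) _ y :=
    (euclSnoc 3).symm.hasFDerivAt.snd
  have hg1 : MDifferentiableAt (𝓡 4) (𝓡 3)
      (fun y : Eucl 4 => (chartAt (Eucl 3) q).symm ((euclSnoc 3).symm y).1) y :=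
    (Geom.mdifferentiableAt_symm hc hy1).comp y hL1.differentiableAt.mdifferentiableAt
  have hg2 := hL2.differentiableAt.mdifferentiableAt
  have hgd : MDifferentiableAt (𝓡 4) ((𝓡 3).prod 𝓘(ℝ, ℝ)) g y := hg1.prodMk hg2
  have h1 : (A.prodChart q).symm = A.φ ∘ g := rfl
  have h2 : (mfderiv (𝓡 4) ((𝓡 3).prod 𝓘(ℝ, ℝ)) g y : Eucl 4 →L[ℝ] Eucl 3 × ℝ)
      = ((mfderiv (𝓡 3) (𝓡 3) (chartAt (Eucl 3) q).symm ((euclSnoc 3).symm y).1 :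
          Eucl 3 →L[ℝ] Eucl 3).comp
        ((ContinuousLinearMap.fst ℝ _ _).comp ((euclSnoc 3).symm : Eucl 4 →L[ℝ] Eucl 3 × ℝ))).prod
        ((ContinuousLinearMap.snd ℝ _ _).comp
          ((euclSnoc 3).symm : Eucl 4 →L[ℝ] Eucl 3 × ℝ)) := by
    refine (MDifferentiableAt.mfderiv_prod hg1 hg2).trans ?_
    have h3 : (mfderiv (𝓡 4) 𝓘(ℝ, ℝ) (fun y => ((euclSnoc 3).symm y).2) y : Eucl 4 →L[ℝ] ℝ)
        = (ContinuousLinearMap.snd ℝ _ _).comp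
          ((euclSnoc 3).symm : Eucl 4 →L[ℝ] Eucl 3 × ℝ) := by
      rw [mfderiv_eq_fderiv, hL2.fderiv]
    have h4 : (mfderiv (𝓡 4) (𝓡 3)
        (fun y : Eucl 4 => (chartAt (Eucl 3) q).symm ((euclSnoc 3).symm y).1) y :
          Eucl 4 →L[ℝ] Eucl 3)
        = (mfderiv (𝓡 3) (𝓡 3) (chartAt (Eucl 3) q).symm ((euclSnoc 3).symm y).1 :
          Eucl 3 →L[ℝ] Eucl 3).comp
        ((ContinuousLinearMap.fst ℝ _ _).comp
          ((euclSnoc 3).symm : Eucl 4 →L[ℝ] Eucl 3 × ℝ)) := by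
      refine (mfderiv_comp y (g := (chartAt (Eucl 3) q).symm)
        (f := fun y => ((euclSnoc 3).symm y).1) (Geom.mdifferentiableAt_symm hc hy1)
        hL1.differentiableAt.mdifferentiableAt).trans ?_
      rw [mfderiv_eq_fderiv, hL1.fderiv]
      rfl
    exact congrArg₂ ContinuousLinearMap.prod h4 h3
  have h5 : (mfderiv (𝓡 4) (𝓡 4) (A.prodChart q).symm y : Eucl 4 →L[ℝ] Eucl 4)
      = (mfderiv ((𝓡 3).prod 𝓘(ℝ, ℝ)) (𝓡 4) A.φ (g y) : Eucl 3 × ℝ →L[ℝ] Eucl 4).comp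
        (mfderiv (𝓡 4) ((𝓡 3).prod 𝓘(ℝ, ℝ)) g y : Eucl 4 →L[ℝ] Eucl 3 × ℝ) := by
    rw [h1, mfderiv_comp y (g := A.φ) (f := g) (A.mdifferentiableAt_φ hy2) hgd]
  rw [h2] at h5
  exact congrArg (fun L : Eucl 4 →L[ℝ] Eucl 4 => L v) h5

/-- The metric in the product chart. -/
theorem pull_metric_prodChart_symm {y : Eucl 4} (hy : y ∈ (A.prodChart q).target) (v w : Eucl 4) :
    Geom.pull (𝓡 4) (Geom.metric (d := 4) (M := M)) (A.prodChart q).symm y v w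
      = ((euclSnoc 3).symm v).2 * ((euclSnoc 3).symm w).2
        + ((euclSnoc 3).symm y).2 ^ 2 * Geom.pull (𝓡 3)
          (fun n v w => A.a ((euclSnoc 3).symm y).2 n v w) (chartAt (Eucl 3) q).symm
          ((euclSnoc 3).symm y).1 ((euclSnoc 3).symm v).1 ((euclSnoc 3).symm w).1
        + Geom.pull (𝓡 3)
          (fun n v w => A.h ((euclSnoc 3).symm y).2 n v w) (chartAt (Eucl 3) q).symm
          ((euclSnoc 3).symm y).1 ((euclSnoc 3).symm v).1 ((euclSnoc 3).symm w).1 := by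
  refine (Geom.apply_congr (T := Geom.metric (d := 4) (M := M)) rfl
    (A.mfderiv_prodChart_symm hy v) (A.mfderiv_prodChart_symm hy w)).trans ?_
  exact A.metric_eq _ _ (A.mem_prodChart_target.1 hy).2 _ _ _ _

/-- The components `ρ² a + h` of the slice metrics. -/
noncomputable def sliceComps (q : N) (ρ : ℝ) (z : Eucl 3) : Matrix (Fin 3) (Fin 3) ℝ :=
  ρ ^ 2 • Geom.comps (fun n v w => A.a ρ n v w) (chartAt (Eucl 3) q) z
    + Geom.comps (fun n v w => A.h ρ n v w) (chartAt (Eucl 3) q) z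

theorem metricMat_prodChart_castSucc {y : Eucl 4} (hy : y ∈ (A.prodChart q).target)
    (i j : Fin 3) : Geom.metricMat (A.prodChart q) y i.castSucc j.castSucc
      = A.sliceComps q ((euclSnoc 3).symm y).2 ((euclSnoc 3).symm y).1 i j := by
  refine (A.pull_metric_prodChart_symm hy _ _).trans ?_
  rw [euclSnoc_single_castSucc, euclSnoc_single_castSucc]
  simp [sliceComps, Geom.comps_apply]

theorem metricMat_prodChart_last {y : Eucl 4} (hy : y ∈ (A.prodChart q).target) (i : Fin 4) :
    Geom.metricMat (A.prodChart q) y i (Fin.last 3) = if i = Fin.last 3 then 1 else 0 := by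
  refine (A.pull_metric_prodChart_symm hy _ _).trans ?_
  refine Fin.lastCases ?_ (fun i => ?_) i
  · rw [euclSnoc_single_last, Geom.pull_zero_right, Geom.pull_zero_right]; simp
  · rw [euclSnoc_single_last, euclSnoc_single_castSucc, Geom.pull_zero_right,
      Geom.pull_zero_right, if_neg (Fin.castSucc_lt_last i).ne]
    simp

variable [IsContMDiffRiemannianBundle (𝓡 4) ∞ (Eucl 4) (fun x : M => TangentSpace (𝓡 4) x)]

/-- The summand `dρ²` without mixed terms makes `∂_ρ` the unit normal of the slices, so the Riccati
theory applies with `κ` the last index. -/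
theorem isNormalMetricOn_prodChart :
    Coord.IsNormalMetricOn (Geom.metricMat (A.prodChart q)) (Fin.last 3) (A.prodChart q).target :=
  { Geom.isMetricOn_metricMat A.prodChart_mem_maximalAtlas with
    normal := fun _ hy => A.metricMat_prodChart_last hy }

/-- The radial row is that of the identity, so the volume density of `M` equals that of the slice.
-/
theorem det_metricMat_prodChart {y : Eucl 4} (hy : y ∈ (A.prodChart q).target) :
    (Geom.metricMat (A.prodChart q) y).det
      = (A.sliceComps q ((euclSnoc 3).symm y).2 ((euclSnoc 3).symm y).1).det := by
  rw [Matrix.det_eq_of_last_row]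
  · congr 1
    ext i j
    exact A.metricMat_prodChart_castSucc hy i j
  · intro j
    rw [A.isNormalMetricOn_prodChart.symm hy]
    exact A.metricMat_prodChart_last hy j

end ALFStructure

/-! ### Volume growth of slices and shells. -/

namespace Geom

/-- A compact manifold is covered by finitely many compact subsets of charts. -/
theorem exists_finite_compact_cover (d : ℕ) (X : Type*) [TopologicalSpace X]
    [ChartedSpace (Eucl d) X] [CompactSpace X] : ∃ (t : Finset X) (Q : X → Set (Eucl d)),
      (∀ q, IsCompact (Q q)) ∧ (∀ q, Q q ⊆ (chartAt (Eucl d) q).target) ∧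
      (univ : Set X) ⊆ ⋃ q ∈ t, (chartAt (Eucl d) q).symm '' Q q := by
  have h1 : ∀ q : X, ∃ r > 0,
      Metric.closedBall (chartAt (Eucl d) q q) r ⊆ (chartAt (Eucl d) q).target := fun q =>
    Metric.nhds_basis_closedBall.mem_iff.1 ((chartAt (Eucl d) q).open_target.mem_nhds
      ((chartAt (Eucl d) q).map_source (mem_chart_source _ q)))
  choose r hr hr2 using h1
  have h2 : ∀ q : X, (chartAt (Eucl d) q).source ∩ chartAt (Eucl d) q ⁻¹'
      Metric.ball (chartAt (Eucl d) q q) (r q) ∈ 𝓝 q := fun q =>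
    ((chartAt (Eucl d) q).isOpen_inter_preimage Metric.isOpen_ball).mem_nhds
      ⟨mem_chart_source _ q, Metric.mem_ball_self (hr q)⟩
  obtain ⟨t, -, ht⟩ := isCompact_univ.elim_nhds_subcover _ fun q _ => h2 q
  refine ⟨t, _, fun q => isCompact_closedBall _ _, hr2, ht.trans (iUnion₂_mono fun q _ => ?_)⟩
  rintro z ⟨hz, hz'⟩
  exact ⟨_, Metric.ball_subset_closedBall hz', (chartAt (Eucl d) q).left_inv hz⟩

/-- Polarization: `4 T(v, w)` is the difference of the diagonal values at `v + w` and `v - w`, and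
the parallelogram law evaluates the sum of the corresponding values of `g`. -/
theorem abs_le_of_abs_diag_le {V : Type*} [AddCommGroup V] [Module ℝ V]
    {T g : V →ₗ[ℝ] V →ₗ[ℝ] ℝ} (hT : ∀ v w, T v w = T w v) (hg : ∀ v w, g v w = g w v)
    (hg0 : ∀ v, 0 ≤ g v v) {C : ℝ} (h : ∀ v, |T v v| ≤ C * g v v) (v w : V) :
    |T v w| ≤ |C| * (g v v + g w w) := by
  have h' : ∀ v, |T v v| ≤ |C| * g v v := fun v =>
    (h v).trans (mul_le_mul_of_nonneg_right (le_abs_self C) (hg0 v))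
  have h1 := h' (v + w)
  have h2 := h' (v - w)
  simp only [map_add, map_sub, LinearMap.add_apply, LinearMap.sub_apply, hT w v, hg w v] at h1 h2
  rw [abs_le] at h1 h2 ⊢
  constructor <;> nlinarith [h1.1, h1.2, h2.1, h2.2]

end Geom

section BoundedFamily

variable {N : Type*} [TopologicalSpace N] [ChartedSpace (Eucl 3) N] [IsManifold (𝓡 3) ∞ N]

/-- The components of a bounded family are bounded on compact subsets of charts. -/
theorem IsBoundedFamily.exists_comps_le
    {T : ℝ → ∀ n : N, TangentSpace (𝓡 3) n →L[ℝ] TangentSpace (𝓡 3) n →L[ℝ] ℝ}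
    (hb : IsBoundedFamily T) (hs : IsSmoothSymmFamily T) (q : N) {Q : Set (Eucl 3)}
    (hQ : IsCompact Q) (hQt : Q ⊆ (chartAt (Eucl 3) q).target) :
    ∃ C, 0 ≤ C ∧ ∀ᶠ ρ in atTop, ∀ z ∈ Q, ∀ i j,
      |Geom.comps (fun n v w => T ρ n v w) (chartAt (Eucl 3) q) z i j| ≤ C := by
  obtain ⟨gN, C, ρ₀, hC⟩ := hb
  -- Installing `gN` as the metric of `N` makes its component functions smooth, hence bounded on the
  -- compact set `Q`.
  let _ : RiemannianBundle (fun n : N => TangentSpace (𝓡 3) n) := ⟨gN.toRiemannianMetric⟩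
  have hm := Geom.isMetricOn_metricMat (M := N)
    (IsManifold.chart_mem_maximalAtlas (I := 𝓡 3) (n := ∞) q)
  have h1 : ∀ i, ∃ K, ∀ z ∈ Q, Geom.metricMat (M := N) (chartAt (Eucl 3) q) z i i ≤ K :=
    fun i => by
      obtain ⟨K, hK⟩ := hQ.bddAbove_image ((hm.smooth i i).continuousOn.mono hQt)
      exact ⟨K, fun z hz => hK (mem_image_of_mem _ hz)⟩
  choose K hK using h1
  refine ⟨|C| * ∑ i, (|K i| + |K i|), by positivity, ?_⟩
  filter_upwards [eventually_ge_atTop ρ₀, eventually_gt_atTop 0] with ρ hρ hρ0 z hz i j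
  set n := (chartAt (Eucl 3) q).symm z
  let T' : TangentSpace (𝓡 3) n →ₗ[ℝ] TangentSpace (𝓡 3) n →ₗ[ℝ] ℝ :=
    LinearMap.mk₂ ℝ (fun v w => T ρ n v w) (by simp) (by simp) (by simp) (by simp)
  let g' : TangentSpace (𝓡 3) n →ₗ[ℝ] TangentSpace (𝓡 3) n →ₗ[ℝ] ℝ :=
    LinearMap.mk₂ ℝ (fun v w => gN.inner n v w) (by simp) (by simp) (by simp) (by simp)
  have h2 := Geom.abs_le_of_abs_diag_le (T := T') (g := g') (hs.symm ρ hρ0 n) (gN.symm n)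
    (fun v => by
      by_cases hv : v = 0
      · simp [hv]
      · exact (gN.pos n v hv).le) (hC ρ hρ n) (Geom.coordVec (chartAt (Eucl 3) q) z i)
    (Geom.coordVec (chartAt (Eucl 3) q) z j)
  refine h2.trans (mul_le_mul_of_nonneg_left ?_ (abs_nonneg C))
  rw [Finset.sum_add_distrib]
  refine add_le_add ((hK i z hz).trans ((le_abs_self _).trans ?_))
    ((hK j z hz).trans ((le_abs_self _).trans ?_))
  · exact Finset.single_le_sum (f := fun i => |K i|) (fun _ _ => abs_nonneg _) (Finset.mem_univ i)
  · exact Finset.single_le_sum (f := fun i => |K i|) (fun _ _ => abs_nonneg _) (Finset.mem_univ j)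

end BoundedFamily

namespace ALFStructure

variable {M N B : Type*}
  [TopologicalSpace M] [ChartedSpace (Eucl 4) M] [IsManifold (𝓡 4) ∞ M]
  [RiemannianBundle (fun x : M => TangentSpace (𝓡 4) x)]
  [TopologicalSpace N] [ChartedSpace (Eucl 3) N] [IsManifold (𝓡 3) ∞ N]
  [TopologicalSpace B] [ChartedSpace (Eucl 2) B] [IsManifold (𝓡 2) ∞ B]
  (A : ALFStructure M N B)

/-- Each entry of `ρ² a + h` is `O(ρ²)`, so the `3 × 3` determinant is `O(ρ⁶)`; the `6` counts its
permutations. -/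
theorem exists_sqrt_det_sliceComps_le (q : N) {Q : Set (Eucl 3)} (hQ : IsCompact Q)
    (hQt : Q ⊆ (chartAt (Eucl 3) q).target) :
    ∃ C, 0 ≤ C ∧ ∀ᶠ ρ in atTop, ∀ z ∈ Q, √(A.sliceComps q ρ z).det ≤ C * ρ ^ 3 := by
  obtain ⟨Ca, hCa, ha⟩ := A.a_bounded.exists_comps_le A.a_smooth q hQ hQt
  obtain ⟨Ch, hCh, hh⟩ := A.h_bounded.exists_comps_le A.h_smooth q hQ hQt
  refine ⟨√(6 * (Ca + Ch) ^ 3), Real.sqrt_nonneg _, ?_⟩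
  filter_upwards [ha, hh, eventually_ge_atTop 1] with ρ ha hh hρ z hz
  have h1 : ∀ i j, |A.sliceComps q ρ z i j| ≤ (Ca + Ch) * ρ ^ 2 := fun i j => by
    simp only [sliceComps, Matrix.add_apply, Matrix.smul_apply, smul_eq_mul]
    refine (abs_add_le _ _).trans ?_
    rw [abs_mul, abs_of_nonneg (sq_nonneg ρ)]
    nlinarith [ha z hz i j, hh z hz i j, mul_le_mul_of_nonneg_left (ha z hz i j) (sq_nonneg ρ),
      one_le_pow₀ hρ (n := 2)]
  have h2 := Matrix.det_le (abv := AbsoluteValue.abs) h1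
  simp only [Fintype.card_fin, AbsoluteValue.abs_apply, nsmul_eq_mul] at h2
  have h3 : (Nat.factorial 3 : ℝ) = 6 := by norm_num [Nat.factorial]
  refine Real.sqrt_le_iff.2 ⟨by positivity, ?_⟩
  rw [mul_pow, Real.sq_sqrt (by positivity)]
  refine (le_abs_self _).trans (h2.trans (le_of_eq ?_))
  rw [h3]; ring

theorem sliceDeriv_eq {r : ℝ} (hr : 0 < r) (n : N) (v : TangentSpace (𝓡 3) n) :
    A.sliceDeriv r n v
      = mfderiv ((𝓡 3).prod 𝓘(ℝ, ℝ)) (𝓡 4) A.φ (n, r) ((v, 0) : Eucl 3 × ℝ) := by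
  have h1 : MDifferentiableAt (𝓡 3) ((𝓡 3).prod 𝓘(ℝ, ℝ)) (fun n : N => (n, r)) n :=
    mdifferentiableAt_id.prodMk mdifferentiableAt_const
  have h2 : A.slice r = A.φ ∘ fun n => (n, r) := rfl
  rw [sliceDeriv, h2, mfderiv_comp n (A.mdifferentiableAt_φ hr) h1, mfderiv_prod_left]
  rfl

theorem sliceMetric_eq {r : ℝ} (hr : 0 < r) (n : N) (v w : TangentSpace (𝓡 3) n) :
    A.sliceMetric r n v w = r ^ 2 * A.a r n v w + A.h r n v w := by
  rw [sliceMetric, A.sliceDeriv_eq hr, A.sliceDeriv_eq hr]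
  refine (A.metric_eq n r hr v w 0 0).trans ?_
  ring

theorem isBilin_sliceMetric {r : ℝ} (hr : 0 < r) : Geom.IsBilin (A.sliceMetric r) := fun n =>
  ⟨LinearMap.mk₂ ℝ (fun v w => r ^ 2 * A.a r n v w + A.h r n v w)
    (fun _ _ _ => by simp only [map_add, add_apply]; ring)
    (fun _ _ _ => by simp only [map_smul, smul_apply, smul_eq_mul]; ring)
    (fun _ _ _ => by simp only [map_add]; ring)
    (fun _ _ _ => by simp only [map_smul, smul_eq_mul]; ring),
    fun v w => by rw [A.sliceMetric_eq hr, LinearMap.mk₂_apply]⟩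

theorem comps_sliceMetric {r : ℝ} (hr : 0 < r) (q : N) (z : Eucl 3) :
    Geom.comps (A.sliceMetric r) (chartAt (Eucl 3) q) z = A.sliceComps q r z := by
  ext i j
  exact A.sliceMetric_eq hr _ _ _

variable [CompactSpace N]

theorem isCompact_shell {r r' : ℝ} (hr : 0 < r) : IsCompact (A.φ '' (univ ×ˢ Icc r r')) :=
  (isCompact_univ.prod isCompact_Icc).image_of_continuousOn
    (A.φ.continuousOn.mono fun _ hp => A.mem_source (hr.trans_le hp.2.1))

section SliceVolume

variable [T2Space N] [Nonempty N] [MeasurableSpace N] [BorelSpace N]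

theorem exists_volume_slice_le : ∃ C, 0 ≤ C ∧ ∀ᶠ r in atTop,
    Geom.volumeMeasure (A.sliceMetric r) univ ≤ ENNReal.ofReal (C * r ^ 3) := by
  obtain ⟨t, Q, hQ, hQt, hcov⟩ := Geom.exists_finite_compact_cover 3 N
  have h1 := fun q => A.exists_sqrt_det_sliceComps_le q (hQ q) (hQt q)
  choose C hC0 hC using h1
  refine ⟨∑ q ∈ t, C q * (volume (Q q)).toReal, Finset.sum_nonneg fun q _ =>
    mul_nonneg (hC0 q) ENNReal.toReal_nonneg, ?_⟩
  filter_upwards [(Filter.eventually_all_finset t).2 fun q _ => hC q, eventually_gt_atTop 0]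
    with r hr hr0
  calc _ ≤ Geom.volumeMeasure (A.sliceMetric r) (⋃ q ∈ t, (chartAt (Eucl 3) q).symm '' Q q) :=
        measure_mono hcov
    _ ≤ ∑ q ∈ t, Geom.volumeMeasure (A.sliceMetric r) ((chartAt (Eucl 3) q).symm '' Q q) :=
        measure_biUnion_finset_le _ _
    _ ≤ ∑ q ∈ t, ENNReal.ofReal (C q * (volume (Q q)).toReal * r ^ 3) := by
        refine Finset.sum_le_sum fun q hq => ?_
        have h2 : IsCompact ((chartAt (Eucl 3) q).symm '' Q q) :=
          (hQ q).image_of_continuousOn ((chartAt (Eucl 3) q).continuousOn_symm.mono (hQt q))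
        refine (Geom.volumeMeasure_le (A.isBilin_sliceMetric hr0)
          (IsManifold.chart_mem_maximalAtlas q) (hQt q) h2.isClosed.measurableSet subset_rfl
          (fun z hz => (congrArg (fun D : Matrix (Fin 3) (Fin 3) ℝ => √D.det)
            (A.comps_sliceMetric hr0 q z)).le.trans (hr q hq z hz))).trans ?_
        rw [← ENNReal.ofReal_toReal (hQ q).measure_lt_top.ne,
          ← ENNReal.ofReal_mul (mul_nonneg (hC0 q) (by positivity)),
          ENNReal.toReal_ofReal ENNReal.toReal_nonneg]
        exact ENNReal.ofReal_le_ofReal (le_of_eq (by ring))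
    _ = _ := by
        rw [← ENNReal.ofReal_sum_of_nonneg fun q _ => mul_nonneg
          (mul_nonneg (hC0 q) ENNReal.toReal_nonneg) (by positivity), Finset.sum_mul]

end SliceVolume

variable [T2Space M] [MeasurableSpace M] [BorelSpace M] [SigmaCompactSpace M] [Nonempty M]
  [IsContMDiffRiemannianBundle (𝓡 4) ∞ (Eucl 4) (fun x : M => TangentSpace (𝓡 4) x)]

/-- The factor `ε` is needed to compensate the slope `1 / ε` of the cutoff. -/
theorem exists_volume_shell_le : ∃ C, 0 ≤ C ∧ ∀ᶠ r in atTop, ∀ ε ∈ Ioc (0 : ℝ) 1,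
    Geom.volumeMeasure (Geom.metric (d := 4) (M := M)) (A.φ '' (univ ×ˢ Icc r (r + ε)))
      ≤ ENNReal.ofReal (C * r ^ 3 * ε) := by
  obtain ⟨t, Q, hQ, hQt, hcov⟩ := Geom.exists_finite_compact_cover 3 N
  obtain ⟨κ, hκ⟩ := exists_volume_image_euclSnoc 3
  have h1 := fun q => A.exists_sqrt_det_sliceComps_le q (hQ q) (hQt q)
  choose C hC0 hC using h1
  refine ⟨∑ q ∈ t, 8 * C q * κ * (volume (Q q)).toReal, Finset.sum_nonneg fun q _ =>
    mul_nonneg (mul_nonneg (mul_nonneg (by norm_num) (hC0 q)) κ.coe_nonneg) ENNReal.toReal_nonneg, ?_⟩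
  filter_upwards [eventually_forall_ge_atTop.2 ((Filter.eventually_all_finset t).2
    fun q _ => hC q), eventually_ge_atTop 1] with r hr hr1 ε hε
  have hr0 : 0 < r := by linarith
  set P : N → Set (Eucl 4) := fun q => euclSnoc 3 '' (Q q ×ˢ Icc r (r + ε)) with hP
  have hPt : ∀ q, P q ⊆ (A.prodChart q).target := by
    rintro q _ ⟨p, hp, rfl⟩
    rw [A.mem_prodChart_target, ContinuousLinearEquiv.symm_apply_apply]
    exact ⟨hQt q hp.1, hr0.trans_le hp.2.1⟩
  have hPc : ∀ q, IsCompact ((A.prodChart q).symm '' P q) := fun q =>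
    (((hQ q).prod isCompact_Icc).image (euclSnoc 3).continuous).image_of_continuousOn
      ((A.prodChart q).continuousOn_symm.mono (hPt q))
  have hcov' : A.φ '' (univ ×ˢ Icc r (r + ε)) ⊆ ⋃ q ∈ t, (A.prodChart q).symm '' P q := by
    rintro _ ⟨⟨n, ρ⟩, hp, rfl⟩
    obtain ⟨q, hq, z, hz, hzn⟩ := mem_iUnion₂.1 (hcov (mem_univ n))
    refine mem_iUnion₂.2 ⟨q, hq, _, ⟨(z, ρ), ⟨hz, hp.2⟩, rfl⟩, ?_⟩
    rw [A.prodChart_symm_apply, ContinuousLinearEquiv.symm_apply_apply, hzn]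
  calc _ ≤ Geom.volumeMeasure (Geom.metric (d := 4) (M := M))
          (⋃ q ∈ t, (A.prodChart q).symm '' P q) := measure_mono hcov'
    _ ≤ ∑ q ∈ t, Geom.volumeMeasure (Geom.metric (d := 4) (M := M))
          ((A.prodChart q).symm '' P q) := measure_biUnion_finset_le _ _
    _ ≤ ∑ q ∈ t, ENNReal.ofReal (8 * C q * κ * (volume (Q q)).toReal * r ^ 3 * ε) := by
        refine Finset.sum_le_sum fun q hq => ?_
        refine (Geom.volumeMeasure_le Geom.isBilin_metric A.prodChart_mem_maximalAtlas (hPt q)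
          (hPc q).isClosed.measurableSet subset_rfl (C := 8 * C q * r ^ 3) ?_).trans ?_
        · rintro y hy
          have hyt := hPt q hy
          obtain ⟨⟨z, ρ⟩, ⟨hz, hρ⟩, rfl⟩ := hy
          have h2 := A.det_metricMat_prodChart hyt
          rw [ContinuousLinearEquiv.symm_apply_apply] at h2
          refine (congrArg Real.sqrt h2).le.trans ((hr ρ hρ.1 q hq z hz).trans ?_)
          -- Since `ε ≤ 1 ≤ r`, radii in the shell are at most `2 * r`; this is the origin of the
          -- `8`.
          have h3 : ρ ^ 3 ≤ (2 * r) ^ 3 :=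
            pow_le_pow_left₀ (hr0.le.trans hρ.1) (by linarith [hρ.2, hε.2]) 3
          calc C q * ρ ^ 3 ≤ C q * (2 * r) ^ 3 := mul_le_mul_of_nonneg_left h3 (hC0 q)
            _ = _ := by ring
        · rw [hκ, ← ENNReal.ofReal_toReal (hQ q).measure_lt_top.ne, Real.volume_Icc,
            ← ENNReal.ofReal_coe_nnreal, ← ENNReal.ofReal_mul ENNReal.toReal_nonneg,
            ← ENNReal.ofReal_mul κ.coe_nonneg,
            ← ENNReal.ofReal_mul (mul_nonneg (mul_nonneg (by norm_num) (hC0 q)) (by positivity)),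
            ENNReal.toReal_ofReal ENNReal.toReal_nonneg]
          exact ENNReal.ofReal_le_ofReal (le_of_eq (by ring))
    _ = _ := by
        rw [← ENNReal.ofReal_sum_of_nonneg fun q _ => mul_nonneg (mul_nonneg (mul_nonneg
          (mul_nonneg (mul_nonneg (by norm_num) (hC0 q)) κ.coe_nonneg) ENNReal.toReal_nonneg)
          (by positivity)) hε.1.le, Finset.sum_mul, Finset.sum_mul]

end ALFStructure

/-! ### Metric geometry of the end: compact truncations and closed outer parts. -/

namespace ALFStructure

section Radius

variable {M N B : Type*}
  [TopologicalSpace M] [ChartedSpace (Eucl 4) M] [IsManifold (𝓡 4) ∞ M]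
  [RiemannianBundle (fun x : M => TangentSpace (𝓡 4) x)]
  [TopologicalSpace N] [ChartedSpace (Eucl 3) N] [IsManifold (𝓡 3) ∞ N]
  [TopologicalSpace B] [ChartedSpace (Eucl 2) B] [IsManifold (𝓡 2) ∞ B]
  (A : ALFStructure M N B)

/-- The radial coordinate on the end. -/
noncomputable def radius (x : M) : ℝ := (A.φ.symm x).2

theorem radius_φ {n : N} {ρ : ℝ} (hρ : 0 < ρ) : A.radius (A.φ (n, ρ)) = ρ := by
  rw [radius, A.φ.left_inv (A.mem_source hρ)]

theorem φ_mem_target {n : N} {ρ : ℝ} (hρ : 0 < ρ) : A.φ (n, ρ) ∈ A.φ.target :=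
  A.φ.map_source (A.mem_source hρ)

theorem radius_pos {x : M} (hx : x ∈ A.φ.target) : 0 < A.radius x := by
  have := A.φ.map_target hx
  rw [A.φ_source] at this
  exact this.2

theorem exists_eq_φ {x : M} (hx : x ∈ A.φ.target) : ∃ n, x = A.φ (n, A.radius x) :=
  ⟨(A.φ.symm x).1, (A.φ.right_inv hx).symm⟩

theorem contMDiffOn_radius : ContMDiffOn (𝓡 4) 𝓘(ℝ, ℝ) ∞ A.radius A.φ.target :=
  contMDiff_snd.comp_contMDiffOn A.φ_symm_smooth

theorem norm_mfderiv_φ_sq {n : N} {ρ : ℝ} (hρ : 0 < ρ) (v : TangentSpace (𝓡 3) n) (t : ℝ) :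
    ‖(mfderiv ((𝓡 3).prod 𝓘(ℝ, ℝ)) (𝓡 4) A.φ (n, ρ) ((v, t) : Eucl 3 × ℝ) :
      TangentSpace (𝓡 4) (A.φ (n, ρ)))‖ ^ 2 = t ^ 2 + ρ ^ 2 * A.a ρ n v v + A.h ρ n v v := by
  rw [← real_inner_self_eq_norm_sq]
  refine (A.metric_eq n ρ hρ v v t t).trans ?_
  ring

/-- The sum is the squared length of a tangent vector of the slice. Positivity of `h` alone is
assumed only along the fibres. -/
theorem slice_form_nonneg {n : N} {ρ : ℝ} (hρ : 0 < ρ) (v : TangentSpace (𝓡 3) n) :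
    0 ≤ ρ ^ 2 * A.a ρ n v v + A.h ρ n v v := by
  have h := A.norm_mfderiv_φ_sq hρ v 0
  nlinarith [sq_nonneg ‖(mfderiv ((𝓡 3).prod 𝓘(ℝ, ℝ)) (𝓡 4) A.φ (n, ρ) ((v, 0) : Eucl 3 × ℝ) :
      TangentSpace (𝓡 4) (A.φ (n, ρ)))‖]

theorem mdifferentiable_φ : A.φ.MDifferentiable ((𝓡 3).prod 𝓘(ℝ, ℝ)) (𝓡 4) :=
  ⟨A.φ_smooth.mdifferentiableOn (by simp), A.φ_symm_smooth.mdifferentiableOn (by simp)⟩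

/-- The gradient of the radial coordinate has length at most `1`. -/
theorem norm_mfderiv_radius_le {x : M} (hx : x ∈ A.φ.target) (v : TangentSpace (𝓡 4) x) :
    @abs ℝ _ _ (mfderiv (𝓡 4) 𝓘(ℝ, ℝ) A.radius x v) ≤ ‖v‖ := by
  obtain ⟨⟨n, ρ⟩, hp, rfl⟩ : ∃ p, p ∈ A.φ.source ∧ A.φ p = x :=
    ⟨_, A.φ.map_target hx, A.φ.right_inv hx⟩
  have hρ : 0 < ρ := by rw [A.φ_source] at hp; exact hp.2
  have hl := A.φ.left_inv hp
  have h1 := A.mdifferentiable_φ.comp_symm_deriv hx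
  have h2 : ∀ p, p = (n, ρ) →
      (mfderiv ((𝓡 3).prod 𝓘(ℝ, ℝ)) (𝓡 4) A.φ p : Eucl 3 × ℝ →L[ℝ] Eucl 4)
        = mfderiv ((𝓡 3).prod 𝓘(ℝ, ℝ)) (𝓡 4) A.φ (n, ρ) := by rintro _ rfl; rfl
  set D : Eucl 4 →L[ℝ] Eucl 3 × ℝ :=
    mfderiv (𝓡 4) ((𝓡 3).prod 𝓘(ℝ, ℝ)) A.φ.symm (A.φ (n, ρ)) with hD
  have h3 : (mfderiv ((𝓡 3).prod 𝓘(ℝ, ℝ)) (𝓡 4) A.φ (n, ρ) : Eucl 3 × ℝ →L[ℝ] Eucl 4).comp D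
      = .id ℝ _ := by rw [← h2 _ hl]; exact h1
  have h4 : (mfderiv ((𝓡 3).prod 𝓘(ℝ, ℝ)) (𝓡 4) A.φ (n, ρ) ((D v).1, (D v).2) : Eucl 4) = v :=
    congrArg (fun L : Eucl 4 →L[ℝ] Eucl 4 => L v) h3
  have h5 : (mfderiv (𝓡 4) 𝓘(ℝ, ℝ) A.radius (A.φ (n, ρ)) v : ℝ) = (D v).2 := by
    have h6 : A.radius = Prod.snd ∘ A.φ.symm := rfl
    have h7 := mfderiv_comp (I := 𝓡 4) (I' := (𝓡 3).prod 𝓘(ℝ, ℝ)) (I'' := 𝓘(ℝ, ℝ)) (A.φ (n, ρ))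
      (g := (Prod.snd : N × ℝ → ℝ)) (f := A.φ.symm) mdifferentiableAt_snd
      (A.mdifferentiable_φ.mdifferentiableAt_symm hx)
    rw [mfderiv_snd] at h7
    rw [h6]
    exact congrArg (fun L : Eucl 4 →L[ℝ] ℝ => L v) h7
  have h8 := A.norm_mfderiv_φ_sq (n := n) hρ (D v).1 (D v).2
  have h9 : ‖(mfderiv ((𝓡 3).prod 𝓘(ℝ, ℝ)) (𝓡 4) A.φ (n, ρ) ((D v).1, (D v).2) :
      TangentSpace (𝓡 4) (A.φ (n, ρ)))‖ = ‖v‖ :=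
    congrArg (fun w : TangentSpace (𝓡 4) (A.φ (n, ρ)) => ‖w‖) h4
  have h10 := A.slice_form_nonneg (n := n) hρ (D v).1
  have h11 : (D v).2 ^ 2 ≤ ‖v‖ ^ 2 := by
    rw [← h9, h8]
    linarith
  exact (congrArg (fun t : ℝ => |t|) h5).le.trans (abs_le_of_sq_le_sq h11 (norm_nonneg _))

/-- The complement is the image under `φ` of an open set. -/
theorem isClosed_truncation (r : ℝ) (hr : 0 ≤ r) : IsClosed (A.truncation r) := by
  have h1 : A.truncation r = (A.φ '' (univ ×ˢ Ioi r))ᶜ := by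
    ext x
    by_cases hx : x ∈ A.φ.target
    · obtain ⟨n, hn⟩ := A.exists_eq_φ hx
      have hρ := A.radius_pos hx
      have hxK : x ∉ A.K := by rw [A.φ_target] at hx; exact hx
      simp only [truncation, mem_union, hxK, false_or, mem_compl_iff]
      constructor
      · rintro ⟨⟨m, s⟩, hs, rfl⟩ ⟨⟨m', s'⟩, hs', h⟩
        have := congrArg A.radius h
        rw [A.radius_φ (hr.trans_lt hs'.2), A.radius_φ hs.2.1] at this
        exact absurd hs.2.2 (not_le.2 (this ▸ hs'.2))
      · intro h
        refine ⟨(n, A.radius x), ⟨mem_univ _, hρ, ?_⟩, hn.symm⟩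
        by_contra h'
        exact h ⟨(n, A.radius x), ⟨mem_univ _, not_le.1 h'⟩, hn.symm⟩
    · have hxK : x ∈ A.K := by rw [A.φ_target] at hx; exact not_not.1 hx
      refine iff_of_true (Or.inl hxK) ?_
      rintro ⟨⟨m', s'⟩, hs', rfl⟩
      exact hx (A.φ_mem_target (hr.trans_lt hs'.2))
  rw [h1]
  refine (A.φ.isOpen_image_of_subset_source (isOpen_univ.prod isOpen_Ioi) fun p hp =>
    A.mem_source (hr.trans_lt hp.2)).isClosed_compl

/-- The radial coordinate is `1`-Lipschitz along paths in the end. -/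
theorem enorm_radius_sub_le {γ : ℝ → M} (hγ : ContMDiff 𝓘(ℝ, ℝ) (𝓡 4) 1 γ) {a b : ℝ}
    (hab : a ≤ b) (h : ∀ τ ∈ Icc a b, γ τ ∈ A.φ.target) :
    ‖A.radius (γ b) - A.radius (γ a)‖ₑ ≤ Manifold.pathELength (𝓡 4) γ a b := by
  have h1 : ContDiffOn ℝ 1 (A.radius ∘ γ) (Icc a b) := by
    rw [← contMDiffOn_iff_contDiffOn]
    exact (A.contMDiffOn_radius.of_le (by simp)).comp hγ.contMDiffOn h
  refine (enorm_sub_le_lintegral_deriv_of_contDiffOn_Icc h1 hab).trans ?_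
  rw [Manifold.pathELength_eq_lintegral_mfderiv_Icc]
  refine setLIntegral_mono' measurableSet_Icc fun τ hτ => ?_
  have h2 := ((A.contMDiffOn_radius.contMDiffAt
      (A.φ.open_target.mem_nhds (h τ hτ))).mdifferentiableAt (by simp)).hasMFDerivAt.comp τ
      (hγ.mdifferentiableAt (by simp)).hasMFDerivAt
  have h3 : deriv (A.radius ∘ γ) τ = (mfderiv (𝓡 4) 𝓘(ℝ, ℝ) A.radius (γ τ)
      (mfderiv 𝓘(ℝ, ℝ) (𝓡 4) γ τ 1) : ℝ) := by
    rw [← fderiv_apply_one_eq_deriv, ← mfderiv_eq_fderiv, h2.mfderiv]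
    rfl
  rw [h3]
  exact enorm_le_iff_norm_le.2 (A.norm_mfderiv_radius_le (h τ hτ) _)

end Radius

section Completeness

variable {M N B : Type*}
  [MetricSpace M] [ChartedSpace (Eucl 4) M] [IsManifold (𝓡 4) ∞ M]
  [RiemannianBundle (fun x : M => TangentSpace (𝓡 4) x)] [IsRiemannianManifold (𝓡 4) M]
  [TopologicalSpace N] [ChartedSpace (Eucl 3) N] [IsManifold (𝓡 3) ∞ N]
  [TopologicalSpace B] [ChartedSpace (Eucl 2) B] [IsManifold (𝓡 2) ∞ B]
  (A : ALFStructure M N B)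

/-- Radial segments have unit speed, because the metric has radial part `dρ²`. -/
theorem dist_φ_le (n : N) {s t : ℝ} (hs : 0 < s) (hst : s ≤ t) :
    dist (A.φ (n, s)) (A.φ (n, t)) ≤ t - s := by
  have h0 : ContMDiff 𝓘(ℝ, ℝ) ((𝓡 3).prod 𝓘(ℝ, ℝ)) ∞ (fun τ : ℝ => (n, τ)) :=
    contMDiff_const.prodMk contMDiff_id
  have h1 : ContMDiffOn 𝓘(ℝ, ℝ) (𝓡 4) 1 (A.φ ∘ fun τ : ℝ => (n, τ)) (Icc s t) :=
    (A.φ_smooth.comp h0.contMDiffOn fun τ hτ => A.mem_source (hs.trans_le hτ.1)).of_le (by simp)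
  have h2 := Manifold.riemannianEDist_le_pathELength h1 (x := A.φ (n, s)) (y := A.φ (n, t))
    rfl rfl hst
  rw [← IsRiemannianManifold.out, Manifold.pathELength_eq_lintegral_mfderiv_Icc] at h2
  have h3 : ∀ τ ∈ Icc s t, ‖mfderiv 𝓘(ℝ, ℝ) (𝓡 4) (A.φ ∘ fun τ : ℝ => (n, τ)) τ 1‖ₑ = 1 := by
    intro τ hτ
    have hτ0 := hs.trans_le hτ.1
    have h4 := mfderiv_comp (I := 𝓘(ℝ, ℝ)) (I' := (𝓡 3).prod 𝓘(ℝ, ℝ)) (I'' := 𝓡 4) τ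
      (g := A.φ) (f := fun τ : ℝ => (n, τ)) (A.mdifferentiableAt_φ hτ0)
      (h0.mdifferentiableAt (by simp))
    rw [mfderiv_prod_right] at h4
    have h5 : ‖(mfderiv ((𝓡 3).prod 𝓘(ℝ, ℝ)) (𝓡 4) A.φ (n, τ) ((0, 1) : Eucl 3 × ℝ) :
      TangentSpace (𝓡 4) (A.φ (n, τ)))‖ = 1 := by
      have h6 := A.norm_mfderiv_φ_sq (n := n) hτ0 (0 : Eucl 3) 1
      have h7 := (A.a τ n (0 : Eucl 3)).map_zero
      have h8 := (A.h τ n (0 : Eucl 3)).map_zero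
      have h9 := h6.trans (congrArg₂ (fun x y : ℝ => 1 ^ 2 + τ ^ 2 * x + y) h7 h8)
      exact (pow_eq_one_iff_of_nonneg (norm_nonneg _) two_ne_zero).1 (h9.trans (by ring))
    have h10 : ‖(mfderiv 𝓘(ℝ, ℝ) (𝓡 4) (A.φ ∘ fun τ : ℝ => (n, τ)) τ 1 :
        TangentSpace (𝓡 4) (A.φ (n, τ)))‖ = 1 :=
      (congrArg (fun L : ℝ →L[ℝ] Eucl 4 => @norm (TangentSpace (𝓡 4) (A.φ (n, τ))) _ (L 1)) h4).trans h5
    rw [← ofReal_norm]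
    exact (congrArg ENNReal.ofReal h10).trans ENNReal.ofReal_one
  rw [setLIntegral_congr_fun measurableSet_Icc h3] at h2
  simp only [lintegral_const, MeasurableSet.univ, Measure.restrict_apply, univ_inter,
    Real.volume_Icc, one_mul] at h2
  rw [edist_dist] at h2
  exact (ENNReal.ofReal_le_ofReal_iff (by linarith)).1 h2

/-- Followed inwards, a radial line is Cauchy and converges by completeness. The limit cannot lie in
the end, where the radius is continuous and positive, so it lies in `K`. -/
theorem infDist_le_of_pos [CompleteSpace M] (n : N) {s : ℝ} (hs : 0 < s) :
    ∃ p ∈ A.K, dist (A.φ (n, s)) p ≤ s := by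
  let u : ℕ → ℝ := fun k => 1 / ((k : ℝ) + 1)
  have hu0 : ∀ k, 0 < u k := fun k => by positivity
  have hu : Tendsto u atTop (𝓝 0) := tendsto_one_div_add_atTop_nhds_zero_nat
  have hanti : Antitone u := fun k l hkl => one_div_le_one_div_of_le (by positivity) (by gcongr)
  have hcau : CauchySeq fun k => A.φ (n, u k) := by
    refine cauchySeq_of_le_tendsto_0 u (fun k l N hk hl => ?_) hu
    rcases le_total (u k) (u l) with h | h
    · exact (A.dist_φ_le n (hu0 k) h).trans (by linarith [hanti hl, hu0 k])
    · rw [dist_comm]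
      exact (A.dist_φ_le n (hu0 l) h).trans (by linarith [hanti hk, hu0 l])
  obtain ⟨p, hp⟩ := cauchySeq_tendsto_of_complete hcau
  refine ⟨p, ?_, ?_⟩
  · by_contra hpK
    have hpt : p ∈ A.φ.target := by rw [A.φ_target]; exact hpK
    have h1 := ((A.contMDiffOn_radius.continuousOn.continuousAt
      (A.φ.open_target.mem_nhds hpt)).tendsto).comp hp
    have h2 : A.radius ∘ (fun k => A.φ (n, u k)) = u := funext fun k => A.radius_φ (hu0 k)
    rw [h2] at h1
    exact (A.radius_pos hpt).ne' (tendsto_nhds_unique h1 hu)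
  · refine le_of_tendsto (tendsto_const_nhds.dist hp) ?_
    filter_upwards [hu.eventually (gt_mem_nhds hs)] with k hk
    rw [dist_comm]
    exact (A.dist_φ_le n (hu0 k) hk.le).trans (by linarith [hu0 k])

/-- The set is closed, so total boundedness suffices. Points of radius at most `ε / 2` lie within `ε
/ 2` of `K`, and the remaining points form the continuous image of a compact product. -/
theorem isCompact_truncation [CompleteSpace M] [CompactSpace N] {r : ℝ} (hr : 0 ≤ r) :
    IsCompact (A.truncation r) := by
  refine isCompact_iff_totallyBounded_isComplete.2
    ⟨?_, (A.isClosed_truncation r hr).isComplete⟩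
  rw [Metric.totallyBounded_iff]
  intro ε hε
  obtain ⟨t, ht, htK⟩ := Metric.totallyBounded_iff.1 A.isCompact_K.totallyBounded (ε / 2)
    (by positivity)
  obtain ⟨t', ht', htS⟩ := Metric.totallyBounded_iff.1
    (A.isCompact_shell (r := ε / 2) (r' := r) (by positivity)).totallyBounded ε hε
  have hKt : A.K ⊆ ⋃ y ∈ t, Metric.ball y ε :=
    htK.trans (iUnion₂_mono fun y _ => Metric.ball_subset_ball (by linarith))
  refine ⟨t ∪ t', ht.union ht', ?_⟩
  rw [biUnion_union]
  rintro x (hx | ⟨⟨n, s⟩, hs, rfl⟩)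
  · exact Or.inl (hKt hx)
  · rcases le_total s (ε / 2) with h | h
    · obtain ⟨p, hp, hps⟩ := A.infDist_le_of_pos n hs.2.1
      obtain ⟨y, hy, hyp⟩ := mem_iUnion₂.1 (htK hp)
      refine Or.inl (mem_iUnion₂.2 ⟨y, hy, ?_⟩)
      rw [Metric.mem_ball] at hyp ⊢
      linarith [dist_triangle (A.φ (n, s)) p y]
    · exact Or.inr (htS ⟨_, ⟨mem_univ _, h, hs.2.2⟩, rfl⟩)

/-- The outer part of the end stays away from the compact part. -/
theorem half_le_dist [CompactSpace N] {p : M} (hp : p ∈ A.K) (n : N) {s : ℝ} (hs : 1 ≤ s) :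
    1 / 2 ≤ dist p (A.φ (n, s)) := by
  by_contra hlt
  have hlt' : Manifold.riemannianEDist (𝓡 4) p (A.φ (n, s)) < ENNReal.ofReal (1 / 2) := by
    rw [← IsRiemannianManifold.out, edist_dist]
    exact (ENNReal.ofReal_lt_ofReal_iff (by norm_num)).2 (not_le.1 hlt)
  obtain ⟨γ, h0, h1, hγ, hlen, -, -⟩ :=
    Manifold.exists_lt_locally_constant_of_riemannianEDist_lt hlt' zero_lt_one
  set O : Set M := A.φ '' (univ ×ˢ Ioi (s - 1)) with hO
  have hOo : IsOpen O := A.φ.isOpen_image_of_subset_source (isOpen_univ.prod isOpen_Ioi)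
    fun p hp => A.mem_source (lt_of_le_of_lt (by linarith) hp.2)
  have hOt : O ⊆ A.φ.target := by
    rintro _ ⟨p, hp, rfl⟩
    exact A.φ_mem_target (lt_of_le_of_lt (by linarith) hp.2)
  have hc := hγ.continuous
  have hcl : IsCompact (Icc (0 : ℝ) 1 ∩ γ ⁻¹' Oᶜ) :=
    isCompact_Icc.inter_right (hOo.isClosed_compl.preimage hc)
  have h00 : (0 : ℝ) ∈ Icc (0 : ℝ) 1 ∩ γ ⁻¹' Oᶜ := by
    refine ⟨by simp, fun h => ?_⟩
    rw [h0] at h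
    have := hOt h
    rw [A.φ_target] at this
    exact this hp
  -- A path of length below `1 / 2` from `K` is examined after the last time `τ₀` at which it is
  -- outside the region of radius above `s - 1`.
  obtain ⟨τ₀, hτ₀, hmax⟩ := hcl.exists_isGreatest ⟨0, h00⟩
  have h1O : γ 1 ∈ O := by
    rw [h1]; exact ⟨_, ⟨mem_univ _, mem_Ioi.2 (by linarith)⟩, rfl⟩
  have hτ1 : τ₀ < 1 := lt_of_le_of_ne hτ₀.1.2 fun h => hτ₀.2 (h ▸ h1O)
  have hin : ∀ τ ∈ Ioc τ₀ 1, γ τ ∈ O := fun τ hτ => by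
    by_contra h
    exact absurd (hmax ⟨⟨hτ₀.1.1.trans hτ.1.le, hτ.2⟩, h⟩) (not_le.2 hτ.1)
  have hS := (A.isCompact_shell (r := s - 1 / 2) (r' := s + 1 / 2) (by linarith)).isClosed
  have hmem : ∀ τ ∈ Ioc τ₀ 1, γ τ ∈ A.φ '' (univ ×ˢ Icc (s - 1 / 2) (s + 1 / 2)) := by
    intro τ hτ
    have h2 := (A.enorm_radius_sub_le hγ hτ.2 fun σ hσ => hOt (hin σ ⟨hτ.1.trans_le hσ.1, hσ.2⟩)
      ).trans (Manifold.pathELength_mono (hτ₀.1.1.trans hτ.1.le) le_rfl)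
    have h3 := h2.trans_lt hlen
    rw [← ofReal_norm, ENNReal.ofReal_lt_ofReal_iff (by norm_num), h1,
      A.radius_φ (by linarith), Real.norm_eq_abs, abs_lt] at h3
    obtain ⟨m, hm⟩ := A.exists_eq_φ (hOt (hin τ hτ))
    exact ⟨(m, A.radius (γ τ)), ⟨mem_univ _, by linarith, by linarith⟩, hm.symm⟩
  -- After `τ₀` the radius stays within `1 / 2` of `s`, so the path runs in a compact, hence closed,
  -- shell. The point at `τ₀` then lies in the shell too, inside the region it was supposed to be
  -- outside of.
  have hlim : γ τ₀ ∈ A.φ '' (univ ×ˢ Icc (s - 1 / 2) (s + 1 / 2)) := by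
    have h4 : Tendsto γ (𝓝[>] τ₀) (𝓝 (γ τ₀)) := hc.continuousAt.tendsto.mono_left nhdsWithin_le_nhds
    refine hS.mem_of_tendsto h4 ?_
    filter_upwards [Ioc_mem_nhdsGT hτ1] with τ hτ using hmem τ hτ
  obtain ⟨q, hq, hq2⟩ := hlim
  exact hτ₀.2 ⟨q, ⟨mem_univ _, mem_Ioi.2 (by linarith [hq.2.1])⟩, hq2⟩

/-- In the end, closedness follows from continuity of the radius. Near a point of `K` only radii up
to `1` occur, by `half_le_dist`, and the corresponding shell is compact. -/
theorem isClosed_outer [CompactSpace N] {r : ℝ} (hr : 0 < r) :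
    IsClosed (A.φ '' (univ ×ˢ Ici r)) := by
  refine isClosed_of_closure_subset fun x hx => ?_
  by_cases hxt : x ∈ A.φ.target
  · obtain ⟨n, hn⟩ := A.exists_eq_φ hxt
    refine ⟨(n, A.radius x), ⟨mem_univ _, ?_⟩, hn.symm⟩
    have h1 := A.contMDiffOn_radius.continuousOn.continuousAt (A.φ.open_target.mem_nhds hxt)
    have h2 := mem_closure_iff_nhdsWithin_neBot.1 hx
    refine ge_of_tendsto (h1.tendsto.mono_left nhdsWithin_le_nhds) (b := r)
      (x := 𝓝[A.φ '' (univ ×ˢ Ici r)] x) ?_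
    filter_upwards [self_mem_nhdsWithin] with z hz
    obtain ⟨⟨m, s⟩, hs, rfl⟩ := hz
    rw [A.radius_φ (hr.trans_le hs.2)]
    exact hs.2
  · have hxK : x ∈ A.K := by rw [A.φ_target] at hxt; exact not_not.1 hxt
    have h1 : x ∈ closure (Metric.ball x (1 / 2) ∩ A.φ '' (univ ×ˢ Ici r)) :=
      Metric.isOpen_ball.inter_closure ⟨Metric.mem_ball_self (by norm_num), hx⟩
    have h2 : Metric.ball x (1 / 2) ∩ A.φ '' (univ ×ˢ Ici r) ⊆ A.φ '' (univ ×ˢ Icc r 1) := by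
      rintro _ ⟨hb, ⟨m, s⟩, hs, rfl⟩
      refine ⟨(m, s), ⟨mem_univ _, hs.2, ?_⟩, rfl⟩
      by_contra h
      have := A.half_le_dist hxK m (not_le.1 h).le
      rw [Metric.mem_ball, dist_comm] at hb
      linarith
    have h3 := closure_minimal h2 (A.isCompact_shell hr).isClosed h1
    exact image_mono (prod_mono subset_rfl Icc_subset_Ici_self) h3

end Completeness

end ALFStructure

/-! ### The cutoff argument for the bulk integral. -/

namespace Coord

variable {d : ℕ}

theorem IsNormalMetricOn.inv_apply {G : Eucl d → Matrix (Fin d) (Fin d) ℝ} {κ : Fin d}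
    {U : Set (Eucl d)} {y : Eucl d} (hG : IsNormalMetricOn G κ U) (hy : y ∈ U) (j : Fin d) :
    (G y)⁻¹ j κ = if j = κ then 1 else 0 := by
  have h1 : ((G y)⁻¹ * G y) j κ = (1 : Matrix (Fin d) (Fin d) ℝ) j κ := by
    rw [Matrix.nonsing_inv_mul _ (hG.isUnit_det hy)]
  rw [Matrix.mul_apply] at h1
  simpa [hG.normal y hy, Matrix.one_apply] using h1

/-- The gradient pairing with a function of the normal coordinate. -/
theorem IsNormalMetricOn.gradInner_eq {G : Eucl d → Matrix (Fin d) (Fin d) ℝ} {κ : Fin d}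
    {U : Set (Eucl d)} {y : Eucl d} (hG : IsNormalMetricOn G κ U) (hy : y ∈ U) {η : ℝ → ℝ}
    (hη : DifferentiableAt ℝ η (y κ)) (f : Eucl d → ℝ) :
    gradInner G (fun z => η (z κ)) f y = deriv η (y κ) * pd κ f y := by
  have h1 : ∀ i, pd i (fun z : Eucl d => η (z κ)) y = if i = κ then deriv η (y κ) else 0 :=
    fun i => by
      have h2 : HasFDerivAt (fun z : Eucl d => z κ) (EuclideanSpace.proj κ : Eucl d →L[ℝ] ℝ) y :=
        (EuclideanSpace.proj κ : Eucl d →L[ℝ] ℝ).hasFDerivAt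
      have h3 := hη.hasDerivAt.comp_hasFDerivAt y h2
      rw [pd]
      have h4 : (fun z : Eucl d => η (z κ)) = η ∘ fun z : Eucl d => z κ := rfl
      rw [h4, h3.fderiv]
      simp [eq_comm]
  have h5 : ∀ j, (G y)⁻¹ κ j = if j = κ then 1 else 0 := fun j =>
    (hG.inv_symm hy κ j).trans (hG.inv_apply hy j)
  simp [gradInner, h1, h5]

end Coord

namespace ALFStructure

section Decay

variable {M N B : Type*}
  [TopologicalSpace M] [ChartedSpace (Eucl 4) M] [IsManifold (𝓡 4) ∞ M]
  [RiemannianBundle (fun x : M => TangentSpace (𝓡 4) x)]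
  [IsContMDiffRiemannianBundle (𝓡 4) ∞ (Eucl 4) (fun x : M => TangentSpace (𝓡 4) x)]
  [TopologicalSpace N] [ChartedSpace (Eucl 3) N] [IsManifold (𝓡 3) ∞ N]
  [TopologicalSpace B] [ChartedSpace (Eucl 2) B] [IsManifold (𝓡 2) ∞ B]
  (A : ALFStructure M N B)

/-- The differential of the scalar curvature decays like `ρ⁻⁴`. -/
theorem exists_abs_mfderiv_scalarCurv_le : ∃ C ρ₀ : ℝ, 0 ≤ C ∧ 1 ≤ ρ₀ ∧ ∀ ρ ≥ ρ₀, ∀ (n : N)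
    (v : TangentSpace (𝓡 4) (A.φ (n, ρ))), Geom.metric (A.φ (n, ρ)) v v = 1 →
      @abs ℝ _ _ (mfderiv (𝓡 4) 𝓘(ℝ, ℝ) (Geom.scalarCurv (M := M) 4) (A.φ (n, ρ)) v)
        ≤ C * (ρ ^ 4)⁻¹ := by
  obtain ⟨C, ρ₀, -, hC⟩ := A.curvature_decay 1
  refine ⟨4 ^ 3 * |C|, max ρ₀ 1, by positivity, le_max_right _ _, fun ρ hρ n => ?_⟩
  have hρ1 : 1 ≤ ρ := (le_max_right _ _).trans hρ
  have hC' := hC ρ ((le_max_left _ _).trans hρ) n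
  generalize A.φ (n, ρ) = x at hC' ⊢
  intro v hv
  have he := IsManifold.chart_mem_maximalAtlas (I := 𝓡 4) (n := ∞) x
  have hx := mem_chart_source (Eucl 4) x
  have hG := Geom.isMetricOn_metricMat he
  have hy := (chartAt (Eucl 4) x).map_source hx
  have h1 := Geom.mfderiv_eq_sum he hx
    (Geom.contMDiff_scalarCurv.mdifferentiableAt (by simp) : MDifferentiableAt (𝓡 4) 𝓘(ℝ, ℝ)
      (Geom.scalarCurv (M := M) 4) x) v
  have h2 : ∀ k, Coord.pd k (Geom.scalarCurv (M := M) 4 ∘ (chartAt (Eucl 4) x).symm)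
      (chartAt (Eucl 4) x x)
      = Coord.pd k (Coord.scalar (Geom.metricMat (chartAt (Eucl 4) x))) (chartAt (Eucl 4) x x) :=
    fun k => Coord.pd_congr_on k (chartAt (Eucl 4) x).open_target hy
      (Geom.scalarCurv_comp_symm he)
  simp only [h2] at h1
  have h3 := hG.abs_fderiv_scalar_le hy (Geom.vecComp (chartAt (Eucl 4) x) x v)
    ((Geom.isBilin_metric.apply_eq_sum he hx v v).symm.trans hv)
  refine (congrArg (fun t : ℝ => |t|) h1).le.trans (h3.trans ?_)
  have h4 := hC' _ he hx
  push_cast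
  rw [mul_assoc]
  refine mul_le_mul_of_nonneg_left (h4.trans ?_) (by norm_num)
  exact mul_le_mul_of_nonneg_right (le_abs_self C) (by positivity)

/-- The `ρ⁻⁴` decay of `ds` for the radial direction in the product chart, the form in which it
meets the gradient of a radial cutoff. -/
theorem exists_abs_pd_scalarCurv_le : ∃ C ρ₀ : ℝ, 0 ≤ C ∧ 1 ≤ ρ₀ ∧ ∀ ρ ≥ ρ₀, ∀ n : N,
      |Coord.pd (Fin.last 3) (Geom.scalarCurv (M := M) 4 ∘ (A.prodChart n).symm)
        (A.prodChart n (A.φ (n, ρ)))| ≤ C * (ρ ^ 4)⁻¹ := by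
  obtain ⟨C, ρ₀, -, hC⟩ := A.curvature_decay 1
  refine ⟨4 ^ 3 * |C|, max ρ₀ 1, by positivity, le_max_right _ _, fun ρ hρ n => ?_⟩
  have hρ1 : 1 ≤ ρ := (le_max_right _ _).trans hρ
  have he := A.prodChart_mem_maximalAtlas (q := n)
  have hx : A.φ (n, ρ) ∈ (A.prodChart n).source :=
    (A.φ_mem_prodChart_source (by linarith)).2 (mem_chart_source _ n)
  have hG := A.isNormalMetricOn_prodChart (q := n)
  have hy := (A.prodChart n).map_source hx
  rw [Coord.pd_congr_on _ (A.prodChart n).open_target hy (Geom.scalarCurv_comp_symm he)]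
  have h3 := hG.abs_fderiv_scalar_le hy (Pi.single (Fin.last 3) 1) (by
    simp only [Pi.single_apply, mul_ite, mul_one, mul_zero, Finset.sum_ite_eq', Finset.mem_univ,
      if_true, hG.normal _ hy])
  simp only [Pi.single_apply, ite_mul, one_mul, zero_mul, Finset.sum_ite_eq', Finset.mem_univ,
    if_true] at h3
  refine h3.trans ?_
  have h4 := hC ρ ((le_max_left _ _).trans hρ) n _ he hx
  push_cast
  rw [mul_assoc]
  refine mul_le_mul_of_nonneg_left (h4.trans ?_) (by norm_num)
  exact mul_le_mul_of_nonneg_right (le_abs_self C) (by positivity)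

end Decay

section Cutoff

variable {M N B : Type*}
  [MetricSpace M] [ChartedSpace (Eucl 4) M] [IsManifold (𝓡 4) ∞ M]
  [RiemannianBundle (fun x : M => TangentSpace (𝓡 4) x)]
  [TopologicalSpace N] [ChartedSpace (Eucl 3) N] [IsManifold (𝓡 3) ∞ N]
  [TopologicalSpace B] [ChartedSpace (Eucl 2) B] [IsManifold (𝓡 2) ∞ B]
  (A : ALFStructure M N B)

open scoped Classical in
/-- The function on `M` that is `η ∘ ρ` on the end and `1` on the compact part. -/
noncomputable def radialExt (η : ℝ → ℝ) (x : M) : ℝ := if x ∈ A.K then 1 else η (A.radius x)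

variable {η : ℝ → ℝ}

theorem mem_K_iff {x : M} : x ∈ A.K ↔ x ∉ A.φ.target := by simp [A.φ_target]

theorem radialExt_φ {n : N} {ρ : ℝ} (hρ : 0 < ρ) : A.radialExt η (A.φ (n, ρ)) = η ρ := by
  rw [radialExt, if_neg (fun h => A.mem_K_iff.1 h (A.φ_mem_target hρ)), A.radius_φ hρ]

theorem radialExt_eq_one {r : ℝ} (h : ∀ t < r, η t = 1) {x : M}
    (hx : x ∉ A.φ '' (univ ×ˢ Ici r)) : A.radialExt η x = 1 := by
  by_cases hK : x ∈ A.K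
  · exact if_pos hK
  · rw [radialExt, if_neg hK]
    obtain ⟨n, hn⟩ := A.exists_eq_φ (not_not.1 fun h => hK (A.mem_K_iff.2 h))
    refine h _ (not_le.1 fun h' => hx ⟨(n, A.radius x), ⟨mem_univ _, h'⟩, hn.symm⟩)

theorem radialExt_eventuallyEq {x : M} (hx : x ∈ A.φ.target) :
    A.radialExt η =ᶠ[𝓝 x] η ∘ A.radius := by
  filter_upwards [A.φ.open_target.mem_nhds hx] with z hz
  exact if_neg fun h => A.mem_K_iff.1 h hz

theorem mem_truncation_iff {r : ℝ} {n : N} {ρ : ℝ} (hρ : 0 < ρ) :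
    A.φ (n, ρ) ∈ A.truncation r ↔ ρ ≤ r := by
  constructor
  · rintro (h | ⟨⟨m, s⟩, hs, h⟩)
    · exact absurd (A.φ_mem_target hρ) (A.mem_K_iff.1 h)
    · have := congrArg A.radius h
      rw [A.radius_φ hs.2.1, A.radius_φ hρ] at this
      exact this ▸ hs.2.2
  · exact fun h => Or.inr ⟨_, ⟨mem_univ _, hρ, h⟩, rfl⟩

theorem radialExt_eq_zero {r : ℝ} (h : ∀ t > r, η t = 0) {x : M}
    (hx : x ∉ A.truncation r) : A.radialExt η x = 0 := by
  have hK : x ∉ A.K := fun h => hx (Or.inl h)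
  obtain ⟨n, hn⟩ := A.exists_eq_φ (not_not.1 fun h => hK (A.mem_K_iff.2 h))
  have h0 := A.radius_pos (not_not.1 fun h => hK (A.mem_K_iff.2 h))
  rw [radialExt, if_neg hK]
  refine h _ (not_le.1 fun h' => hx ?_)
  rw [hn]
  exact (A.mem_truncation_iff h0).2 h'

variable [IsRiemannianManifold (𝓡 4) M] [CompactSpace N]

/-- At a point of `K` the closed outer part is avoided by a whole neighbourhood, on which the
function is constantly `1`. -/
theorem contMDiff_radialExt (hη : ContDiff ℝ ∞ η) {r : ℝ} (hr : 0 < r) (h : ∀ t < r, η t = 1) :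
    ContMDiff (𝓡 4) 𝓘(ℝ, ℝ) ∞ (A.radialExt η) := by
  intro x
  by_cases hx : x ∈ A.φ.target
  · exact ((hη.contMDiff.contMDiffAt).comp x (A.contMDiffOn_radius.contMDiffAt
      (A.φ.open_target.mem_nhds hx))).congr_of_eventuallyEq (A.radialExt_eventuallyEq hx)
  · refine (contMDiffAt_const (c := (1 : ℝ))).congr_of_eventuallyEq ?_
    have h1 : (A.φ '' (univ ×ˢ Ici r))ᶜ ∈ 𝓝 x := by
      refine (A.isClosed_outer hr).isOpen_compl.mem_nhds ?_
      rintro ⟨⟨m, s⟩, hs, rfl⟩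
      exact hx (A.φ_mem_target (hr.trans_le hs.2))
    filter_upwards [h1] with z hz
    exact A.radialExt_eq_one h hz

theorem hasCompactSupport_radialExt [CompleteSpace M] {r : ℝ} (hr : 0 < r)
    (h : ∀ t > r, η t = 0) : HasCompactSupport (A.radialExt η) :=
  HasCompactSupport.intro (A.isCompact_truncation hr.le) fun _ hx => A.radialExt_eq_zero h hx

end Cutoff

section Estimate

variable {M N B : Type*}
  [MetricSpace M] [ChartedSpace (Eucl 4) M] [IsManifold (𝓡 4) ∞ M]
  [RiemannianBundle (fun x : M => TangentSpace (𝓡 4) x)]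
  [IsContMDiffRiemannianBundle (𝓡 4) ∞ (Eucl 4) (fun x : M => TangentSpace (𝓡 4) x)]
  [IsRiemannianManifold (𝓡 4) M]
  [TopologicalSpace N] [CompactSpace N] [ChartedSpace (Eucl 3) N] [IsManifold (𝓡 3) ∞ N]
  [TopologicalSpace B] [ChartedSpace (Eucl 2) B] [IsManifold (𝓡 2) ∞ B]
  (A : ALFStructure M N B)

/-- The gradient of a radial function is `η' ∂_ρ` in the normal chart, so only the radial derivative
of `f` is seen. -/
theorem gradPair_radialExt {η : ℝ → ℝ} (hη : ContDiff ℝ ∞ η) {r : ℝ} (hr : 0 < r)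
    (h : ∀ t < r, η t = 1) {f : M → ℝ} (hf : ContMDiff (𝓡 4) 𝓘(ℝ, ℝ) ∞ f) (n : N) {ρ : ℝ}
    (hρ : 0 < ρ) : Geom.gradPair 4 (A.radialExt η) f (A.φ (n, ρ))
      = deriv η ρ * Coord.pd (Fin.last 3) (f ∘ (A.prodChart n).symm)
        (A.prodChart n (A.φ (n, ρ))) := by
  have he := A.prodChart_mem_maximalAtlas (q := n)
  have hx : A.φ (n, ρ) ∈ (A.prodChart n).source :=
    (A.φ_mem_prodChart_source hρ).2 (mem_chart_source _ n)
  have hy := (A.prodChart n).map_source hx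
  have hyl : A.prodChart n (A.φ (n, ρ)) (Fin.last 3) = ρ := by
    rw [A.prodChart_apply_φ hρ, euclSnoc_last]
  rw [Geom.gradPair_eq he hx (A.contMDiff_radialExt hη hr h) hf]
  have h1 : A.radialExt η ∘ (A.prodChart n).symm =ᶠ[𝓝 (A.prodChart n (A.φ (n, ρ)))]
      fun z => η (z (Fin.last 3)) := by
    filter_upwards [(A.prodChart n).open_target.mem_nhds hy] with z hz
    rw [Function.comp, A.prodChart_symm_apply, A.radialExt_φ (A.mem_prodChart_target.1 hz).2,
      ← euclSnoc_last ((euclSnoc 3).symm z), ContinuousLinearEquiv.apply_symm_apply]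
  rw [Coord.gradInner_congr h1 EventuallyEq.rfl, A.isNormalMetricOn_prodChart.gradInner_eq hy
    (hη.differentiable (by simp) _), hyl]

/-- A smooth step function. -/
theorem exists_cutoff : ∃ L : ℝ, 0 ≤ L ∧ ∀ (r ε : ℝ), 0 < ε → ∃ η : ℝ → ℝ, ContDiff ℝ ∞ η ∧
    (∀ t ≤ r, η t = 1) ∧ (∀ t ≥ r + ε, η t = 0) ∧ (∀ t, η t ∈ Icc (0 : ℝ) 1) ∧
    ∀ t ∈ Icc r (r + ε), |deriv η t| ≤ L / ε := by
  have h0 : ContDiff ℝ ∞ Real.smoothTransition := Real.smoothTransition.contDiff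
  obtain ⟨L, hL⟩ := isCompact_Icc.bddAbove_image (K := Icc (0 : ℝ) 1)
    (f := fun t => |deriv Real.smoothTransition t|)
    (h0.continuous_deriv (by simp)).abs.continuousOn
  refine ⟨|L|, abs_nonneg _, fun r ε hε => ⟨fun t => Real.smoothTransition (1 - (t - r) / ε),
    ?_, ?_, ?_, ?_, ?_⟩⟩
  · exact h0.comp (by fun_prop)
  · intro t ht
    refine Real.smoothTransition.one_of_one_le ?_
    have : (t - r) / ε ≤ 0 := div_nonpos_of_nonpos_of_nonneg (by linarith) hε.le
    linarith
  · intro t ht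
    refine Real.smoothTransition.zero_of_nonpos ?_
    have : 1 ≤ (t - r) / ε := (one_le_div hε).2 (by linarith)
    linarith
  · exact fun t => ⟨Real.smoothTransition.nonneg _, Real.smoothTransition.le_one _⟩
  · intro t ht
    have h1 : HasDerivAt (fun t => 1 - (t - r) / ε) (-(1 / ε)) t :=
      (((hasDerivAt_id t).sub_const r).div_const ε).const_sub 1
    have h2 := ((h0.differentiable (by simp) _).hasDerivAt).comp t h1
    have h3 : 1 - (t - r) / ε ∈ Icc (0 : ℝ) 1 := by
      have h4 : 0 ≤ (t - r) / ε := div_nonneg (by linarith [ht.1]) hε.le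
      have h5 : (t - r) / ε ≤ 1 := (div_le_one hε).2 (by linarith [ht.2])
      exact ⟨by linarith, by linarith⟩
    have h6 := hL (mem_image_of_mem _ h3)
    change |deriv (Real.smoothTransition ∘ fun t => 1 - (t - r) / ε) t| ≤ _
    rw [h2.deriv, abs_mul, abs_neg, abs_of_pos (one_div_pos.2 hε), mul_one_div]
    exact div_le_div_of_nonneg_right (h6.trans (le_abs_self L)) hε.le

variable [CompleteSpace M] [MeasurableSpace M] [BorelSpace M] [SigmaCompactSpace M] [Nonempty M]

theorem integrableOn_laplace {f : M → ℝ} (hf : ContMDiff (𝓡 4) 𝓘(ℝ, ℝ) ∞ f) {r : ℝ}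
    (hr : 0 ≤ r) : IntegrableOn (Geom.laplace 4 f) (A.truncation r)
      (Geom.volumeMeasure (Geom.metric (d := 4) (M := M))) :=
  (Geom.continuous_laplace hf).continuousOn.integrableOn_compact (A.isCompact_truncation hr)

/-- Approximating the indicator of the truncation by cutoffs of width `ε` avoids Stokes' theorem on
a domain with boundary: the gradient term is bounded independently of `ε`, and the approximation
error vanishes with `ε`. -/
theorem exists_abs_integral_laplace_le : ∃ C : ℝ, ∀ᶠ r in atTop,
    |∫ x in A.truncation r, Geom.laplace 4 (Geom.scalarCurv (M := M) 4) x
      ∂(Geom.volumeMeasure (Geom.metric (d := 4) (M := M)))| ≤ C * r⁻¹ := by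
  set μ := Geom.volumeMeasure (Geom.metric (d := 4) (M := M)) with hμ
  set s : M → ℝ := Geom.scalarCurv (M := M) 4 with hs
  have hss : ContMDiff (𝓡 4) 𝓘(ℝ, ℝ) ∞ s := Geom.contMDiff_scalarCurv
  obtain ⟨L, hL0, hL⟩ := exists_cutoff
  obtain ⟨C₁, ρ₀, hC₁, hρ₀, hds⟩ := A.exists_abs_pd_scalarCurv_le
  obtain ⟨C₂, hC₂, hvol⟩ := A.exists_volume_shell_le
  refine ⟨L * C₁ * C₂, ?_⟩
  filter_upwards [hvol, eventually_ge_atTop ρ₀] with r hvol hr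
  have hr1 : 1 ≤ r := hρ₀.trans hr
  have hr0 : 0 < r := by linarith
  -- A bound for the Laplacian of `s` on a compact set containing every shell with `ε ≤ 1`. It may
  -- depend on `r`, since `ε` tends to zero with `r` fixed.
  obtain ⟨D, hD⟩ := (A.isCompact_truncation (r := r + 1) (by linarith)).bddAbove_image
    (Geom.continuous_laplace hss).abs.continuousOn
  have key : ∀ ε ∈ Ioc (0 : ℝ) 1, |∫ x in A.truncation r, Geom.laplace 4 s x ∂μ|
      ≤ L * C₁ * C₂ * r⁻¹ + |D| * (C₂ * r ^ 3 * ε) := by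
    intro ε hε
    obtain ⟨η, hη, hη1, hη0, hηI, hηd⟩ := hL r ε hε.1
    set S := A.φ '' (univ ×ˢ Icc r (r + ε)) with hS
    have hSc : IsCompact S := A.isCompact_shell hr0
    have hSfin : μ S < ⊤ := (hvol ε hε).trans_lt ENNReal.ofReal_lt_top
    have hSr : μ.real S ≤ C₂ * r ^ 3 * ε :=
      ENNReal.toReal_le_of_le_ofReal (mul_nonneg (by positivity) hε.1.le) (hvol ε hε)
    set χ := A.radialExt η with hχ
    have hχs : ContMDiff (𝓡 4) 𝓘(ℝ, ℝ) ∞ χ := A.contMDiff_radialExt hη hr0 fun t ht => hη1 t ht.le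
    have hχc : HasCompactSupport χ :=
      A.hasCompactSupport_radialExt (r := r + ε) (by linarith [hε.1]) fun t ht => hη0 t ht.le
    -- Off the shell the cutoff is locally constant and equal to the indicator. Both the gradient
    -- term and the error are therefore supported in the shell.
    have hcase : ∀ x ∉ S, (x ∈ A.truncation r ∧ χ =ᶠ[𝓝 x] fun _ => 1) ∨
        (x ∉ A.truncation r ∧ χ =ᶠ[𝓝 x] fun _ => 0) := by
      intro x hx
      by_cases hxr : x ∈ A.φ '' (univ ×ˢ Ici r)
      · obtain ⟨⟨n, ρ⟩, hρ, rfl⟩ := hxr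
        have hρ' : r + ε < ρ := not_le.1 fun h => hx ⟨_, ⟨mem_univ _, hρ.2, h⟩, rfl⟩
        have hρ0 : 0 < ρ := hr0.trans_le hρ.2
        refine Or.inr ⟨fun h => ?_, ?_⟩
        · have := (A.mem_truncation_iff hρ0).1 h
          linarith [hε.1]
        · have h1 : A.φ (n, ρ) ∉ A.truncation (r + ε) := fun h =>
            absurd ((A.mem_truncation_iff hρ0).1 h) (not_le.2 hρ')
          filter_upwards [(A.isClosed_truncation (r + ε)
            (by linarith [hε.1])).isOpen_compl.mem_nhds h1] with z hz
          exact A.radialExt_eq_zero (fun t ht => hη0 t ht.le) hz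
      · refine Or.inl ⟨?_, ?_⟩
        · by_cases hK : x ∈ A.K
          · exact Or.inl hK
          · have hxt : x ∈ A.φ.target := not_not.1 fun h => hK (A.mem_K_iff.2 h)
            obtain ⟨n, hn⟩ := A.exists_eq_φ hxt
            rw [hn]
            refine (A.mem_truncation_iff (A.radius_pos hxt)).2 (not_lt.1 fun h => hxr ?_)
            exact ⟨(n, A.radius x), ⟨mem_univ _, h.le⟩, hn.symm⟩
        · filter_upwards [(A.isClosed_outer hr0).isOpen_compl.mem_nhds hxr] with z hz
          exact A.radialExt_eq_one (fun t ht => hη1 t ht.le) hz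
    have hχI : ∀ x, χ x ∈ Icc (0 : ℝ) 1 := fun x => by
      by_cases hK : x ∈ A.K
      · rw [hχ, radialExt, if_pos hK]; simp
      · rw [hχ, radialExt, if_neg hK]; exact hηI _
    have hi1 : Integrable (fun x => χ x * Geom.laplace 4 s x) μ :=
      (hχs.continuous.mul (Geom.continuous_laplace hss)).integrable_of_hasCompactSupport
        hχc.mul_right
    have htm : MeasurableSet (A.truncation r) := (A.isClosed_truncation r hr0.le).measurableSet
    have hi2 : Integrable ((A.truncation r).indicator (Geom.laplace 4 s)) μ :=
      (A.integrableOn_laplace hss hr0.le).integrable_indicator htm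
    have hdiff : |∫ x, χ x * Geom.laplace 4 s x
        - (A.truncation r).indicator (Geom.laplace 4 s) x ∂μ| ≤ |D| * (C₂ * r ^ 3 * ε) := by
      rw [← setIntegral_eq_integral_of_forall_compl_eq_zero (s := S)]
      · rw [← Real.norm_eq_abs]
        refine (norm_setIntegral_le_of_norm_le_const (C := |D|) hSfin fun x hx => ?_).trans
          (mul_le_mul_of_nonneg_left hSr (abs_nonneg D))
        have hxT : x ∈ A.truncation (r + 1) := by
          obtain ⟨⟨n, ρ⟩, hρ, rfl⟩ := hx
          exact (A.mem_truncation_iff (hr0.trans_le hρ.2.1)).2 (hρ.2.2.trans (by linarith [hε.2]))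
        have h1 : |Geom.laplace 4 s x| ≤ |D| := (hD (mem_image_of_mem _ hxT)).trans (le_abs_self D)
        rw [Real.norm_eq_abs]
        refine le_trans ?_ h1
        have h2 := hχI x
        by_cases hxt : x ∈ A.truncation r
        · rw [indicator_of_mem hxt, ← sub_one_mul, abs_mul]
          refine mul_le_of_le_one_left (abs_nonneg _) (abs_le.2 ⟨by linarith [h2.1], by linarith [h2.2]⟩)
        · rw [indicator_of_notMem hxt, sub_zero, abs_mul]
          refine mul_le_of_le_one_left (abs_nonneg _) (abs_le.2 ⟨by linarith [h2.1], h2.2⟩)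
      · intro x hx
        rcases hcase x hx with ⟨h1, h2⟩ | ⟨h1, h2⟩
        · rw [h2.eq_of_nhds, indicator_of_mem h1]; ring
        · rw [h2.eq_of_nhds, indicator_of_notMem h1]; ring
    -- The product `(L / ε) · C₁ r⁻⁴ · C₂ r³ ε` does not contain `ε`.
    have hgrad : |∫ x, χ x * Geom.laplace 4 s x ∂μ| ≤ L * C₁ * C₂ * r⁻¹ := by
      rw [Geom.integral_mul_laplace hχs hss hχc,
        ← setIntegral_eq_integral_of_forall_compl_eq_zero (s := S)]
      · rw [← Real.norm_eq_abs]
        refine (norm_setIntegral_le_of_norm_le_const (C := L / ε * (C₁ * (r ^ 4)⁻¹)) hSfin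
          fun x hx => ?_).trans ?_
        · obtain ⟨⟨n, ρ⟩, hρ, rfl⟩ := hx
          have hρ0 : 0 < ρ := hr0.trans_le hρ.2.1
          rw [A.gradPair_radialExt hη hr0 (fun t ht => hη1 t ht.le) hss n hρ0, norm_mul,
            Real.norm_eq_abs, Real.norm_eq_abs]
          refine mul_le_mul (hηd ρ hρ.2) ((hds ρ (hr.trans hρ.2.1) n).trans ?_) (abs_nonneg _)
            (div_nonneg hL0 hε.1.le)
          refine mul_le_mul_of_nonneg_left ?_ hC₁
          exact inv_anti₀ (by positivity) (pow_le_pow_left₀ hr0.le hρ.2.1 4)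
        · refine (mul_le_mul_of_nonneg_left hSr (mul_nonneg (div_nonneg hL0 hε.1.le)
            (by positivity))).trans (le_of_eq ?_)
          have := hε.1.ne'
          field_simp
      · intro x hx
        rcases hcase x hx with ⟨h1, h2⟩ | ⟨h1, h2⟩ <;>
          rw [Geom.gradPair_congr h2, Geom.gradPair_const]
    rw [integral_sub hi1 hi2, integral_indicator htm] at hdiff
    rw [abs_le] at hdiff hgrad ⊢
    constructor <;> linarith [hdiff.1, hdiff.2, hgrad.1, hgrad.2]
  have hlim : Tendsto (fun ε : ℝ => L * C₁ * C₂ * r⁻¹ + |D| * (C₂ * r ^ 3 * ε)) (𝓝[>] 0)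
      (𝓝 (L * C₁ * C₂ * r⁻¹)) := by
    have h1 : Continuous fun ε : ℝ => L * C₁ * C₂ * r⁻¹ + |D| * (C₂ * r ^ 3 * ε) := by fun_prop
    have h2 := h1.tendsto 0
    simp only [mul_zero, add_zero] at h2
    exact h2.mono_left nhdsWithin_le_nhds
  refine ge_of_tendsto hlim ?_
  filter_upwards [Ioc_mem_nhdsGT (zero_lt_one' ℝ)] with ε hε using key ε hε

end Estimate

end ALFStructure

/-! ### The second fundamental form of the slices. -/

theorem Coord.pd_eq_zero_of_line {d : ℕ} {f : Eucl d → ℝ} {y : Eucl d}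
    (hf : DifferentiableAt ℝ f y) (k : Fin d)
    (h : ∀ᶠ t in 𝓝 (0 : ℝ), f (y + t • EuclideanSpace.single k 1) = 0) : Coord.pd k f y = 0 := by
  rw [Coord.pd, ← hf.lineDeriv_eq_fderiv, lineDeriv]
  have h1 : (fun t : ℝ => f (y + t • EuclideanSpace.single k (1 : ℝ))) =ᶠ[𝓝 0] fun _ => 0 := h
  rw [h1.deriv_eq]
  simp

namespace ALFStructure

variable {M N B : Type*}
  [TopologicalSpace M] [ChartedSpace (Eucl 4) M] [IsManifold (𝓡 4) ∞ M]
  [RiemannianBundle (fun x : M => TangentSpace (𝓡 4) x)]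
  [TopologicalSpace N] [ChartedSpace (Eucl 3) N] [IsManifold (𝓡 3) ∞ N]
  [TopologicalSpace B] [ChartedSpace (Eucl 2) B] [IsManifold (𝓡 2) ∞ B]
  (A : ALFStructure M N B) {q : N}

/-- The tangential coordinate vectors of the product chart are tangent to the slices. -/
theorem coordVec_prodChart_castSucc {y : Eucl 4} (hy : y ∈ (A.prodChart q).target) (k : Fin 3) :
    (Geom.coordVec (A.prodChart q) y k.castSucc : Eucl 4)
      = A.sliceDeriv ((euclSnoc 3).symm y).2
        ((chartAt (Eucl 3) q).symm ((euclSnoc 3).symm y).1)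
        (Geom.coordVec (chartAt (Eucl 3) q) ((euclSnoc 3).symm y).1 k) := by
  rw [A.sliceDeriv_eq (A.mem_prodChart_target.1 hy).2]
  refine (A.mfderiv_prodChart_symm hy _).trans ?_
  rw [euclSnoc_single_castSucc]
  rfl

variable [IsContMDiffRiemannianBundle (𝓡 4) ∞ (Eucl 4) (fun x : M => TangentSpace (𝓡 4) x)]

/-- A unit normal of a slice is plus or minus the radial vector. -/
theorem exists_metric_normal_eq {y : Eucl 4} (hy : y ∈ (A.prodChart q).target)
    {ν : TangentSpace (𝓡 4) ((A.prodChart q).symm y)}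
    (h1 : Geom.metric ((A.prodChart q).symm y) ν ν = 1)
    (h2 : ∀ v, Geom.metric ((A.prodChart q).symm y) ν (A.sliceDeriv ((euclSnoc 3).symm y).2
        ((chartAt (Eucl 3) q).symm ((euclSnoc 3).symm y).1) v) = 0) :
    ∃ t : ℝ, t ^ 2 = 1 ∧ ∀ Z, Geom.metric ((A.prodChart q).symm y) Z ν
      = t * Geom.vecComp (A.prodChart q) ((A.prodChart q).symm y) Z (Fin.last 3) := by
  have he := A.prodChart_mem_maximalAtlas (q := q)
  have hx := (A.prodChart q).map_target hy
  have hG := A.isNormalMetricOn_prodChart (q := q)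
  have hr := (A.prodChart q).right_inv hy
  set u := Geom.vecComp (A.prodChart q) ((A.prodChart q).symm y) ν with hu
  have hsum : ∀ Z, Geom.metric ((A.prodChart q).symm y) Z ν
      = ∑ i, Geom.vecComp (A.prodChart q) ((A.prodChart q).symm y) Z i
        * ∑ j, Geom.metricMat (A.prodChart q) y i j * u j := fun Z => by
    rw [Geom.isBilin_metric.apply_eq_sum he hx, hr]
    simp only [Finset.mul_sum]
    refine Finset.sum_congr rfl fun i _ => Finset.sum_congr rfl fun j _ => ?_
    rw [Geom.metricMat]
    ring
  have hcoord : ∀ k l, Geom.vecComp (A.prodChart q) ((A.prodChart q).symm y)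
      (Geom.coordVec (A.prodChart q) y k) l = if l = k then 1 else 0 := fun k l => by
    have h3 := Geom.vecComp_coordVec he hx k l
    have h4 : (Geom.coordVec (A.prodChart q) (A.prodChart q ((A.prodChart q).symm y)) k : Eucl 4)
        = Geom.coordVec (A.prodChart q) y k := by rw [hr]
    exact (congrArg (fun w : Eucl 4 =>
      Geom.vecComp (A.prodChart q) ((A.prodChart q).symm y) w l) h4.symm).trans h3
  -- Orthogonality to the tangential coordinate vectors leaves `ν` with only a radial lowered
  -- component.
  have hrow : ∀ i, ∑ j, Geom.metricMat (A.prodChart q) y i j * u j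
      = if i = Fin.last 3 then u (Fin.last 3) else 0 := fun i => by
    have h3 := hsum (Geom.coordVec (A.prodChart q) y i)
    simp only [hcoord, ite_mul, one_mul, zero_mul, Finset.sum_ite_eq', Finset.mem_univ,
      if_true] at h3
    rcases Fin.eq_castSucc_or_eq_last i with ⟨k, rfl⟩ | rfl
    · rw [← h3, if_neg (Fin.castSucc_lt_last k).ne]
      refine (real_inner_comm _ _).trans ?_
      exact (congrArg (fun w : TangentSpace (𝓡 4) ((A.prodChart q).symm y) =>
        Geom.metric ((A.prodChart q).symm y) ν w) (A.coordVec_prodChart_castSucc hy k)).trans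
        (h2 _)
    · simp only [fun j => hG.symm hy (Fin.last 3) j, hG.normal y hy, ite_mul, one_mul, zero_mul,
        Finset.sum_ite_eq', Finset.mem_univ, if_true]
  have hZ : ∀ Z, Geom.metric ((A.prodChart q).symm y) Z ν
      = u (Fin.last 3) * Geom.vecComp (A.prodChart q) ((A.prodChart q).symm y) Z (Fin.last 3) :=
    fun Z => by
      rw [hsum]
      simp only [hrow, mul_ite, mul_zero, Finset.sum_ite_eq', Finset.mem_univ, if_true]
      ring
  exact ⟨_, by rw [sq, ← h1, hZ], hZ⟩

/-- Fields orthogonal to the normal have no radial component along the slice. -/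
theorem IsAdaptedFrame.exists_metric_eq {A : ALFStructure M N B} {U : Set M}
    {e : Fin 4 → ∀ x : M, TangentSpace (𝓡 4) x} {y : Eucl 4} (hy : y ∈ (A.prodChart q).target)
    (he : A.IsAdaptedFrame ((euclSnoc 3).symm y).2 U e) (hU : (A.prodChart q).symm y ∈ U) :
    ∃ t : ℝ, t ^ 2 = 1 ∧ ∀ Z, Geom.metric ((A.prodChart q).symm y) Z (e 3 ((A.prodChart q).symm y))
      = t * Geom.vecComp (A.prodChart q) ((A.prodChart q).symm y) Z (Fin.last 3) :=
  A.exists_metric_normal_eq hy ((he.orthonormal _ hU 3 3).trans (if_pos rfl))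
    fun v => he.normal ((chartAt (Eucl 3) q).symm ((euclSnoc 3).symm y).1) hU v

/-- On the slice `e₄` is `±∂_ρ`, so vectors orthogonal to it have no radial component. This holds at
points of that one slice only. -/
theorem IsAdaptedFrame.vecComp_last_eq_zero {A : ALFStructure M N B} {U : Set M}
    {e : Fin 4 → ∀ x : M, TangentSpace (𝓡 4) x} {y : Eucl 4} (hy : y ∈ (A.prodChart q).target)
    (he : A.IsAdaptedFrame ((euclSnoc 3).symm y).2 U e) (hU : (A.prodChart q).symm y ∈ U)
    (j : Fin 3) : Geom.vecComp (A.prodChart q) ((A.prodChart q).symm y)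
      (e j.castSucc ((A.prodChart q).symm y)) (Fin.last 3) = 0 := by
  obtain ⟨t, ht, h⟩ := he.exists_metric_eq hy hU
  have h1 := h (e j.castSucc ((A.prodChart q).symm y))
  rw [he.orthonormal _ hU, if_neg (show j.castSucc ≠ (3 : Fin 4) from (Fin.castSucc_lt_last j).ne)]
    at h1
  have ht0 : t ≠ 0 := by rintro rfl; norm_num at ht
  exact (mul_eq_zero.1 h1.symm).resolve_left ht0

/-- The second fundamental form in terms of the shape operator of the radial foliation. -/
theorem IsAdaptedFrame.abs_secondFundForm_le {A : ALFStructure M N B} {U : Set M}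
    {e : Fin 4 → ∀ x : M, TangentSpace (𝓡 4) x} {y : Eucl 4} (hy : y ∈ (A.prodChart q).target)
    (he : A.IsAdaptedFrame ((euclSnoc 3).symm y).2 U e) (hU : (A.prodChart q).symm y ∈ U)
    (i j : Fin 3) : |secondFundForm e i j ((A.prodChart q).symm y)|
      ≤ 4 ^ 2 * √((Coord.gam (Geom.metricMat (A.prodChart q)) (Fin.last 3) y
        * Coord.gam (Geom.metricMat (A.prodChart q)) (Fin.last 3) y).trace) := by
  have hc := A.prodChart_mem_maximalAtlas (q := q)
  have hx := (A.prodChart q).map_target hy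
  have hG := A.isNormalMetricOn_prodChart (q := q)
  have hr := (A.prodChart q).right_inv hy
  set c := A.prodChart q with hcdef
  set v := Geom.vecComp c (c.symm y) (e i.castSucc (c.symm y)) with hv
  set w := Geom.vecComp c (c.symm y) (e j.castSucc (c.symm y)) with hw
  have hunit : ∀ k : Fin 4, ∑ a, ∑ b, Geom.metricMat c y a b
      * Geom.vecComp c (c.symm y) (e k (c.symm y)) a
      * Geom.vecComp c (c.symm y) (e k (c.symm y)) b = 1 := fun k => by
    have h1 := Geom.isBilin_metric.apply_eq_sum hc hx (e k (c.symm y)) (e k (c.symm y))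
    rw [he.orthonormal _ hU, if_pos rfl, hr] at h1
    exact h1.symm
  obtain ⟨t, ht, hZ⟩ := he.exists_metric_eq hy hU
  have h1 : secondFundForm e i j (c.symm y) = t * Geom.vecComp c (c.symm y)
      (Geom.covDerivVec (c.symm y) (e i.castSucc (c.symm y)) (e j.castSucc)) (Fin.last 3) := hZ _
  have ht1 : |t| = 1 := by
    rw [← abs_one]
    exact (sq_eq_sq_iff_abs_eq_abs t 1).1 (by rw [ht]; norm_num)
  rw [h1, abs_mul, ht1, one_mul,
    Geom.vecComp_covDerivVec hc hx _ he.isOpen hU (he.smooth j.castSucc), hr]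
  set Y : Fin 4 → Eucl 4 → ℝ := fun k y => Geom.vecComp c (c.symm y) (e j.castSucc (c.symm y)) k
    with hY
  have hV : IsOpen (c.target ∩ c.symm ⁻¹' U) := c.isOpen_inter_preimage_symm he.isOpen
  have hdiff : DifferentiableAt ℝ (Y (Fin.last 3)) y :=
    Coord.differentiableAt_of_contDiffOn hV ⟨hy, hU⟩ (Geom.contDiffOn_vecComp hc (he.smooth _) _)
  have hvl : v (Fin.last 3) = 0 := he.vecComp_last_eq_zero hy hU i
  -- The radial component of `eⱼ` vanishes along the slice, so its tangential derivatives are zero;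
  -- a radial derivative would carry the vanishing factor `v (Fin.last 3)`. Only the Christoffel
  -- term survives.
  have hpd : ∀ k, v k * Coord.pd k (Y (Fin.last 3)) y = 0 := fun k => by
    rcases Fin.eq_castSucc_or_eq_last k with ⟨k, rfl⟩ | rfl
    · rw [Coord.pd_eq_zero_of_line hdiff, mul_zero]
      have h2 : Continuous fun s : ℝ => y + s • (EuclideanSpace.single k.castSucc (1 : ℝ) : Eucl 4) := by
        fun_prop
      have h3 : y + (0 : ℝ) • (EuclideanSpace.single k.castSucc (1 : ℝ) : Eucl 4)
          ∈ c.target ∩ c.symm ⁻¹' U := by simpa using ⟨hy, hU⟩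
      filter_upwards [h2.continuousAt.preimage_mem_nhds (hV.mem_nhds h3)] with s hs
      refine IsAdaptedFrame.vecComp_last_eq_zero hs.1 ?_ hs.2 j
      have h4 : ((euclSnoc 3).symm
          (y + s • (EuclideanSpace.single k.castSucc (1 : ℝ) : Eucl 4))).2
          = ((euclSnoc 3).symm y).2 := by
        rw [map_add, map_smul, euclSnoc_single_castSucc]
        simp
      rwa [h4]
    · rw [hvl, zero_mul]
  have h5 : Coord.covVec (Geom.metricMat c) v Y (Fin.last 3) y
      = -∑ a, ∑ b, (Geom.metricMat c y * Coord.gam (Geom.metricMat c) (Fin.last 3) y) a b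
        * v a * w b := by
    simp only [Coord.covVec, mul_add, hpd, zero_add, hG.christoffel_normal_upper' hy,
      Finset.mul_sum, ← Finset.sum_neg_distrib]
    refine Finset.sum_congr rfl fun a _ => Finset.sum_congr rfl fun b _ => ?_
    simp only [hY, hw]
    ring
  rw [h5, abs_neg]
  have h6 := hG.abs_shape_le hy v w (hunit _) (hunit _)
  exact_mod_cast h6

/-- The frame enters only through unit vectors, so the bound reduces to the decay of `tr S²` along
the radial line through the boundary point. The starting radius is doubled because the Riccati
comparison looks back to half the radius. -/
theorem exists_abs_secondFundForm_le : ∃ C ρ₀ : ℝ, 0 ≤ C ∧ 1 ≤ ρ₀ ∧ ∀ r ≥ ρ₀, ∀ (U : Set M)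
    (e : Fin 4 → ∀ x : M, TangentSpace (𝓡 4) x), A.IsAdaptedFrame r U e → ∀ n : N,
      A.slice r n ∈ U → ∀ i j : Fin 3, |secondFundForm e i j (A.slice r n)| ≤ C * r⁻¹ := by
  obtain ⟨C, ρ₀, -, hC⟩ := A.curvature_decay 0
  set K : ℝ := (1 + 2 * ((4 : ℕ) : ℝ) ^ 4 * (|C| + 1))
    * (9 * (2 * ((4 : ℕ) : ℝ) ^ 4 * (|C| + 1)) + 1) with hK
  have hK0 : 0 ≤ K := by positivity
  refine ⟨4 ^ 2 * K, 2 * max ρ₀ 1, by positivity, by linarith [le_max_right ρ₀ 1], ?_⟩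
  intro r hr U e he n hn i j
  have hm1 : 1 ≤ max ρ₀ 1 := le_max_right _ _
  have hr0 : 0 < r := by linarith
  let γ : ℝ → Eucl 4 := fun t => euclSnoc 3 (chartAt (Eucl 3) n n, t)
  have hγt : ∀ t, 0 < t → γ t ∈ (A.prodChart n).target := fun t ht => by
    rw [A.mem_prodChart_target, ContinuousLinearEquiv.symm_apply_apply]
    exact ⟨(chartAt (Eucl 3) n).map_source (mem_chart_source _ n), ht⟩
  have hγs : ∀ t, (A.prodChart n).symm (γ t) = A.slice t n := fun t => by
    rw [A.prodChart_symm_apply, ContinuousLinearEquiv.symm_apply_apply,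
      (chartAt (Eucl 3) n).left_inv (mem_chart_source _ n)]
    rfl
  have hγd : ∀ t, HasDerivAt γ (EuclideanSpace.single (Fin.last 3) 1) t := fun t => by
    have h1 := (euclSnoc 3).hasFDerivAt.comp_hasDerivAt t
      ((hasDerivAt_const t (chartAt (Eucl 3) n n)).prodMk (hasDerivAt_id t))
    have h2 : (EuclideanSpace.single (Fin.last 3) 1 : Eucl 4) = euclSnoc 3 (0, 1) := by
      rw [← euclSnoc_single_last, ContinuousLinearEquiv.apply_symm_apply]
    rw [h2]
    exact h1
  have hq := A.isNormalMetricOn_prodChart.trace_shape_sq_le hγd hm1 (abs_nonneg C)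
    (fun t ht => hγt t (by linarith)) (fun t ht => ?_) hr
  · have hy := hγt r hr0
    have h3 : ((euclSnoc 3).symm (γ r)).2 = r := by
      rw [ContinuousLinearEquiv.symm_apply_apply]
    have h4 := IsAdaptedFrame.abs_secondFundForm_le (A := A) hy (by rwa [h3])
      (by rwa [hγs r]) i j
    rw [hγs r] at h4
    refine h4.trans ?_
    rw [mul_assoc]
    refine mul_le_mul_of_nonneg_left ?_ (by norm_num)
    refine Real.sqrt_le_iff.2 ⟨by positivity, ?_⟩
    rw [← div_eq_mul_inv]
    exact hq
  · have ht0 : 0 < t := by linarith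
    have hs : A.φ (n, t) ∈ (A.prodChart n).source :=
      (A.φ_mem_prodChart_source ht0).2 (mem_chart_source _ n)
    have h5 := hC t ((le_max_left _ _).trans ht) n _ A.prodChart_mem_maximalAtlas hs
    rw [Geom.nablaCurvNorm, A.prodChart_apply_φ ht0] at h5
    refine h5.trans ?_
    rw [div_eq_mul_inv]
    exact mul_le_mul_of_nonneg_right (le_abs_self C) (by positivity)

end ALFStructure

/-! ### The boundary integral. -/

namespace ALFStructure

variable {M N B : Type*}
  [TopologicalSpace M] [ChartedSpace (Eucl 4) M] [IsManifold (𝓡 4) ∞ M]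
  [RiemannianBundle (fun x : M => TangentSpace (𝓡 4) x)]
  [IsContMDiffRiemannianBundle (𝓡 4) ∞ (Eucl 4) (fun x : M => TangentSpace (𝓡 4) x)]
  [TopologicalSpace N] [ChartedSpace (Eucl 3) N] [IsManifold (𝓡 3) ∞ N]
  [TopologicalSpace B] [ChartedSpace (Eucl 2) B] [IsManifold (𝓡 2) ∞ B]
  (A : ALFStructure M N B)

/-- The derivative of a smooth function along a continuous vector field is continuous. -/
theorem _root_.Continuous.mfderiv_apply {d : ℕ} {X Y : Type*} [TopologicalSpace X]
    [ChartedSpace (Eucl d) X] [IsManifold (𝓡 d) ∞ X] [TopologicalSpace Y] {g : Y → X}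
    {ν : ∀ y : Y, TangentSpace (𝓡 d) (g y)}
    (hν : Continuous fun y => (⟨g y, ν y⟩ : TangentBundle (𝓡 d) X)) {f : X → ℝ}
    (hf : ContMDiff (𝓡 d) 𝓘(ℝ, ℝ) ∞ f) :
    Continuous fun y => (mfderiv (𝓡 d) 𝓘(ℝ, ℝ) f (g y) (ν y) : ℝ) := by
  have h1 := (hf.continuous_tangentMap (by simp)).comp hν
  have h2 := (tangentBundleModelSpaceHomeomorph 𝓘(ℝ, ℝ)).continuous.comp h1
  exact continuous_snd.comp h2

variable [T2Space N] [CompactSpace N] [Nonempty N] [MeasurableSpace N] [BorelSpace N]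

/-- A continuous integrand of size `O(r⁻⁴)`, integrated over a compact slice of volume `O(r³)`. -/
theorem exists_integral_normal_derivative_le : ∃ C : ℝ, ∀ᶠ r in atTop,
    ∀ ν : ∀ n : N, TangentSpace (𝓡 4) (A.slice r n), A.IsUnitNormal r ν →
      Integrable (fun n => (mfderiv (𝓡 4) 𝓘(ℝ, ℝ) (Geom.scalarCurv (M := M) 4)
          (A.slice r n) (ν n) : ℝ)) (Geom.volumeMeasure (A.sliceMetric r)) ∧
      |∫ n, (mfderiv (𝓡 4) 𝓘(ℝ, ℝ) (Geom.scalarCurv (M := M) 4) (A.slice r n) (ν n) : ℝ)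
        ∂(Geom.volumeMeasure (A.sliceMetric r))| ≤ C * r⁻¹ := by
  obtain ⟨C₁, ρ₀, hC₁, hρ₀, hds⟩ := A.exists_abs_mfderiv_scalarCurv_le
  obtain ⟨C₂, hC₂, hvol⟩ := A.exists_volume_slice_le
  refine ⟨C₁ * C₂, ?_⟩
  filter_upwards [hvol, eventually_ge_atTop ρ₀] with r hvol hr ν hν
  have hr0 : 0 < r := by linarith
  set μ := Geom.volumeMeasure (A.sliceMetric r)
  have hfin : IsFiniteMeasure μ := ⟨hvol.trans_lt ENNReal.ofReal_lt_top⟩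
  set F : N → ℝ := fun n =>
    mfderiv (𝓡 4) 𝓘(ℝ, ℝ) (Geom.scalarCurv (M := M) 4) (A.slice r n) (ν n)
  have hF : Continuous F := hν.continuous.mfderiv_apply Geom.contMDiff_scalarCurv
  have hb : ∀ n, ‖F n‖ ≤ C₁ * (r ^ 4)⁻¹ := fun n => hds r hr n (ν n) (hν.unit n)
  refine ⟨Integrable.of_bound hF.aestronglyMeasurable _ (Eventually.of_forall hb), ?_⟩
  rw [← Real.norm_eq_abs]
  refine (norm_integral_le_of_norm_le_const (Eventually.of_forall hb)).trans ?_
  have h1 : μ.real univ ≤ C₂ * r ^ 3 := ENNReal.toReal_le_of_le_ofReal (by positivity) hvol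
  refine (mul_le_mul_of_nonneg_left h1 (by positivity)).trans (le_of_eq ?_)
  field_simp

end ALFStructure

/-! ### Passage to the cut-off radius `R ρ = ρ + O(1)` and conclusion. -/

theorem eventually_half_le_of_sub_isBigO_one {R : ℝ → ℝ}
    (hR : (fun ρ => R ρ - ρ) =O[atTop] (fun _ => (1 : ℝ))) :
    ∀ᶠ ρ in atTop, ρ / 2 ≤ R ρ := by
  obtain ⟨c, hc⟩ := hR.bound
  filter_upwards [hc, eventually_ge_atTop (2 * c)] with ρ h1 h2
  rw [norm_one, mul_one, Real.norm_eq_abs, abs_le] at h1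
  linarith [h1.1]

theorem mainTheorem7 {M N B : Type*}
    -- a connected, complete Riemannian 4-manifold
    [MetricSpace M] [ChartedSpace (Eucl 4) M] [IsManifold (𝓡 4) ∞ M]
    [RiemannianBundle (fun x : M => TangentSpace (𝓡 4) x)]
    [IsContMDiffRiemannianBundle (𝓡 4) ∞ (Eucl 4) (fun x : M => TangentSpace (𝓡 4) x)]
    [IsRiemannianManifold (𝓡 4) M] [CompleteSpace M] [ConnectedSpace M] [SigmaCompactSpace M]
    [MeasurableSpace M] [BorelSpace M]
    -- a connected, compact 3-manifold
    [TopologicalSpace N] [T2Space N] [CompactSpace N] [ConnectedSpace N]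
    [ChartedSpace (Eucl 3) N] [IsManifold (𝓡 3) ∞ N] [MeasurableSpace N] [BorelSpace N]
    -- a compact surface
    [TopologicalSpace B] [T2Space B] [CompactSpace B] [ConnectedSpace B]
    [ChartedSpace (Eucl 2) B] [IsManifold (𝓡 2) ∞ B]
    (A : ALFStructure M N B)
    -- the truncations, cut off at the radial coordinate `R ρ = ρ + O(1)`
    (R : ℝ → ℝ) (hR : (fun ρ => R ρ - ρ) =O[atTop] (fun _ => (1 : ℝ))) :
    -- the bulk integral
    ((∀ᶠ ρ in atTop, IntegrableOn (Geom.laplace 4 (Geom.scalarCurv (M := M) 4))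
        (A.truncation (R ρ)) (Geom.volumeMeasure (Geom.metric (d := 4) (M := M)))) ∧
      Tendsto (fun ρ => ∫ x in A.truncation (R ρ),
          Geom.laplace 4 (Geom.scalarCurv (M := M) 4) x
            ∂(Geom.volumeMeasure (Geom.metric (d := 4) (M := M))))
        atTop (𝓝 0)) ∧
    -- the boundary integral, for every choice of the unit normals `e₄`
    (∀ ν : ∀ (ρ : ℝ) (n : N), TangentSpace (𝓡 4) (A.slice (R ρ) n),
      (∀ᶠ ρ in atTop, A.IsUnitNormal (R ρ) (ν ρ)) →
      (∀ᶠ ρ in atTop, Integrable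
        (fun n => (mfderiv (𝓡 4) 𝓘(ℝ, ℝ) (Geom.scalarCurv (M := M) 4)
          (A.slice (R ρ) n) (ν ρ n) : ℝ))
        (Geom.volumeMeasure (A.sliceMetric (R ρ)))) ∧
      Tendsto (fun ρ => ∫ n,
          (mfderiv (𝓡 4) 𝓘(ℝ, ℝ) (Geom.scalarCurv (M := M) 4)
            (A.slice (R ρ) n) (ν ρ n) : ℝ)
            ∂(Geom.volumeMeasure (A.sliceMetric (R ρ))))
        atTop (𝓝 0)) ∧
    -- the second fundamental form, uniformly in the boundary point and the adapted frame
    (∃ C ρ₁ : ℝ, 0 < ρ₁ ∧ ∀ ρ ≥ ρ₁,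
      ∀ (U : Set M) (e : Fin 4 → ∀ x : M, TangentSpace (𝓡 4) x),
        A.IsAdaptedFrame (R ρ) U e → ∀ n : N, A.slice (R ρ) n ∈ U →
          ∀ i j : Fin 3, |secondFundForm e i j (A.slice (R ρ) n)| ≤ C * ρ⁻¹) := by
  have hR2 := eventually_half_le_of_sub_isBigO_one hR
  have hRt : Tendsto R atTop atTop :=
    tendsto_atTop_mono' atTop hR2 (tendsto_id.atTop_div_const two_pos)
  have hinv : Tendsto (fun ρ => (R ρ)⁻¹) atTop (𝓝 0) := tendsto_inv_atTop_zero.comp hRt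
  refine ⟨⟨?_, ?_⟩, ?_, ?_⟩
  · filter_upwards [hRt.eventually_ge_atTop 0] with ρ hρ
    exact A.integrableOn_laplace Geom.contMDiff_scalarCurv hρ
  · obtain ⟨C, hC⟩ := A.exists_abs_integral_laplace_le
    have h0 : Tendsto (fun ρ => C * (R ρ)⁻¹) atTop (𝓝 0) := by simpa using hinv.const_mul C
    exact squeeze_zero_norm' (hRt.eventually hC) h0
  · intro ν hν
    obtain ⟨C, hC⟩ := A.exists_integral_normal_derivative_le
    have h0 : Tendsto (fun ρ => C * (R ρ)⁻¹) atTop (𝓝 0) := by simpa using hinv.const_mul C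
    have h1 := (hRt.eventually hC).and hν
    exact ⟨h1.mono fun ρ h => (h.1 (ν ρ) h.2).1,
      squeeze_zero_norm' (h1.mono fun ρ h => (h.1 (ν ρ) h.2).2) h0⟩
  · obtain ⟨C, ρ₀, hC, hρ₀, h⟩ := A.exists_abs_secondFundForm_le
    obtain ⟨ρ₁, hρ₁⟩ := eventually_atTop.1 (hR2.and (hRt.eventually_ge_atTop ρ₀))
    refine ⟨2 * C, max ρ₁ 1, by positivity, fun ρ hρ U e he n hn i j => ?_⟩
    obtain ⟨h1, h2⟩ := hρ₁ ρ ((le_max_left _ _).trans hρ)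
    have hρ1 : 1 ≤ ρ := (le_max_right _ _).trans hρ
    refine (h (R ρ) h2 U e he n hn i j).trans ?_
    -- The lower bound `ρ / 2 ≤ R ρ` converts decay in the cut-off radius into decay in `ρ`, at the
    -- cost of a factor `2`.
    have h3 : (R ρ)⁻¹ ≤ 2 * ρ⁻¹ := by
      have h4 := inv_anti₀ (by positivity : 0 < ρ / 2) h1
      rwa [inv_div, div_eq_mul_inv] at h4
    calc C * (R ρ)⁻¹ ≤ C * (2 * ρ⁻¹) := mul_le_mul_of_nonneg_left h3 hC
      _ = 2 * C * ρ⁻¹ := by ring
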